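/- **Notation.** Let $k\ge 3$. Write $\|t\|$ for the distance from $t\in\mathbb R$ to the nearest integer and $\lambda$ for Lebesgue measure on $[0,1]^k$. A *bump function* is a non-zero smooth compactly supported function $\mathbb R\to[0,1]$. For $a,b\in\mathbb R$ let $\omega^*(a,b)$ be the supremum of the real $w$ for which $\|n_1a+n_2b\|<|\mathbf n|_\infty^{-w}$ has infinitely many solutions $\mathbf n\in\mathbb Z^2$. Let $\mathcal H\subset\mathbb R^k$ be an affine hyperplane with normal vector $\boldsymbol\alpha=(1,\alpha_2,\dots,\alpha_k)$, and put $\omega_2(\mathcal H)=\max_{2\le i<j\le k}\omega^*(\alpha_i,\alpha_j)$. **Measures.** Fix $B_1,\dots,B_{k-1}>0$, $r_1,\dots,r_{k-1}>0$ and bump functions $b_1,\dots,b_k$ supported on $[-2,2]$. Let $\mu_k$ be Lebesgue measure on $\prod_{j<k}[-B_j,B_j]\times\{0\}$. For $\eta>0$ let $\mathfrak b_\eta(\mathbf x)=b_k(x_k/\eta)\prod_{j<k}b_j(x_j/r_j)$, and let $\mu_\eta$ be the image of the probability measure with density $(\mu_k*\mathfrak b_\eta)/\|\mu_k*\mathfrak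 b_\eta\|_1$ under a rigid motion of $\mathbb R^k$ that takes $\{x_k=0\}$ to $\mathcal H$ and whose linear part takes the $k$-th basis vector to $\boldsymbol\alpha/|\boldsymbol\alpha|$. Let $\mu_0$, a probability measure on $\mathcal H$, be the weak limit of $\mu_\eta$ as $\eta\to0^+$. **Admissible function systems.** Let $0<\tau<1/k$ and $\mathbf y\in\mathbb R^k$. For $m\ge1$ let $D_m=[2^{m-1},2^m)$ and let $I_m$ be a finite index set. For $i\in I_m$ and $1\le j\le k$ let $d_{i,j}=d_{i,j,m}>0$ satisfy $d_{i,j}\le 1/(2n)$ and $$n^{-(1+1/k+\tau)}\ll d_{i,j}\ll n^{-(1+1/k-\tau)}\qquad(n\in D_m),$$ uniformly in $m,i,j,n$, with $\prod_jd_{i,j}$ independent of $i\in I_m$. Each pair $(i,j)$ is assigned one of two types; for $n\in D_m$ put $\mathcal U_{i,j}=[0,nd_{i,j})$ for the first type and $\mathcal U_{i,j}=[nd_{i,j}/2,nd_{i,j})$ for the second. Assume that for $n\in D_m$ the sets $\{\mathbf x\in[0,1]^k:\|nx_j-y_j\|\in\mathcal U_{i,j}\ \forall j\}$ $(i\in I_m)$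 are pairwise disjoint, and that their union is $[0,1]^k\cap(\mathcal Z+n^{-1}(\mathbf y+\mathbb Z^k))$ for some $\mathcal Z\subseteq[-\frac12,\frac12]^k$ such that $\mathbf x\in\mathcal Z$ and $|z_j|\le|x_j|$ for all $j$ imply $\mathbf z\in\mathcal Z$. Fix bump functions $\varpi_1$, supported on $\{|x|<1\}$, and $\varpi_2$, supported on $\{\frac12\le|x|<1\}$; let $b_{i,j}=\varpi_1$ if $(i,j)$ has the first type and $b_{i,j}=\varpi_2$ otherwise. The admissible function system with parameter $\tau$ is $$f_n(\mathbf x)=\sum_{i\in I_m}\ \sum_{\mathbf a\in\mathbb Z^k}\ \prod_{j\le k}b_{i,j}\!\left(\frac{x_j-(a_j+y_j)/n}{d_{i,j}}\right)\qquad(n\in D_m).$$ **Variance transference.** For a measure $\mu$ write $\mu(f)=\int f\,d\mu$, $E_N(\mu)=\sum_{n\le N}\mu(f_n)$ and $V_N(\mu)=\int\big(\sum_{n\le N}(f_n-\lambda(f_n))\big)^2d\mu$. *VTP holds for $(f_n)$ and $\mu$* if $V_N(\mu)=V_N(\lambda)+o(E_N(\mu)^2)+O(1)$ along some sequence of $N\to\infty$.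 **Theorem.** (1) Suppose $\omega_2(\mathcal H)<\infty$. There is a constant $C_0>0$ depending only on $\mathcal H$ such that the following holds. For all $\mu_\eta$ as above, every $\tau$, every admissible function system $(f_n)$ with parameter $\tau$, and every $\varepsilon>0$, there is a constant $K$, independent of $\eta$ and $N$, such that for all $\eta>0$ and all $N$ $$|V_N(\mu_\eta)-V_N(\lambda)|\le K\sum_{n,n'\le N}\lambda(f_n)\lambda(f_{n'})\,(nn')^{(2\omega_2(\mathcal H)+4-k+C_0\tau+\varepsilon)/(2k)}.$$ (2) Suppose $k>2\omega_2(\mathcal H)+4$. There is $\tau_0>0$ depending only on $\mathcal H$ such that, for all $\mu_0$ as above and every admissible function system $(f_n)$ with parameter $\tau<\tau_0$, VTP holds for $(f_n)$ and $\mu_0$. -/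

import Mathlib

open MeasureTheory Filter Topology Asymptotics
open scoped ContDiff Matrix

noncomputable section

namespace FlatVTP

/-! ### Diophantine exponents -/

/-- The distance from `t` to the nearest integer. -/
def distInt (t : ℝ) : ℝ := |t - round t|

/-- The dual exponent `ω*(x)`: the supremum of the real `w` for which there are infinitely many
integer vectors `a` with `‖a · x‖ < |a|_∞ ^ (-w)`.  The supremum is taken in the extended reals. -/
def dualExponent {m : ℕ} (x : Fin m → ℝ) : EReal :=
  sSup ((fun w : ℝ => (w : EReal)) ''
    {w : ℝ | {a : Fin m → ℤ | distInt (∑ i, (a i : ℝ) * x i) < ‖a‖ ^ (-w)}.Infinite})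

/-- `ω₂ = max_{i < j} ω*(α_i, α_j)`. -/
def omegaTwo {d : ℕ} (α : Fin d → ℝ) : EReal :=
  ⨆ (i : Fin d) (j : Fin d) (_ : i < j), dualExponent ![α i, α j]

/-! ### Expectation, variance and the variance transference principle -/

/-- Lebesgue measure on the unit cube `[0,1]^k`. -/
def lam (k : ℕ) : Measure (Fin k → ℝ) := volume.restrict (Set.Icc 0 1)

/-- `E_N(μ) = ∑_{n ≤ N} μ(f_n)`. -/
def expectation {k : ℕ} (f : ℕ → (Fin k → ℝ) → ℝ) (N : ℕ) (μ : Measure (Fin k → ℝ)) : ℝ :=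
  ∑ n ∈ Finset.Icc 1 N, ∫ x, f n x ∂μ

/-- `V_N(μ) = ∫ (∑_{n ≤ N} (f_n(x) - λ(f_n)))² dμ(x)`. -/
def variance {k : ℕ} (f : ℕ → (Fin k → ℝ) → ℝ) (N : ℕ) (μ : Measure (Fin k → ℝ)) : ℝ :=
  ∫ x, (∑ n ∈ Finset.Icc 1 N, (f n x - ∫ z, f n z ∂(lam k))) ^ 2 ∂μ

/-- The variance transference principle:
`V_N(μ) = V_N(λ) + o(E_N(μ)²) + O(1)` along a sequence of `N → ∞`. -/
def VTP {k : ℕ} (f : ℕ → (Fin k → ℝ) → ℝ) (μ : Measure (Fin k → ℝ)) : Prop :=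
  ∃ N : ℕ → ℕ, StrictMono N ∧ ∃ e₁ e₂ : ℕ → ℝ,
    (∀ j, variance f (N j) μ = variance f (N j) (lam k) + e₁ j + e₂ j) ∧
    e₁ =o[atTop] (fun j => expectation f (N j) μ ^ 2) ∧
    e₂ =O[atTop] (fun _ => (1 : ℝ))

/-! ### Bump functions -/

/-- A non-zero bump function `b : ℝ → [0,1]`: smooth and compactly supported. -/
structure IsBump (b : ℝ → ℝ) : Prop where
  smooth : ContDiff ℝ ∞ b
  compact : HasCompactSupport b
  mem_Icc : ∀ x, b x ∈ Set.Icc (0 : ℝ) 1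
  nonzero : ∃ x, b x ≠ 0

/-! ### Admissible set systems and admissible function systems -/

/-- The interval attached to a scale `s` at level `n`: `[0, ns)` if `core` is true and
`[ns/2, ns)` otherwise. -/
def scaleInterval (n : ℕ) (s : ℝ) (core : Bool) : Set ℝ :=
  if core then Set.Ico 0 (n * s) else Set.Ico (n * s / 2) (n * s)

/-- The set of `x ∈ [0,1]^k` with `‖n x_j - y_j‖ ∈ U_j` for all `j`, where `U_j` is the interval
attached to the scale `s_j`. -/
def boxSet {k : ℕ} (y : Fin k → ℝ) (n : ℕ) (s : Fin k → ℝ) (core : Fin k → Bool) :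
    Set (Fin k → ℝ) :=
  {x | x ∈ Set.Icc 0 1 ∧ ∀ j, distInt (n * x j - y j) ∈ scaleInterval n (s j) (core j)}

/-- The smooth `n⁻¹`-periodic analogue of `boxSet`:
`∑_{a ∈ ℤ^k} ∏_j b_j((x_j - (a_j + y_j)/n) / s_j)`. -/
def boxFun {k : ℕ} (y : Fin k → ℝ) (n : ℕ) (s : Fin k → ℝ) (b : Fin k → ℝ → ℝ)
    (x : Fin k → ℝ) : ℝ :=
  ∑' a : Fin k → ℤ, ∏ j, b j ((x j - (a j + y j) / n) / s j)

/-- Strongly star-shaped sets. -/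
def StronglyStarShaped {k : ℕ} (Z : Set (Fin k → ℝ)) : Prop :=
  ∀ x ∈ Z, ∀ z : Fin k → ℝ, (∀ j, |z j| ≤ |x j|) → z ∈ Z

/-- The part in the unit cube of a set with Property `P_n(y)`:
`X = [0,1]^k ∩ (Z + n⁻¹ (y + ℤ^k))` for some strongly star-shaped `Z ⊆ [-1/2, 1/2]^k`. -/
def PropertyP {k : ℕ} (n : ℕ) (y : Fin k → ℝ) (X : Set (Fin k → ℝ)) : Prop :=
  ∃ Z : Set (Fin k → ℝ), (∀ z ∈ Z, ∀ j, |z j| ≤ 1 / 2) ∧ StronglyStarShaped Z ∧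
    X = {x | x ∈ Set.Icc 0 1 ∧
      ∃ z ∈ Z, ∃ a : Fin k → ℤ, ∀ j, x j = z j + (y j + a j) / n}

/-- The index `m` of the dyadic block `D_m = [2^(m-1), 2^m)` containing `n ≥ 1`. -/
def block (n : ℕ) : ℕ := Nat.log 2 n + 1

/-- The data of an admissible set system and of an associated admissible function system, with
parameter `τ`. -/
structure AdmissibleSystem (k : ℕ) (τ : ℝ) where
  /-- the inhomogeneous shift -/
  y : Fin k → ℝ
  /-- the index set `I_m` is `Fin (size m)` -/
  size : ℕ → ℕ
  /-- the scales `d_{i,j} = d_{i,j,m}` -/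
  scale : (m : ℕ) → Fin (size m) → Fin k → ℝ
  /-- whether the interval attached to `d_{i,j}` is `[0, n d_{i,j})` or
  `[n d_{i,j} / 2, n d_{i,j})` -/
  core : (m : ℕ) → Fin (size m) → Fin k → Bool
  /-- the bump function used for intervals `[0, n d_{i,j})` -/
  w₁ : ℝ → ℝ
  /-- the bump function used for intervals `[n d_{i,j} / 2, n d_{i,j})` -/
  w₂ : ℝ → ℝ
  tau_pos : 0 < τ
  tau_lt : τ < 1 / k
  scale_pos : ∀ m i j, 0 < scale m i j
  scale_le : ∀ n : ℕ, 1 ≤ n → ∀ i j, scale (block n) i j ≤ 1 / (2 * n)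
  /-- `n^(-(1 + 1/k + τ)) ≪ d_{i,j} ≪ n^(-(1 + 1/k - τ))` for `n ∈ D_m` -/
  scale_bounds : ∃ c C : ℝ, 0 < c ∧ 0 < C ∧ ∀ n : ℕ, 1 ≤ n → ∀ i j,
    c * (n : ℝ) ^ (-(1 + 1 / (k : ℝ) + τ)) ≤ scale (block n) i j ∧
    scale (block n) i j ≤ C * (n : ℝ) ^ (-(1 + 1 / (k : ℝ) - τ))
  prod_scale : ∀ m i i', ∏ j, scale m i j = ∏ j, scale m i' j
  disjoint : ∀ n : ℕ, 1 ≤ n → ∀ i i', i ≠ i' →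
    Disjoint (boxSet y n (scale (block n) i) (core (block n) i))
      (boxSet y n (scale (block n) i') (core (block n) i'))
  propertyP : ∀ n : ℕ, 1 ≤ n →
    PropertyP n y (⋃ i, boxSet y n (scale (block n) i) (core (block n) i))
  bump₁ : IsBump w₁
  supp₁ : Function.support w₁ ⊆ {x | |x| < 1}
  bump₂ : IsBump w₂
  supp₂ : Function.support w₂ ⊆ {x | 1 / 2 ≤ |x| ∧ |x| < 1}

/-- The admissible function system `(f_n)`. -/
def AdmissibleSystem.fn {k : ℕ} {τ : ℝ} (S : AdmissibleSystem k τ) (n : ℕ) (x : Fin k → ℝ) : ℝ :=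
  ∑ i, boxFun S.y n (S.scale (block n) i)
    (fun j => if S.core (block n) i j then S.w₁ else S.w₂) x

/-! ### The measures `μ_η` and `μ_0`

Here `k = d + 1`, and `α = (α_2, …, α_k)` is indexed by `Fin d`. -/

/-- The normal vector `(1, α_2, …, α_k)`. -/
def normal {d : ℕ} (α : Fin d → ℝ) : Fin (d + 1) → ℝ := Fin.cons (1 : ℝ) α

/-- The affine hyperplane `{x : x_1 + α_2 x_2 + ⋯ + α_k x_k = c}`. -/
def hyperplane {d : ℕ} (α : Fin d → ℝ) (c : ℝ) : Set (Fin (d + 1) → ℝ) :=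
  {x | normal α ⬝ᵥ x = c}

/-- The embedding `s ↦ (s, 0)` of `ℝ^(k-1)` as the hyperplane `{x_k = 0}`. -/
def embed {d : ℕ} (s : Fin d → ℝ) : Fin (d + 1) → ℝ := Fin.snoc s (0 : ℝ)

/-- Data for the construction of the smooth measures near a hyperplane `H` with normal vector
`(1, α_2, …, α_k)`: a box, mollifying scales, bump functions and a rigid motion
`x ↦ R x + p` taking `{x_k = 0}` to `H`. -/
structure FlatData {d : ℕ} (α : Fin d → ℝ) (c : ℝ) where
  /-- the box is `∏_j [-B_j, B_j]` -/
  B : Fin d → ℝ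
  /-- the mollifying scales -/
  r : Fin d → ℝ
  /-- the bump functions -/
  b : Fin (d + 1) → ℝ → ℝ
  /-- the rotation -/
  R : Matrix (Fin (d + 1)) (Fin (d + 1)) ℝ
  /-- the translation -/
  p : Fin (d + 1) → ℝ
  B_pos : ∀ j, 0 < B j
  r_pos : ∀ j, 0 < r j
  bump : ∀ j, IsBump (b j)
  supp : ∀ j, Function.support (b j) ⊆ Set.Icc (-2) 2
  R_mem : R ∈ Matrix.orthogonalGroup (Fin (d + 1)) ℝ
  /-- the rotation takes the last basis vector to the unit vector in the direction
  `(1, α_2, …, α_k)` -/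
  R_last : √(normal α ⬝ᵥ normal α) • (R *ᵥ Pi.single (Fin.last d) 1) = normal α
  p_mem : p ∈ hyperplane α c

namespace FlatData

variable {d : ℕ} {α : Fin d → ℝ} {c : ℝ} (D : FlatData α c)

/-- `b_1(x_1/r_1) ⋯ b_{k-1}(x_{k-1}/r_{k-1}) b_k(x_k/η)`. -/
def mollifier (η : ℝ) (x : Fin (d + 1) → ℝ) : ℝ :=
  (∏ j : Fin d, D.b j.castSucc (x j.castSucc / D.r j)) *
    D.b (Fin.last d) (x (Fin.last d) / η)

/-- Lebesgue measure on the part of the hyperplane `{x_k = 0}` in the box. -/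
def plate : Measure (Fin (d + 1) → ℝ) :=
  (volume.restrict (Set.Icc (-D.B) D.B)).map embed

/-- The convolution of `plate` and `mollifier η`. -/
def density (η : ℝ) (x : Fin (d + 1) → ℝ) : ℝ :=
  ∫ z, D.mollifier η (x - z) ∂D.plate

/-- The rigid motion taking `{x_k = 0}` to the hyperplane. -/
def motion (x : Fin (d + 1) → ℝ) : Fin (d + 1) → ℝ := D.R *ᵥ x + D.p

/-- The measure `μ_η`: the probability measure with density proportional to `density η`,
transported by the rigid motion. -/
def muEta (η : ℝ) : Measure (Fin (d + 1) → ℝ) :=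
  (volume.withDensity fun x =>
    ENNReal.ofReal (D.density η x / ∫ z, D.density η z)).map D.motion

/-- The limiting density on `{x_k = 0}`, i.e. the convolution on `ℝ^(k-1)` of the indicator
function of the box and `b_1(s_1/r_1) ⋯ b_{k-1}(s_{k-1}/r_{k-1})`. -/
def density₀ (s : Fin d → ℝ) : ℝ :=
  ∫ z in Set.Icc (-D.B) D.B, ∏ j : Fin d, D.b j.castSucc ((s j - z j) / D.r j)

/-- The measure `μ_0` on the hyperplane, i.e. the weak limit of `μ_η` as `η → 0+`: the
probability measure on `{x_k = 0}` with density proportional to `density₀`, transported by the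
rigid motion. (One has `density η (s, t) = density₀ s * b_k (t / η)`.) -/
def muZero : Measure (Fin (d + 1) → ℝ) :=
  (volume.withDensity fun s =>
    ENNReal.ofReal (D.density₀ s / ∫ z, D.density₀ z)).map fun s => D.motion (embed s)

end FlatData

end FlatVTP

end

noncomputable section

namespace FlatVTP

/-! ### Diophantine lower bounds -/

lemma distInt_nonneg (t : ℝ) : 0 ≤ distInt t := abs_nonneg _

lemma distInt_le_half (t : ℝ) : distInt t ≤ 1 / 2 := abs_sub_round t

lemma distInt_le_abs_add (t : ℝ) (z : ℤ) : distInt t ≤ |t + z| := by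
  have := round_le t (-z)
  simpa [distInt] using this

/-- A real `w` exceeding the dual exponent gives a uniform lower bound. -/
lemma exists_distInt_lower_bound {m : ℕ} {x : Fin m → ℝ} {w : ℝ}
    (hw : dualExponent x < (w : EReal)) :
    ∃ c : ℝ, 0 < c ∧ ∀ a : Fin m → ℤ, a ≠ 0 → c * ‖a‖ ^ (-w) ≤ distInt (∑ i, (a i : ℝ) * x i) := by
  have hfin : {a : Fin m → ℤ | distInt (∑ i, (a i : ℝ) * x i) < ‖a‖ ^ (-w)}.Finite := by
    by_contra h
    refine absurd hw (not_lt.2 ?_)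
    exact le_sSup ⟨w, h, rfl⟩
  have hpos : ∀ a : Fin m → ℤ, a ≠ 0 → 0 < distInt (∑ i, (a i : ℝ) * x i) := by
    intro a ha
    refine lt_of_le_of_ne (distInt_nonneg _) fun h0 => ?_
    have hint : ∑ i, (a i : ℝ) * x i = (round (∑ i, (a i : ℝ) * x i) : ℝ) := by
      have := h0.symm
      rw [distInt, abs_eq_zero, sub_eq_zero] at this
      exact this
    set r := round (∑ i, (a i : ℝ) * x i)
    refine Set.infinite_of_injective_forall_mem (f := fun t : ℕ => ((t + 1 : ℕ) : ℤ) • a) ?_ ?_ hfin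
    · intro s t hst
      obtain ⟨i, hi⟩ := Function.ne_iff.1 ha
      have := congrFun hst i
      simp only [Pi.smul_apply, smul_eq_mul, Pi.zero_apply] at this hi
      have := mul_right_cancel₀ hi this
      push_cast at this
      omega
    · intro t
      have hz : (((t + 1 : ℕ) : ℤ) • a) ≠ 0 := smul_ne_zero (by omega) ha
      have : ∑ i, (((((t + 1 : ℕ) : ℤ) • a) i : ℤ) : ℝ) * x i = (((t + 1 : ℕ) : ℤ) * r : ℤ) := by
        simp only [Pi.smul_apply, smul_eq_mul, Int.cast_mul, mul_assoc]
        rw [← Finset.mul_sum, hint]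
      simp only [Set.mem_ofPred_eq]
      rw [this]
      have h2 : distInt ((((t + 1 : ℕ) : ℤ) * r : ℤ) : ℝ) = 0 := by
        rw [distInt, round_intCast]; simp
      rw [h2]
      exact Real.rpow_pos_of_pos (norm_pos_iff.2 hz) _
  obtain ⟨c, hc0, hc⟩ : ∃ c : ℝ, 0 < c ∧ ∀ a ∈ hfin.toFinset, a ≠ 0 →
      c * ‖a‖ ^ (-w) ≤ distInt (∑ i, (a i : ℝ) * x i) := by
    induction hfin.toFinset using Finset.induction_on with
    | empty => exact ⟨1, one_pos, by simp⟩
    | insert b s _ ih =>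
      obtain ⟨c, hc0, hc⟩ := ih
      by_cases hb : b = 0
      · refine ⟨c, hc0, fun a ha ha0 => ?_⟩
        rcases Finset.mem_insert.1 ha with h | h
        · exact absurd (h.trans hb) ha0
        · exact hc a h ha0
      · have hn : 0 < ‖b‖ ^ (-w) := Real.rpow_pos_of_pos (norm_pos_iff.2 hb) _
        refine ⟨min c (distInt (∑ i, (b i : ℝ) * x i) / ‖b‖ ^ (-w)),
          lt_min hc0 (div_pos (hpos b hb) hn), fun a ha ha0 => ?_⟩
        rcases Finset.mem_insert.1 ha with h | h
        · subst h
          calc _ ≤ distInt (∑ i, (a i : ℝ) * x i) / ‖a‖ ^ (-w) * ‖a‖ ^ (-w) := by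
                gcongr; exact min_le_right _ _
            _ = _ := div_mul_cancel₀ _ hn.ne'
        · refine le_trans ?_ (hc a h ha0)
          gcongr; exact min_le_left _ _
  refine ⟨min c 1, lt_min hc0 one_pos, fun a ha => ?_⟩
  have hn : 0 ≤ ‖a‖ ^ (-w) := Real.rpow_nonneg (norm_nonneg _) _
  by_cases h : a ∈ hfin.toFinset
  · exact le_trans (by gcongr; exact min_le_left _ _) (hc a h ha)
  · rw [Set.Finite.mem_toFinset, Set.mem_ofPred_eq, not_lt] at h
    refine le_trans ?_ h
    calc min c 1 * ‖a‖ ^ (-w) ≤ 1 * ‖a‖ ^ (-w) := by gcongr; exact min_le_right _ _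
      _ = _ := one_mul _

lemma dualExponent_nonneg {m : ℕ} [NeZero m] (x : Fin m → ℝ) : 0 ≤ dualExponent x := by
  refine le_sSup ⟨0, ?_, by simp⟩
  have : {a : Fin m → ℤ | distInt (∑ i, (a i : ℝ) * x i) < ‖a‖ ^ (-(0 : ℝ))} = Set.univ := by
    ext a
    simp only [neg_zero, Real.rpow_zero, Set.mem_ofPred_eq, Set.mem_univ, iff_true]
    linarith [distInt_le_half (∑ i, (a i : ℝ) * x i)]
  rw [Set.mem_ofPred_eq, this]
  exact Set.infinite_univ

lemma dualExponent_le_omegaTwo {d : ℕ} (α : Fin d → ℝ) {i j : Fin d} (h : i < j) :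
    dualExponent ![α i, α j] ≤ omegaTwo α :=
  le_iSup_of_le i (le_iSup_of_le j (le_iSup_of_le h le_rfl))

lemma omegaTwo_nonneg {d : ℕ} (hd : 2 ≤ d) (α : Fin d → ℝ) : 0 ≤ omegaTwo α :=
  (dualExponent_nonneg _).trans
    (dualExponent_le_omegaTwo α (i := ⟨0, by omega⟩) (j := ⟨1, by omega⟩) (by simp))

/-- Lower bound for `|a α_i + b α_j + z|` valid for `i ≠ j` and integers `a`, `b` not both zero. -/
def PairBound {d : ℕ} (α : Fin d → ℝ) (w c : ℝ) : Prop :=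
  ∀ i j : Fin d, i ≠ j → ∀ a b z : ℤ, (a ≠ 0 ∨ b ≠ 0) → ∀ X : ℝ, |(a : ℝ)| ≤ X → |(b : ℝ)| ≤ X →
    c * X ^ (-w) ≤ |a * α i + b * α j + z|

lemma exists_pairBound {d : ℕ} {α : Fin d → ℝ} {w : ℝ} (hw0 : 0 ≤ w)
    (hw : omegaTwo α < (w : EReal)) : ∃ c : ℝ, 0 < c ∧ c ≤ 1 ∧ PairBound α w c := by
  have h1 : ∀ p : Fin d × Fin d, ∃ c : ℝ, 0 < c ∧ (p.1 < p.2 → ∀ a : Fin 2 → ℤ, a ≠ 0 →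
      c * ‖a‖ ^ (-w) ≤ distInt (∑ l, (a l : ℝ) * ![α p.1, α p.2] l)) := by
    intro p
    by_cases h : p.1 < p.2
    · obtain ⟨c, hc, h'⟩ := exists_distInt_lower_bound
        (lt_of_le_of_lt (dualExponent_le_omegaTwo α h) hw)
      exact ⟨c, hc, fun _ => h'⟩
    · exact ⟨1, one_pos, fun h' => absurd h' h⟩
  choose c hc0 hc using h1
  obtain ⟨c₀, hc₀, hle⟩ : ∃ c₀ : ℝ, 0 < c₀ ∧ ∀ p, c₀ ≤ c p := by
    by_cases hne : Nonempty (Fin d × Fin d)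
    · obtain ⟨p, hp⟩ := Finite.exists_min c
      exact ⟨c p, hc0 p, hp⟩
    · exact ⟨1, one_pos, fun p => absurd ⟨p⟩ hne⟩
  have key : ∀ i j : Fin d, i < j → ∀ a b z : ℤ, (a ≠ 0 ∨ b ≠ 0) → ∀ X : ℝ, |(a : ℝ)| ≤ X →
      |(b : ℝ)| ≤ X → min c₀ 1 * X ^ (-w) ≤ |a * α i + b * α j + z| := by
    intro i j hij a b z hab X ha hb
    have hne : (![a, b] : Fin 2 → ℤ) ≠ 0 := by
      intro h
      have h0 := congrFun h 0
      have h1 := congrFun h 1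
      simp at h0 h1
      tauto
    have hX : ‖(![a, b] : Fin 2 → ℤ)‖ ≤ X := by
      rw [pi_norm_le_iff_of_nonneg ((abs_nonneg _).trans ha)]
      intro l
      fin_cases l <;> simpa [Int.norm_eq_abs]
    have hn := norm_pos_iff.2 hne
    have h := (hc (i, j) hij _ hne).trans (distInt_le_abs_add _ z)
    simp only [Fin.sum_univ_two, Matrix.cons_val_zero, Matrix.cons_val_one] at h
    refine le_trans ?_ h
    have : X ^ (-w) ≤ ‖(![a, b] : Fin 2 → ℤ)‖ ^ (-w) :=
      Real.rpow_le_rpow_of_nonpos hn hX (by linarith)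
    have h0 : 0 ≤ X ^ (-w) := Real.rpow_nonneg (hn.le.trans hX) _
    exact mul_le_mul ((min_le_left _ _).trans (hle _)) this h0 (hc0 _).le
  refine ⟨min c₀ 1, lt_min hc₀ one_pos, min_le_right _ _, ?_⟩
  intro i j hij a b z hab X ha hb
  rcases lt_or_gt_of_ne hij with h | h
  · exact key i j h a b z hab X ha hb
  · rw [add_comm ((a : ℝ) * α i)]
    exact key j i h b a z hab.symm X hb ha

/-- The deviation of `ξ` from the line spanned by `(1, α)`. -/
def slope {d : ℕ} (α : Fin d → ℝ) (ξ : Fin (d + 1) → ℤ) (j : Fin d) : ℝ := ξ j.succ - α j * ξ 0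

lemma slope_comb {d : ℕ} (α : Fin d → ℝ) (a b : ℤ) (x y : Fin (d + 1) → ℤ) (j : Fin d) :
    slope α (a • x + b • y) j = a * slope α x j + b * slope α y j := by
  simp [slope]; ring

lemma slope_smul {d : ℕ} (α : Fin d → ℝ) (a : ℤ) (x : Fin (d + 1) → ℤ) (j : Fin d) :
    slope α (a • x) j = a * slope α x j := by
  simp [slope]; ring

lemma exists_slope_lower_bound {d : ℕ} (hd : 2 ≤ d) {α : Fin d → ℝ} {w c : ℝ} (hw0 : 0 ≤ w)
    (hc1 : c ≤ 1) (h : PairBound α w c) {ξ : Fin (d + 1) → ℤ} (hξ : ξ ≠ 0) {X : ℝ}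
    (hX : ∀ j, |(ξ j : ℝ)| ≤ X) : ∃ j, c * X ^ (-w) ≤ |slope α ξ j| := by
  by_cases h0 : ξ 0 = 0
  · obtain ⟨i, hi⟩ := Function.ne_iff.1 hξ
    rcases Fin.eq_zero_or_eq_succ i with rfl | ⟨j, rfl⟩
    · exact absurd h0 hi
    · have h1 : (1 : ℝ) ≤ |(ξ j.succ : ℝ)| := by
        have : (1 : ℤ) ≤ |ξ j.succ| := Int.one_le_abs hi
        exact_mod_cast this
      refine ⟨j, ?_⟩
      have hs : slope α ξ j = ξ j.succ := by simp [slope, h0]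
      rw [hs]
      refine le_trans ?_ h1
      have h2 : X ^ (-w) ≤ 1 := Real.rpow_le_one_of_one_le_of_nonpos (h1.trans (hX _)) (by linarith)
      have h3 : 0 ≤ X ^ (-w) := Real.rpow_nonneg ((abs_nonneg _).trans (hX 0)) _
      exact (mul_le_mul hc1 h2 h3 zero_le_one).trans_eq (one_mul 1)
  · refine ⟨⟨0, by omega⟩, ?_⟩
    have h1 := h ⟨0, by omega⟩ ⟨1, by omega⟩ (by simp) (-ξ 0) 0
      (ξ (Fin.succ ⟨0, by omega⟩)) (Or.inl (neg_ne_zero.2 h0)) X (by simpa using hX 0)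
      (by simpa using (abs_nonneg _).trans (hX 0))
    refine h1.trans (le_of_eq ?_)
    rw [slope]
    congr 1
    push_cast
    ring

/-! ### Counting lattice points near a line -/

/-- The integers in `[-M, M]`. -/
def symInt (M : ℝ) : Finset ℤ := Finset.Icc (-⌊M⌋) ⌊M⌋

lemma mem_symInt {M : ℝ} {a : ℤ} : a ∈ symInt M ↔ |(a : ℝ)| ≤ M := by
  rw [symInt, Finset.mem_Icc, ← abs_le, Int.le_floor]
  push_cast
  rfl

lemma card_symInt_le {M : ℝ} (hM : 0 ≤ M) : ((symInt M).card : ℝ) ≤ 2 * M + 1 := by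
  have h0 : 0 ≤ ⌊M⌋ := Int.floor_nonneg.2 hM
  have h1 : ((symInt M).card : ℤ) = 2 * ⌊M⌋ + 1 := by
    rw [symInt, Int.card_Icc]; omega
  have h2 : ((symInt M).card : ℝ) = 2 * ⌊M⌋ + 1 := by exact_mod_cast h1
  rw [h2]
  linarith [Int.floor_le M]

lemma card_symInt_le_three_mul {M : ℝ} (hM : 1 ≤ M) : ((symInt M).card : ℝ) ≤ 3 * M := by
  linarith [card_symInt_le (zero_le_one.trans hM)]

/-- The integer vectors in `[-M, M]^k`. -/
def box (k : ℕ) (M : ℝ) : Finset (Fin k → ℤ) := Fintype.piFinset fun _ => symInt M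

lemma mem_box {k : ℕ} {M : ℝ} {m : Fin k → ℤ} : m ∈ box k M ↔ ∀ j, |(m j : ℝ)| ≤ M := by
  simp [box, mem_symInt]

lemma card_box_le {k : ℕ} {M : ℝ} (hM : 1 ≤ M) : ((box k M).card : ℝ) ≤ (3 * M) ^ k := by
  rw [box, Fintype.card_piFinset]
  simp only [Finset.prod_const, Finset.card_univ, Fintype.card_fin, Nat.cast_pow]
  gcongr
  exact card_symInt_le_three_mul hM

lemma card_le_of_mem_interval {F : Finset ℤ} {x y : ℝ} (hxy : x ≤ y)
    (h : ∀ a ∈ F, x ≤ a ∧ (a : ℝ) ≤ y) : (F.card : ℝ) ≤ y - x + 1 := by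
  have h1 : F ⊆ Finset.Icc ⌈x⌉ ⌊y⌋ := fun a ha =>
    Finset.mem_Icc.2 ⟨Int.ceil_le.2 (h a ha).1, Int.le_floor.2 (h a ha).2⟩
  have h2 : (F.card : ℝ) ≤ ((Finset.Icc ⌈x⌉ ⌊y⌋).card : ℝ) := by
    exact_mod_cast Finset.card_le_card h1
  refine h2.trans ?_
  rw [Int.card_Icc]
  have h3 := Int.floor_le y
  have h4 := Int.le_ceil x
  rcases le_total 0 (⌊y⌋ + 1 - ⌈x⌉) with h | h
  · have : (((⌊y⌋ + 1 - ⌈x⌉).toNat : ℤ) : ℝ) = ((⌊y⌋ + 1 - ⌈x⌉ : ℤ) : ℝ) := by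
      rw [Int.toNat_of_nonneg h]
    rw [Int.cast_natCast] at this
    rw [this]
    push_cast
    linarith
  · rw [Int.toNat_of_nonpos h]
    simp
    linarith

lemma card_le_of_dvd_sub {F : Finset ℤ} {r : ℕ} (hr : 0 < r) {M : ℝ} (hM : 0 ≤ M)
    (h : ∀ a ∈ F, |(a : ℝ)| ≤ M) (hd : ∀ a ∈ F, ∀ b ∈ F, (r : ℤ) ∣ a - b) :
    (F.card : ℝ) ≤ 2 * M / r + 1 := by
  rcases F.eq_empty_or_nonempty with rfl | ⟨b, hb⟩
  · simp; positivity
  have hr' : (0 : ℝ) < r := by exact_mod_cast hr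
  have hval : ∀ a ∈ F, (((a - b) / (r : ℤ) : ℤ) : ℝ) = (a - b : ℝ) / r := by
    intro a ha
    rw [Int.cast_div (hd a ha b hb) (by positivity)]
    push_cast; rfl
  have hinj : Set.InjOn (fun a : ℤ => (a - b) / (r : ℤ)) F := by
    intro a ha a' ha' haa
    simp only at haa
    have h1 : (a - b : ℝ) / r = (a' - b : ℝ) / r := by rw [← hval a ha, ← hval a' ha', haa]
    have h2 := (div_left_inj' hr'.ne').1 h1
    exact_mod_cast sub_left_inj.1 h2
  rw [← Finset.card_image_of_injOn hinj]
  have := card_le_of_mem_interval (F := F.image fun a : ℤ => (a - b) / (r : ℤ))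
    (x := (-M - b) / r) (y := (M - b) / r) (by gcongr; linarith) ?_
  · refine this.trans (le_of_eq ?_)
    ring
  · intro q hq
    obtain ⟨a, ha, rfl⟩ := Finset.mem_image.1 hq
    rw [hval a ha]
    have := abs_le.1 (h a ha)
    exact ⟨by gcongr; linarith, by gcongr; linarith⟩

lemma card_le_mul_of_fibers {ι κ : Type*} [DecidableEq κ] {F : Finset ι} {G : Finset κ} (f : ι → κ)
    (hf : ∀ a ∈ F, f a ∈ G) {B : ℝ} (hB : ∀ b ∈ G, ((F.filter fun a => f a = b).card : ℝ) ≤ B) :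
    (F.card : ℝ) ≤ G.card * B := by
  rw [Finset.card_eq_sum_card_fiberwise (f := f) (t := G) hf]
  push_cast
  calc _ ≤ ∑ _b ∈ G, B := Finset.sum_le_sum hB
    _ = _ := by simp

lemma card_linear_form_le {n n' : ℕ} (hn' : 0 < n') {M U x : ℝ} (hM : 0 ≤ M) (hU : 0 ≤ U)
    {F : Finset (ℤ × ℤ)} (hF : ∀ p ∈ F, |(p.1 : ℝ)| ≤ M ∧ |x + (n * p.1 + n' * p.2)| ≤ U) :
    (F.card : ℝ) ≤ (2 * U + 1) * (1 + 2 * (M * (Nat.gcd n n' : ℝ) / n')) := by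
  have hg : 0 < Nat.gcd n n' := Nat.gcd_pos_of_pos_right _ hn'
  obtain ⟨r, hr⟩ := Nat.gcd_dvd_right n n'
  have hr0 : 0 < r := by
    rcases Nat.eq_zero_or_pos r with h | h
    · rw [h] at hr; omega
    · exact h
  obtain ⟨s, hs⟩ := Nat.gcd_dvd_left n n'
  have hcop : Nat.Coprime s r := by
    have := Nat.coprime_div_gcd_div_gcd hg
    rwa [Nat.div_eq_of_eq_mul_right hg hs, Nat.div_eq_of_eq_mul_right hg hr] at this
  set f : ℤ × ℤ → ℤ := fun p => n * p.1 + n' * p.2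
  have hfib : ∀ b ∈ F.image f, ((F.filter fun a => f a = b).card : ℝ) ≤
      1 + 2 * (M * (Nat.gcd n n' : ℝ) / n') := by
    intro b _
    have hinj : Set.InjOn Prod.fst ((F.filter fun a => f a = b : Finset (ℤ × ℤ)) : Set (ℤ × ℤ)) := by
      rintro ⟨a, a'⟩ ha ⟨e, e'⟩ he hae
      simp only [Finset.coe_filter, Set.mem_ofPred_eq, f] at ha he hae
      subst hae
      have h1 : (n' : ℤ) * a' = n' * e' := by linarith [ha.2, he.2]
      have := mul_left_cancel₀ (by exact_mod_cast hn'.ne') h1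
      rw [this]
    rw [← Finset.card_image_of_injOn hinj]
    refine (card_le_of_dvd_sub hr0 hM ?_ ?_).trans (le_of_eq ?_)
    · intro a ha
      obtain ⟨p, hp, rfl⟩ := Finset.mem_image.1 ha
      exact (hF p (Finset.mem_filter.1 hp).1).1
    · intro a ha e he
      obtain ⟨p, hp, rfl⟩ := Finset.mem_image.1 ha
      obtain ⟨q, hq, rfl⟩ := Finset.mem_image.1 he
      have h1 := (Finset.mem_filter.1 hp).2
      have h2 := (Finset.mem_filter.1 hq).2
      have h3 : (n : ℤ) * (p.1 - q.1) = n' * (q.2 - p.2) := by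
        simp only [f] at h1 h2; linarith
      have hs' : (n : ℤ) = (Nat.gcd n n' : ℤ) * s := by exact_mod_cast hs
      have hr' : (n' : ℤ) = (Nat.gcd n n' : ℤ) * r := by exact_mod_cast hr
      rw [hs', hr', mul_assoc, mul_assoc] at h3
      have h4 := mul_left_cancel₀ (by exact_mod_cast hg.ne') h3
      have h5 : (r : ℤ) ∣ s * (p.1 - q.1) := ⟨_, h4⟩
      exact (Int.isCoprime_iff_gcd_eq_one.2 (by simpa [Int.gcd] using hcop.symm)).dvd_of_dvd_mul_left
        h5
    · have h1 : (n' : ℝ) = (Nat.gcd n n' : ℝ) * r := by exact_mod_cast hr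
      have h2 : (0 : ℝ) < Nat.gcd n n' := by exact_mod_cast hg
      have h3 : (0 : ℝ) < r := by exact_mod_cast hr0
      rw [show M * (Nat.gcd n n' : ℝ) / n' = M / r by rw [h1]; field_simp]
      ring
  refine (card_le_mul_of_fibers f (fun a ha => Finset.mem_image_of_mem f ha) hfib).trans ?_
  have hcard : ((F.image f).card : ℝ) ≤ 2 * U + 1 := by
    have := card_le_of_mem_interval (F := F.image f) (x := -x - U) (y := -x + U) (by linarith) ?_
    · linarith
    · intro b hb
      obtain ⟨p, hp, rfl⟩ := Finset.mem_image.1 hb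
      have := abs_le.1 (hF p hp).2
      simp only [f]
      push_cast
      constructor <;> linarith
  gcongr

/-- The number of pairs `(m, m')` in boxes with `n m + n' m'` close to the line `ℝ (1, α)`. -/
lemma card_near_line_le {d : ℕ} (α : Fin d → ℝ) {n n' : ℕ} (hn' : 0 < n') {M M' U : ℝ}
    (hM : 1 ≤ M) (hM' : 1 ≤ M') (hU : 0 ≤ U)
    {F : Finset ((Fin (d + 1) → ℤ) × (Fin (d + 1) → ℤ))}
    (hF : ∀ p ∈ F, (∀ j, |(p.1 j : ℝ)| ≤ M) ∧ (∀ j, |(p.2 j : ℝ)| ≤ M') ∧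
      ∀ j, |n * slope α p.1 j + n' * slope α p.2 j| ≤ U) :
    (F.card : ℝ) ≤ 9 * (M * M') * ((2 * U + 1) * (1 + 2 * (M * (Nat.gcd n n' : ℝ) / n'))) ^ d := by
  classical
  set f : (Fin (d + 1) → ℤ) × (Fin (d + 1) → ℤ) → ℤ × ℤ := fun p => (p.1 0, p.2 0)
  have h1 := card_le_mul_of_fibers (F := F) (G := symInt M ×ˢ symInt M') f
    (B := ((2 * U + 1) * (1 + 2 * (M * (Nat.gcd n n' : ℝ) / n'))) ^ d) ?_ ?_
  · refine h1.trans ?_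
    rw [Finset.card_product, Nat.cast_mul]
    have := mul_le_mul (card_symInt_le_three_mul hM) (card_symInt_le_three_mul hM')
      (Nat.cast_nonneg _) (by linarith)
    have h3 : 9 * (M * M') = 3 * M * (3 * M') := by ring
    rw [h3]
    gcongr
  · intro p hp
    simp only [f, Finset.mem_product, mem_symInt]
    exact ⟨(hF p hp).1 0, (hF p hp).2.1 0⟩
  · intro b _
    set G : Fin d → Finset (ℤ × ℤ) := fun j => (symInt M ×ˢ symInt M').filter fun q =>
      |-(α j * (n * b.1 + n' * b.2)) + (n * q.1 + n' * q.2)| ≤ U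
    set φ : (Fin (d + 1) → ℤ) × (Fin (d + 1) → ℤ) → Fin d → ℤ × ℤ := fun p j =>
      (p.1 j.succ, p.2 j.succ)
    have hinj : Set.InjOn φ ((F.filter fun a => f a = b : Finset _) : Set _) := by
      rintro ⟨p, p'⟩ hp ⟨q, q'⟩ hq hpq
      have h1 := (Finset.mem_filter.1 hp).2
      have h2 := (Finset.mem_filter.1 hq).2
      have h3 := h1.trans h2.symm
      simp only [f, Prod.mk.injEq] at h3
      have h4 : ∀ j, p (Fin.succ j) = q j.succ ∧ p' (Fin.succ j) = q' j.succ := fun j => by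
        simpa [φ] using congrFun hpq j
      refine Prod.ext ?_ ?_
      · funext j
        exact Fin.cases h3.1 (fun j => (h4 j).1) j
      · funext j
        exact Fin.cases h3.2 (fun j => (h4 j).2) j
    rw [← Finset.card_image_of_injOn hinj]
    have hsub : (F.filter fun a => f a = b).image φ ⊆ Fintype.piFinset G := by
      intro q hq
      obtain ⟨p, hp, rfl⟩ := Finset.mem_image.1 hq
      have hpF := (Finset.mem_filter.1 hp).1
      have hpb := (Finset.mem_filter.1 hp).2
      obtain ⟨h1, h2, h3⟩ := hF p hpF
      rw [Fintype.mem_piFinset]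
      intro j
      simp only [G, φ, Finset.mem_filter, Finset.mem_product, mem_symInt]
      refine ⟨⟨h1 _, h2 _⟩, ?_⟩
      rw [← hpb]
      refine le_trans (le_of_eq ?_) (h3 j)
      simp only [slope, f]
      congr 1
      ring
    have h2 : ((((F.filter fun a => f a = b).image φ).card : ℕ) : ℝ) ≤ ∏ j, ((G j).card : ℝ) := by
      rw [← Nat.cast_prod, ← Fintype.card_piFinset]
      exact_mod_cast Finset.card_le_card hsub
    refine h2.trans ?_
    calc ∏ j, ((G j).card : ℝ)
        ≤ ∏ _j : Fin d, ((2 * U + 1) * (1 + 2 * (M * (Nat.gcd n n' : ℝ) / n'))) := by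
          refine Finset.prod_le_prod (fun _ _ => Nat.cast_nonneg _) fun j _ => ?_
          refine card_linear_form_le hn' (zero_le_one.trans hM) hU
            (x := -(α j * (n * b.1 + n' * b.2))) fun q hq => ?_
          have := Finset.mem_filter.1 hq
          exact ⟨mem_symInt.1 (Finset.mem_product.1 this.1).1, this.2⟩
      _ = _ := by simp

/-- The number of integer vectors in a box close to the line `ℝ (1, α)`. -/
lemma card_slope_le {d : ℕ} (α : Fin d → ℝ) {M U : ℝ} (hM : 1 ≤ M) (hU : 0 ≤ U)
    {F : Finset (Fin (d + 1) → ℤ)}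
    (hF : ∀ p ∈ F, (∀ j, |(p j : ℝ)| ≤ M) ∧ ∀ j, |slope α p j| ≤ U) :
    (F.card : ℝ) ≤ 3 * M * (2 * U + 1) ^ d := by
  classical
  have h1 := card_le_mul_of_fibers (F := F) (G := symInt M) (fun p => p 0)
    (B := (2 * U + 1) ^ d) (fun p hp => mem_symInt.2 ((hF p hp).1 0)) ?_
  · refine h1.trans ?_
    gcongr
    exact card_symInt_le_three_mul hM
  · intro b _
    set G : Fin d → Finset ℤ := fun j => (symInt M).filter fun q => |q - α j * b| ≤ U
    set φ : (Fin (d + 1) → ℤ) → Fin d → ℤ := fun p j => p j.succ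
    have hinj : Set.InjOn φ ((F.filter fun a => a 0 = b : Finset _) : Set _) := by
      intro p hp q hq hpq
      have h3 := (Finset.mem_filter.1 hp).2.trans (Finset.mem_filter.1 hq).2.symm
      funext j
      exact Fin.cases h3 (fun j => congrFun hpq j) j
    rw [← Finset.card_image_of_injOn hinj]
    have hsub : (F.filter fun a => a 0 = b).image φ ⊆ Fintype.piFinset G := by
      intro q hq
      obtain ⟨p, hp, rfl⟩ := Finset.mem_image.1 hq
      obtain ⟨hpF, hpb⟩ := Finset.mem_filter.1 hp
      rw [Fintype.mem_piFinset]
      intro j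
      simp only [G, φ, Finset.mem_filter, mem_symInt]
      refine ⟨(hF p hpF).1 _, ?_⟩
      rw [← hpb]
      exact (hF p hpF).2 j
    have h2 : ((((F.filter fun a => a 0 = b).image φ).card : ℕ) : ℝ) ≤ ∏ j, ((G j).card : ℝ) := by
      rw [← Nat.cast_prod, ← Fintype.card_piFinset]
      exact_mod_cast Finset.card_le_card hsub
    refine h2.trans ?_
    calc ∏ j, ((G j).card : ℝ) ≤ ∏ _j : Fin d, (2 * U + 1) := by
          refine Finset.prod_le_prod (fun _ _ => Nat.cast_nonneg _) fun j _ => ?_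
          have := card_le_of_mem_interval (F := G j) (x := α j * b - U) (y := α j * b + U)
            (by linarith) fun a ha => ?_
          · linarith
          · have := abs_le.1 (Finset.mem_filter.1 ha).2
            constructor <;> linarith
      _ = _ := by simp

/-- Two integer vectors are parallel if all their `2 × 2` minors vanish. -/
def Parallel {k : ℕ} (m m' : Fin k → ℤ) : Prop := ∀ i j, m i * m' j = m j * m' i

lemma Parallel.exists_common {k : ℕ} {m m' : Fin k → ℤ} (h : Parallel m m') (hm : m ≠ 0) :
    ∃ (p : Fin k → ℤ) (a a' : ℤ), p ≠ 0 ∧ m = a • p ∧ m' = a' • p := by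
  obtain ⟨i, hi⟩ := Function.ne_iff.1 hm
  obtain ⟨p, hp, hg⟩ := Finset.extract_gcd m (s := Finset.univ) ⟨i, Finset.mem_univ i⟩
  set a := Finset.univ.gcd m
  have hmp : m = a • p := by
    funext j; simpa using hp j (Finset.mem_univ j)
  have ha : a ≠ 0 := by
    intro h0; apply hi; rw [hmp, h0]; simp
  have hpi : p i ≠ 0 := by
    intro h0; apply hi; rw [hmp]; simp [h0]
  have hpar : ∀ i j, p i * m' j = p j * m' i := by
    intro i j
    have := h i j
    rw [hmp] at this
    simp only [Pi.smul_apply, smul_eq_mul, mul_assoc] at this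
    exact mul_left_cancel₀ ha this
  have hdvd : p i ∣ m' i := by
    have h1 : p i ∣ Finset.univ.gcd fun j => p j * m' i :=
      Finset.dvd_gcd fun j _ => ⟨m' j, (hpar i j).symm⟩
    rw [Finset.gcd_mul_right, hg, one_mul] at h1
    exact h1.trans (normalize_associated _).dvd
  obtain ⟨a', ha'⟩ := hdvd
  refine ⟨p, a, a', fun h0 => hpi (by rw [h0]; rfl), hmp, ?_⟩
  funext j
  have := hpar i j
  rw [ha'] at this
  have h2 : p i * m' j = p i * (a' * p j) := by rw [this]; ring
  simpa using mul_left_cancel₀ hpi h2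

lemma abs_le_of_smul {k : ℕ} {p : Fin k → ℤ} (hp : p ≠ 0) {a : ℤ} {M : ℝ}
    (h : ∀ j, |(((a • p) j : ℤ) : ℝ)| ≤ M) : |(a : ℝ)| ≤ M := by
  obtain ⟨i, hi⟩ := Function.ne_iff.1 hp
  have h1 : (1 : ℝ) ≤ |(p i : ℝ)| := by exact_mod_cast Int.one_le_abs hi
  have := h i
  simp only [Pi.smul_apply, smul_eq_mul, Int.cast_mul, abs_mul] at this
  nlinarith [abs_nonneg (a : ℝ)]

lemma abs_le_of_smul' {k : ℕ} {p : Fin k → ℤ} {a : ℤ} (ha : a ≠ 0) {M : ℝ}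
    (h : ∀ j, |(((a • p) j : ℤ) : ℝ)| ≤ M) (j : Fin k) : |(p j : ℝ)| ≤ M := by
  have h1 : (1 : ℝ) ≤ |(a : ℝ)| := by exact_mod_cast Int.one_le_abs ha
  have := h j
  simp only [Pi.smul_apply, smul_eq_mul, Int.cast_mul, abs_mul] at this
  nlinarith [abs_nonneg (p j : ℝ)]

/-- For fixed `n`, the number of triples `(n', m, m')` with `m`, `m'` parallel and `n m + n' m'`
nonzero and close to the line `ℝ (1, α)`. -/
lemma card_parallel_le {d : ℕ} (hd : 2 ≤ d) {α : Fin d → ℝ} {w c : ℝ} (hw0 : 0 ≤ w) (hc0 : 0 < c)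
    (hc1 : c ≤ 1) (h : PairBound α w c) {n : ℕ} {M M' U : ℝ} (hM : 1 ≤ M) (hM' : 1 ≤ M')
    (hU : 0 ≤ U) {F : Finset (ℕ × ((Fin (d + 1) → ℤ) × (Fin (d + 1) → ℤ)))}
    (hF : ∀ t ∈ F, (∀ j, |(t.2.1 j : ℝ)| ≤ M) ∧ (∀ j, |(t.2.2 j : ℝ)| ≤ M') ∧
      t.2.1 ≠ 0 ∧ t.2.2 ≠ 0 ∧ Parallel t.2.1 t.2.2 ∧
      (n : ℤ) • t.2.1 + (t.1 : ℤ) • t.2.2 ≠ 0 ∧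
      ∀ j, |n * slope α t.2.1 j + t.1 * slope α t.2.2 j| ≤ U) :
    (F.card : ℝ) ≤ 3 * M * (2 * U + 1) ^ d * (3 * M * (3 * M' * (2 * (U * M ^ w / c) + 1))) := by
  classical
  set P := (box (d + 1) M).filter fun p => ∀ j, |slope α p j| ≤ U
  set G := P ×ˢ (symInt M ×ˢ (symInt M' ×ˢ symInt (U * M ^ w / c)))
  set ψ : (Fin (d + 1) → ℤ) × (ℤ × (ℤ × ℤ)) → ℕ × ((Fin (d + 1) → ℤ) × (Fin (d + 1) → ℤ)) :=
    fun s => (((s.2.2.2 - n * s.2.1) / s.2.2.1).toNat, (s.2.1 • s.1, s.2.2.1 • s.1))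
  have hMw : 0 < M ^ w := Real.rpow_pos_of_pos (by linarith) _
  have hsub : F ⊆ G.image ψ := by
    rintro ⟨n', m, m'⟩ ht
    obtain ⟨h1, h2, hm, hm', hpar, hne, hs⟩ := hF _ ht
    simp only at h1 h2 hm hm' hpar hne hs
    obtain ⟨p, a, a', hp, rfl, rfl⟩ := hpar.exists_common hm
    have ha : a ≠ 0 := by rintro rfl; simp at hm
    have ha' : a' ≠ 0 := by rintro rfl; simp at hm'
    set q : ℤ := n * a + n' * a'
    have hq0 : q ≠ 0 := by
      intro h0
      apply hne
      rw [smul_smul, smul_smul, ← add_smul]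
      change q • p = 0
      rw [h0, zero_smul]
    have hq1 : (1 : ℝ) ≤ |(q : ℝ)| := by exact_mod_cast Int.one_le_abs hq0
    have hqs : ∀ j, |(q : ℝ)| * |slope α p j| ≤ U := by
      intro j
      refine le_trans (le_of_eq ?_) (hs j)
      rw [slope_smul, slope_smul, ← abs_mul]
      congr 1
      simp only [q]; push_cast; ring
    have hpM := abs_le_of_smul' ha h1
    refine Finset.mem_image.2 ⟨(p, a, a', q), ?_, ?_⟩
    · simp only [G, P, Finset.mem_product, Finset.mem_filter, mem_symInt, mem_box]
      refine ⟨⟨hpM, fun j => ?_⟩, abs_le_of_smul hp h1, abs_le_of_smul hp h2, ?_⟩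
      · nlinarith [hqs j, abs_nonneg (slope α p j)]
      · obtain ⟨j, hj⟩ := exists_slope_lower_bound hd hw0 hc1 h hp hpM
        rw [Real.rpow_neg (by linarith), ← div_eq_mul_inv, div_le_iff₀ hMw] at hj
        rw [le_div_iff₀ hc0]
        calc |(q : ℝ)| * c ≤ |(q : ℝ)| * (|slope α p j| * M ^ w) := by gcongr
          _ = |(q : ℝ)| * |slope α p j| * M ^ w := by ring
          _ ≤ U * M ^ w := by gcongr; exact hqs j
    · simp only [ψ, q]
      congr 1
      rw [add_sub_cancel_left, Int.mul_ediv_cancel _ ha']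
      simp
  have h1 : (F.card : ℝ) ≤ G.card := by
    exact_mod_cast (Finset.card_le_card hsub).trans Finset.card_image_le
  refine h1.trans ?_
  simp only [G, Finset.card_product, Nat.cast_mul]
  have hP : (P.card : ℝ) ≤ 3 * M * (2 * U + 1) ^ d := by
    refine card_slope_le α hM hU fun p hp => ?_
    exact ⟨mem_box.1 (Finset.mem_filter.1 hp).1, (Finset.mem_filter.1 hp).2⟩
  have h2 := card_symInt_le_three_mul hM
  have h3 := card_symInt_le_three_mul hM'
  have h4 := card_symInt_le (M := U * M ^ w / c) (by positivity)
  gcongr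

/-- If `n m + n' m'` is close to the line `ℝ (1, α)` and `m`, `m'` are not parallel, then `n n'`
cannot be large. -/
lemma mul_le_of_not_parallel {d : ℕ} (hd : 2 ≤ d) {α : Fin d → ℝ} {w c A : ℝ} (hw0 : 0 ≤ w)
    (hc0 : 0 < c) (hc1 : c ≤ 1) (h : PairBound α w c) (hA : ∀ j, |α j| ≤ A) {n n' : ℕ}
    {M M' U : ℝ} (hM : 1 ≤ M) (hM' : 1 ≤ M') (hU : 0 ≤ U) {m m' : Fin (d + 1) → ℤ}
    (hm : ∀ j, |(m j : ℝ)| ≤ M) (hm' : ∀ j, |(m' j : ℝ)| ≤ M') (hpar : ¬ Parallel m m')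
    (hs : ∀ j, |n * slope α m j + n' * slope α m' j| ≤ U) :
    (n : ℝ) * n' * c ^ 2 ≤ 4 * (1 + A) ^ 2 * U ^ 2 * (M * M') * ((2 * (M * M')) ^ w) ^ 2 := by
  set X := 2 * (M * M')
  have hMM : 1 ≤ M * M' := one_le_mul_of_one_le_of_one_le hM hM'
  have hX1 : 1 ≤ X := by simp only [X]; linarith
  have hXw : 0 < X ^ w := Real.rpow_pos_of_pos (by linarith) _
  have hA0 : 0 ≤ A := (abs_nonneg _).trans (hA ⟨0, by omega⟩)
  obtain ⟨i, j, hij⟩ : ∃ i j : Fin d, c ≤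
      |slope α m i * slope α m' j - slope α m j * slope α m' i| * X ^ w := by
    by_cases hP : ∃ j : Fin d, m j.succ * m' 0 - m 0 * m' j.succ ≠ 0
    · obtain ⟨j, hj⟩ := hP
      obtain ⟨i, hij⟩ : ∃ i : Fin d, i ≠ j := by
        have : Nontrivial (Fin d) := Fin.nontrivial_iff_two_le.2 hd
        exact exists_ne j
      have hbd : ∀ i : Fin d, |((m i.succ * m' 0 - m 0 * m' i.succ : ℤ) : ℝ)| ≤ X := by
        intro i
        push_cast
        refine (abs_sub _ _).trans ?_
        rw [abs_mul, abs_mul]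
        have h1 := mul_le_mul (hm i.succ) (hm' 0) (abs_nonneg _) (by linarith)
        have h2 := mul_le_mul (hm 0) (hm' i.succ) (abs_nonneg _) (by linarith)
        simp only [X]; linarith
      have := h i j hij (m j.succ * m' 0 - m 0 * m' j.succ)
        (-(m i.succ * m' 0 - m 0 * m' i.succ)) (m i.succ * m' j.succ - m j.succ * m' i.succ)
        (Or.inl hj) X (hbd j) (by rw [Int.cast_neg, abs_neg]; exact hbd i)
      refine ⟨i, j, ?_⟩
      rw [Real.rpow_neg (by linarith), ← div_eq_mul_inv, div_le_iff₀ hXw] at this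
      refine this.trans (le_of_eq ?_)
      congr 2
      simp only [slope]
      push_cast
      ring
    · push Not at hP
      obtain ⟨i, j, hij⟩ : ∃ i j : Fin d, m i.succ * m' j.succ - m j.succ * m' i.succ ≠ 0 := by
        by_contra! hcon
        apply hpar
        intro a b
        refine Fin.cases ?_ (fun i => ?_) a <;> refine Fin.cases ?_ (fun j => ?_) b
        · rfl
        · linarith [hP j]
        · linarith [hP i]
        · linarith [hcon i j]
      refine ⟨i, j, ?_⟩
      have h1 : slope α m i * slope α m' j - slope α m j * slope α m' i =
          ((m i.succ * m' j.succ - m j.succ * m' i.succ : ℤ) : ℝ) := by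
        have hi : ((m i.succ * m' 0 - m 0 * m' i.succ : ℤ) : ℝ) = 0 := by rw [hP i]; simp
        have hj : ((m j.succ * m' 0 - m 0 * m' j.succ : ℤ) : ℝ) = 0 := by rw [hP j]; simp
        push_cast at hi hj ⊢
        simp only [slope]
        linear_combination (-α j) * hi + α i * hj
      rw [h1]
      have h2 : (1 : ℝ) ≤ |((m i.succ * m' j.succ - m j.succ * m' i.succ : ℤ) : ℝ)| := by
        exact_mod_cast Int.one_le_abs hij
      have h3 : 1 ≤ X ^ w := Real.one_le_rpow hX1 hw0
      nlinarith
  set D := slope α m i * slope α m' j - slope α m j * slope α m' i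
  have hsl : ∀ (m : Fin (d + 1) → ℤ) (M : ℝ), (∀ j, |(m j : ℝ)| ≤ M) → ∀ j,
      |slope α m j| ≤ (1 + A) * M := by
    intro m M hm j
    refine (abs_sub _ _).trans ?_
    rw [abs_mul]
    have := mul_le_mul (hA j) (hm 0) (abs_nonneg _) hA0
    linarith [hm j.succ]
  have h1 : (n : ℝ) * |D| ≤ 2 * (1 + A) * U * M' := by
    have : (n : ℝ) * D = (n * slope α m i + n' * slope α m' i) * slope α m' j -
        (n * slope α m j + n' * slope α m' j) * slope α m' i := by simp only [D]; ring
    rw [← Nat.abs_cast n, ← abs_mul, this]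
    refine (abs_sub _ _).trans ?_
    rw [abs_mul, abs_mul]
    have e1 := mul_le_mul (hs i) (hsl m' M' hm' j) (abs_nonneg _) hU
    have e2 := mul_le_mul (hs j) (hsl m' M' hm' i) (abs_nonneg _) hU
    linarith
  have h2 : (n' : ℝ) * |D| ≤ 2 * (1 + A) * U * M := by
    have : (n' : ℝ) * D = (n * slope α m j + n' * slope α m' j) * slope α m i -
        (n * slope α m i + n' * slope α m' i) * slope α m j := by simp only [D]; ring
    rw [← Nat.abs_cast n', ← abs_mul, this]
    refine (abs_sub _ _).trans ?_
    rw [abs_mul, abs_mul]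
    have e1 := mul_le_mul (hs i) (hsl m M hm j) (abs_nonneg _) hU
    have e2 := mul_le_mul (hs j) (hsl m M hm i) (abs_nonneg _) hU
    linarith
  calc (n : ℝ) * n' * c ^ 2 ≤ n * n' * (|D| * X ^ w) ^ 2 := by gcongr
    _ = (n * |D|) * (n' * |D|) * (X ^ w) ^ 2 := by ring
    _ ≤ (2 * (1 + A) * U * M') * (2 * (1 + A) * U * M) * (X ^ w) ^ 2 := by gcongr
    _ = _ := by ring

/-! ### Summing the counts -/

/-- The cut-off `n^κ T^(2τ)` for the frequencies of `f_n`, where `κ = 1 / k`. -/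
def cutoff (d : ℕ) (τ : ℝ) (n : ℕ) (T : ℝ) : ℝ :=
  (n : ℝ) ^ (1 / ((d + 1 : ℕ) : ℝ)) * T ^ (2 * τ)

open Classical in
/-- The pairs of frequencies that contribute substantially to the correlation of `f_n`, `f_n'`. -/
def badSet {d : ℕ} (α : Fin d → ℝ) (τ : ℝ) (n n' : ℕ) :
    Finset ((Fin (d + 1) → ℤ) × (Fin (d + 1) → ℤ)) :=
  (box (d + 1) (cutoff d τ n ((n : ℝ) * n')) ×ˢ box (d + 1) (cutoff d τ n' ((n : ℝ) * n'))).filter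
    fun p => p.1 ≠ 0 ∧ p.2 ≠ 0 ∧ (n : ℤ) • p.1 + (n' : ℤ) • p.2 ≠ 0 ∧
      ∀ j, |n * slope α p.1 j + n' * slope α p.2 j| ≤ ((n : ℝ) * n') ^ τ

lemma mem_badSet {d : ℕ} {α : Fin d → ℝ} {τ : ℝ} {n n' : ℕ}
    {p : (Fin (d + 1) → ℤ) × (Fin (d + 1) → ℤ)} :
    p ∈ badSet α τ n n' ↔ (∀ j, |(p.1 j : ℝ)| ≤ cutoff d τ n ((n : ℝ) * n')) ∧
      (∀ j, |(p.2 j : ℝ)| ≤ cutoff d τ n' ((n : ℝ) * n')) ∧ p.1 ≠ 0 ∧ p.2 ≠ 0 ∧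
      (n : ℤ) • p.1 + (n' : ℤ) • p.2 ≠ 0 ∧
      ∀ j, |n * slope α p.1 j + n' * slope α p.2 j| ≤ ((n : ℝ) * n') ^ τ := by
  simp only [badSet, Finset.mem_filter, Finset.mem_product, mem_box, and_assoc]

lemma card_badSet_comm {d : ℕ} (α : Fin d → ℝ) (τ : ℝ) (n n' : ℕ) :
    (badSet α τ n n').card = (badSet α τ n' n).card := by
  refine Finset.card_bij' (fun p _ => p.swap) (fun p _ => p.swap) ?_ ?_ (by simp) (by simp)
  · intro p hp
    rw [mem_badSet] at hp ⊢
    obtain ⟨h1, h2, h3, h4, h5, h6⟩ := hp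
    rw [mul_comm (n' : ℝ)]
    exact ⟨h2, h1, h4, h3, by rw [add_comm (_ • p.swap.1)]; exact h5, fun j => by rw [add_comm]; exact h6 j⟩
  · intro p hp
    rw [mem_badSet] at hp ⊢
    obtain ⟨h1, h2, h3, h4, h5, h6⟩ := hp
    rw [mul_comm (n : ℝ)]
    exact ⟨h2, h1, h4, h3, by rw [add_comm (_ • p.swap.1)]; exact h5, fun j => by rw [add_comm]; exact h6 j⟩

lemma one_le_mul_cast {n n' : ℕ} (hn : 1 ≤ n) (hn' : 1 ≤ n') : (1 : ℝ) ≤ (n : ℝ) * n' := by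
  exact_mod_cast Nat.mul_pos hn hn'

lemma one_le_cutoff {d : ℕ} {τ : ℝ} (hτ : 0 < τ) {n : ℕ} (hn : 1 ≤ n) {T : ℝ} (hT : 1 ≤ T) :
    1 ≤ cutoff d τ n T :=
  one_le_mul_of_one_le_of_one_le (Real.one_le_rpow (by exact_mod_cast hn) (by positivity))
    (Real.one_le_rpow hT (by positivity))

lemma cutoff_mul_cutoff {d : ℕ} {τ : ℝ} {n n' : ℕ} (hn : 1 ≤ n) (hn' : 1 ≤ n') :
    cutoff d τ n ((n : ℝ) * n') * cutoff d τ n' ((n : ℝ) * n') =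
      ((n : ℝ) * n') ^ (1 / ((d + 1 : ℕ) : ℝ) + 4 * τ) := by
  have hT : (0 : ℝ) < (n : ℝ) * n' := zero_lt_one.trans_le (one_le_mul_cast hn hn')
  rw [Real.rpow_add hT, show 4 * τ = 2 * τ + 2 * τ by ring, Real.rpow_add hT,
    Real.mul_rpow (Nat.cast_nonneg n) (Nat.cast_nonneg n')]
  simp only [cutoff]
  ring

lemma card_badSet_le {d : ℕ} (α : Fin d → ℝ) {τ : ℝ} (hτ : 0 < τ) {n n' : ℕ} (hn : 1 ≤ n)
    (hn' : 1 ≤ n') :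
    ((badSet α τ n n').card : ℝ) ≤
      9 ^ (d + 1) * ((n : ℝ) * n') ^ (1 + 4 * ((d + 1 : ℕ) : ℝ) * τ) := by
  have hT := one_le_mul_cast hn hn'
  have h1 : ((badSet α τ n n').card : ℝ) ≤ ((box (d + 1) (cutoff d τ n ((n : ℝ) * n')) ×ˢ
      box (d + 1) (cutoff d τ n' ((n : ℝ) * n'))).card : ℝ) := by
    rw [badSet]
    exact Nat.cast_le.2 (Finset.card_filter_le _ _)
  refine h1.trans ?_
  rw [Finset.card_product, Nat.cast_mul]
  have h2 := card_box_le (k := d + 1) (one_le_cutoff (d := d) hτ hn hT)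
  have h3 := card_box_le (k := d + 1) (one_le_cutoff (d := d) hτ hn' hT)
  refine (mul_le_mul h2 h3 (Nat.cast_nonneg _) (by have := one_le_cutoff (d := d) hτ hn hT; positivity)).trans
    (le_of_eq ?_)
  rw [← mul_pow, show ∀ a b : ℝ, 3 * a * (3 * b) = 9 * (a * b) by intros; ring,
    cutoff_mul_cutoff hn hn', mul_pow, ← Real.rpow_natCast (_ ^ _), ← Real.rpow_mul (by linarith)]
  congr 2
  field_simp

lemma card_filter_parallel_block_le {d : ℕ} (hd : 2 ≤ d) {α : Fin d → ℝ} {w c : ℝ} (hw0 : 0 ≤ w)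
    (hc0 : 0 < c) (hc1 : c ≤ 1) (h : PairBound α w c) {τ : ℝ} (hτ : 0 < τ) {n : ℕ} (hn : 1 ≤ n)
    {Q : ℝ} (s : Finset ℕ) (hs : ∀ n' ∈ s, n ≤ n' ∧ (n' : ℝ) ≤ Q) (hQ : (n : ℝ) ≤ Q) :
    open Classical in
    ∑ n' ∈ s, (((badSet α τ n n').filter fun p => Parallel p.1 p.2).card : ℝ) ≤
      27 * 3 ^ d * (3 / c) * ((n : ℝ) ^ (1 / ((d + 1 : ℕ) : ℝ) * (2 + w)) *
        Q ^ (1 / ((d + 1 : ℕ) : ℝ) + τ * (14 + 4 * w + 2 * d))) := by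
  classical
  set κ := 1 / ((d + 1 : ℕ) : ℝ) with hκ
  have hκ0 : 0 < κ := by positivity
  have hn1 : (1 : ℝ) ≤ n := by exact_mod_cast hn
  have hQ1 : 1 ≤ Q := hn1.trans hQ
  have hQ0 : 0 < Q := by linarith
  set M := (n : ℝ) ^ κ * Q ^ (4 * τ)
  set M' := Q ^ (κ + 4 * τ)
  set U := Q ^ (2 * τ)
  have hM : 1 ≤ M := one_le_mul_of_one_le_of_one_le (Real.one_le_rpow hn1 hκ0.le)
    (Real.one_le_rpow hQ1 (by positivity))
  have hM' : 1 ≤ M' := Real.one_le_rpow hQ1 (by positivity)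
  have hU : 1 ≤ U := Real.one_le_rpow hQ1 (by positivity)
  have hTQ : ∀ n' ∈ s, ∀ x : ℝ, 0 ≤ x → ((n : ℝ) * n') ^ x ≤ Q ^ (2 * x) := by
    intro n' hn' x hx
    rw [Real.rpow_mul hQ0.le]
    have h2 : (Q : ℝ) ^ (2 : ℝ) = Q * Q := by rw [Real.rpow_two, sq]
    rw [h2]
    have := (hs n' hn').2
    gcongr
  set F : Finset (ℕ × ((Fin (d + 1) → ℤ) × (Fin (d + 1) → ℤ))) :=
    (s.sigma fun n' => (badSet α τ n n').filter fun p => Parallel p.1 p.2).map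
      (Equiv.sigmaEquivProd ℕ _).toEmbedding
  have hcard : ∑ n' ∈ s, (((badSet α τ n n').filter fun p => Parallel p.1 p.2).card : ℝ) =
      F.card := by
    rw [Finset.card_map, Finset.card_sigma]; push_cast; rfl
  rw [hcard]
  have hF := card_parallel_le hd hw0 hc0 hc1 h (n := n) hM hM' (zero_le_one.trans hU) (F := F) ?_
  · refine hF.trans ?_
    have hMw : 1 ≤ M ^ w := Real.one_le_rpow hM hw0
    have e1 : 2 * U + 1 ≤ 3 * U := by linarith
    have e2 : 2 * (U * M ^ w / c) + 1 ≤ 3 / c * (U * M ^ w) := by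
      have : 1 ≤ U * M ^ w / c := by
        rw [le_div_iff₀ hc0, one_mul]
        exact hc1.trans (one_le_mul_of_one_le_of_one_le hU hMw)
      have h3 : 3 / c * (U * M ^ w) = 3 * (U * M ^ w / c) := by ring
      rw [h3]; linarith
    calc 3 * M * (2 * U + 1) ^ d * (3 * M * (3 * M' * (2 * (U * M ^ w / c) + 1)))
        ≤ 3 * M * (3 * U) ^ d * (3 * M * (3 * M' * (3 / c * (U * M ^ w)))) := by gcongr
      _ = 27 * 3 ^ d * (3 / c) * (M ^ 2 * M ^ w * (U ^ d * U * M')) := by rw [mul_pow]; ring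
      _ = _ := by
        congr 1
        have h1 : M ^ 2 * M ^ w = (n : ℝ) ^ (κ * (2 + w)) * Q ^ (4 * τ * (2 + w)) := by
          rw [← Real.rpow_natCast M, ← Real.rpow_add (by linarith), Real.mul_rpow (by positivity)
            (by positivity), ← Real.rpow_mul (by positivity), ← Real.rpow_mul (by positivity)]
          norm_num
        have h2 : U ^ d * U * M' = Q ^ (2 * τ * d + 2 * τ + (κ + 4 * τ)) := by
          rw [Real.rpow_add hQ0, Real.rpow_add hQ0, Real.rpow_mul hQ0.le (2 * τ), Real.rpow_natCast]
        rw [h1, h2, mul_assoc, ← Real.rpow_add hQ0]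
        congr 2
        ring
  · intro t ht
    obtain ⟨⟨n', p⟩, hp, rfl⟩ := Finset.mem_map.1 ht
    obtain ⟨hn', hp⟩ := Finset.mem_sigma.1 hp
    obtain ⟨hp, hpar⟩ := Finset.mem_filter.1 hp
    obtain ⟨h1, h2, h3, h4, h5, h6⟩ := mem_badSet.1 hp
    simp only [Equiv.toEmbedding_apply, Equiv.sigmaEquivProd_apply]
    have hT2 := hTQ n' hn' (2 * τ) (by positivity)
    rw [show 2 * (2 * τ) = 4 * τ by ring] at hT2
    refine ⟨fun j => (h1 j).trans ?_, fun j => (h2 j).trans ?_, h3, h4, hpar, h5,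
      fun j => (h6 j).trans (hTQ n' hn' τ hτ.le)⟩
    · simp only [cutoff, M]; gcongr
    · simp only [cutoff, M']
      rw [Real.rpow_add hQ0]
      have := (hs n' hn').2
      gcongr

/-- Assumptions on the weights `L n = λ(f_n)` used in the summation. -/
structure WeightBound (d : ℕ) (τ : ℝ) (L : ℕ → ℝ) (C : ℝ) : Prop where
  nonneg : ∀ n, 0 ≤ L n
  C_nonneg : 0 ≤ C
  le : ∀ n : ℕ, 1 ≤ n → L n ≤ C * (n : ℝ) ^ (-1 + ((d + 1 : ℕ) : ℝ) * τ)

lemma sum_parallel_le {d : ℕ} (hd : 2 ≤ d) {α : Fin d → ℝ} {w : ℝ} (hw0 : 0 ≤ w)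
    {c : ℝ} (hc0 : 0 < c) (hc1 : c ≤ 1) (h : PairBound α w c) {τ : ℝ} (hτ : 0 < τ)
    (hτ1 : (3 * ((d + 1 : ℕ) : ℝ) + 14 + 4 * w) * τ ≤ 1 / 12) {L : ℕ → ℝ} {C : ℝ}
    (hL : WeightBound d τ L C) :
    open Classical in
    ∃ K : ℝ, 0 ≤ K ∧ ∀ n : ℕ, 1 ≤ n → ∀ N : ℕ, ∑ n' ∈ Finset.Icc n N,
      L n' * (((badSet α τ n n').filter fun p => Parallel p.1 p.2).card : ℝ) ≤
        K * (n : ℝ) ^ (1 / ((d + 1 : ℕ) : ℝ) * (2 + w) - 1 / 2) := by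
  classical
  have hk : (3 : ℝ) ≤ ((d + 1 : ℕ) : ℝ) := by exact_mod_cast (by omega : 3 ≤ d + 1)
  have hdk : (d : ℝ) ≤ ((d + 1 : ℕ) : ℝ) := by push_cast; linarith
  set k := ((d + 1 : ℕ) : ℝ)
  set κ := 1 / k with hκ
  have hκ0 : 0 < κ := by positivity
  have hκ1 : κ ≤ 1 / 3 := one_div_le_one_div_of_le (by norm_num) hk
  have hkτ : k * τ ≤ 1 / 12 := by nlinarith
  set K₀ := 27 * 3 ^ d * (3 / c) with hK₀
  have hK₀0 : 0 ≤ K₀ := by positivity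
  set r : ℝ := (2 : ℝ) ^ (-(1 / 12 : ℝ)) with hr
  have hr0 : 0 < r := by positivity
  have hr1 : r < 1 := Real.rpow_lt_one_of_one_lt_of_neg (by norm_num) (by norm_num)
  have hr1' : 0 < 1 - r := by linarith
  refine ⟨2 * C * K₀ * (1 - r)⁻¹, by have := hL.C_nonneg; positivity, fun n hn N => ?_⟩
  have hn1 : (1 : ℝ) ≤ n := by exact_mod_cast hn
  have hn0 : (0 : ℝ) < n := by linarith
  set b : ℕ → ℝ := fun n' => (((badSet α τ n n').filter fun p => Parallel p.1 p.2).card : ℝ)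
  change ∑ n' ∈ Finset.Icc n N, L n' * b n' ≤ _
  have hmaps : ∀ n' ∈ Finset.Icc n N, Nat.log 2 n' ∈ Finset.range (N + 1) := fun n' hn' =>
    Finset.mem_range.2 (Nat.lt_succ_of_le ((Nat.log_le_self _ _).trans (Finset.mem_Icc.1 hn').2))
  rw [← Finset.sum_fiberwise_of_maps_to hmaps]
  have hblock : ∀ j ∈ Finset.range (N + 1),
      ∑ n' ∈ (Finset.Icc n N).filter (fun n' => Nat.log 2 n' = j), L n' * b n' ≤
        2 * C * K₀ * (n : ℝ) ^ (κ * (2 + w) - 1 / 2) * r ^ j := by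
    intro j _
    set s := (Finset.Icc n N).filter (fun n' => Nat.log 2 n' = j)
    set Q : ℝ := 2 ^ (j + 1)
    rcases s.eq_empty_or_nonempty with hs | ⟨n₁, hn₁⟩
    · rw [hs, Finset.sum_empty]
      have := hL.C_nonneg
      positivity
    have hmem : ∀ n' ∈ s, n ≤ n' ∧ (n' : ℝ) ≤ Q ∧ Q / 2 ≤ n' := by
      intro n' hn'
      obtain ⟨h1, h2⟩ := Finset.mem_filter.1 hn'
      have h3 := (Finset.mem_Icc.1 h1).1
      have h4 : n' < 2 ^ (j + 1) := by
        rw [← h2]; exact Nat.lt_pow_succ_log_self (by norm_num) n'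
      have h5 : 2 ^ j ≤ n' := by
        rw [← h2]; exact Nat.pow_log_le_self 2 (by omega)
      refine ⟨h3, by simp only [Q]; exact_mod_cast h4.le, ?_⟩
      have : Q / 2 = 2 ^ j := by simp only [Q, pow_succ]; ring
      rw [this]
      exact_mod_cast h5
    have hnQ : (n : ℝ) ≤ Q :=
      le_trans (by exact_mod_cast (hmem n₁ hn₁).1) (hmem n₁ hn₁).2.1
    have hQ1 : 1 ≤ Q := hn1.trans hnQ
    have hQ0 : 0 < Q := by linarith
    have hLQ : ∀ n' ∈ s, L n' ≤ 2 * C * Q ^ (-1 + k * τ) := by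
      intro n' hn'
      obtain ⟨h1, h2, h3⟩ := hmem n' hn'
      refine (hL.le n' (hn.trans h1)).trans ?_
      have e1 : (n' : ℝ) ^ (-1 + k * τ) ≤ (Q / 2) ^ (-1 + k * τ) :=
        Real.rpow_le_rpow_of_nonpos (by positivity) h3 (by linarith)
      have e2 : (Q / 2) ^ (-1 + k * τ) ≤ 2 * Q ^ (-1 + k * τ) := by
        rw [Real.div_rpow hQ0.le (by norm_num), div_le_iff₀ (by positivity)]
        have e3 : (1 : ℝ) ≤ 2 * 2 ^ (-1 + k * τ) := by
          rw [Real.rpow_add two_pos, Real.rpow_neg_one, ← mul_assoc, mul_inv_cancel₀ two_ne_zero,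
            one_mul]
          exact Real.one_le_rpow one_le_two (by positivity)
        have e4 : 0 ≤ Q ^ (-1 + k * τ) := by positivity
        nlinarith
      calc C * (n' : ℝ) ^ (-1 + k * τ) ≤ C * (2 * Q ^ (-1 + k * τ)) := by
            have := hL.C_nonneg
            gcongr
            exact e1.trans e2
        _ = _ := by ring
    have hsum := card_filter_parallel_block_le hd hw0 hc0 hc1 h hτ hn s
      (fun n' hn' => ⟨(hmem n' hn').1, (hmem n' hn').2.1⟩) hnQ
    calc ∑ n' ∈ s, L n' * b n' ≤ ∑ n' ∈ s, 2 * C * Q ^ (-1 + k * τ) * b n' :=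
          Finset.sum_le_sum fun n' hn' =>
            mul_le_mul_of_nonneg_right (hLQ n' hn') (Nat.cast_nonneg _)
      _ = 2 * C * Q ^ (-1 + k * τ) * ∑ n' ∈ s, b n' := by rw [Finset.mul_sum]
      _ ≤ 2 * C * Q ^ (-1 + k * τ) * (K₀ * ((n : ℝ) ^ (κ * (2 + w)) *
            Q ^ (κ + τ * (14 + 4 * w + 2 * d)))) := by
          have := hL.C_nonneg
          gcongr
      _ = 2 * C * K₀ * (n : ℝ) ^ (κ * (2 + w)) *
            (Q ^ (-1 + k * τ) * Q ^ (κ + τ * (14 + 4 * w + 2 * d))) := by ring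
      _ ≤ 2 * C * K₀ * (n : ℝ) ^ (κ * (2 + w)) * ((n : ℝ) ^ (-(1 / 2 : ℝ)) * r ^ j) := by
          have := hL.C_nonneg
          refine mul_le_mul_of_nonneg_left ?_ (by positivity)
          rw [← Real.rpow_add hQ0]
          calc Q ^ (-1 + k * τ + (κ + τ * (14 + 4 * w + 2 * d)))
              ≤ Q ^ (-(1 / 2 : ℝ) + -(1 / 12 : ℝ)) := by
                apply Real.rpow_le_rpow_of_exponent_le hQ1
                nlinarith
            _ = Q ^ (-(1 / 2 : ℝ)) * Q ^ (-(1 / 12 : ℝ)) := Real.rpow_add hQ0 _ _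
            _ ≤ (n : ℝ) ^ (-(1 / 2 : ℝ)) * r ^ j := by
                gcongr ?_ * ?_
                · exact Real.rpow_le_rpow_of_nonpos hn0 hnQ (by norm_num)
                · have : Q ^ (-(1 / 12 : ℝ)) = r ^ (j + 1) := by
                    simp only [Q, r]
                    rw [← Real.rpow_natCast, ← Real.rpow_natCast, ← Real.rpow_mul (by norm_num),
                      ← Real.rpow_mul (by norm_num), mul_comm]
                  rw [this, pow_succ]
                  exact mul_le_of_le_one_right (by positivity) hr1.le
      _ = 2 * C * K₀ * ((n : ℝ) ^ (κ * (2 + w)) * (n : ℝ) ^ (-(1 / 2 : ℝ))) * r ^ j := by ring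
      _ = _ := by rw [← Real.rpow_add hn0, ← sub_eq_add_neg]
  refine (Finset.sum_le_sum hblock).trans ?_
  rw [← Finset.mul_sum]
  have hgeo : ∑ j ∈ Finset.range (N + 1), r ^ j ≤ (1 - r)⁻¹ := by
    rw [← tsum_geometric_of_lt_one hr0.le hr1]
    exact (summable_geometric_of_lt_one hr0.le hr1).sum_le_tsum _ fun _ _ => by positivity
  calc _ ≤ 2 * C * K₀ * (n : ℝ) ^ (κ * (2 + w) - 1 / 2) * (1 - r)⁻¹ := by
        have := hL.C_nonneg
        gcongr
    _ = _ := by ring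

open Classical in
/-- The non-parallel pairs in `badSet`. -/
def skewSet {d : ℕ} (α : Fin d → ℝ) (τ : ℝ) (n n' : ℕ) :
    Finset ((Fin (d + 1) → ℤ) × (Fin (d + 1) → ℤ)) :=
  (badSet α τ n n').filter fun p => ¬ Parallel p.1 p.2

lemma mem_skewSet {d : ℕ} {α : Fin d → ℝ} {τ : ℝ} {n n' : ℕ}
    {p : (Fin (d + 1) → ℤ) × (Fin (d + 1) → ℤ)} :
    p ∈ skewSet α τ n n' ↔ p ∈ badSet α τ n n' ∧ ¬ Parallel p.1 p.2 := by
  simp only [skewSet, Finset.mem_filter]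

lemma exists_abs_le {d : ℕ} (α : Fin d → ℝ) : ∃ A : ℝ, 0 ≤ A ∧ ∀ j, |α j| ≤ A :=
  ⟨∑ i, |α i|, Finset.sum_nonneg fun _ _ => abs_nonneg _, fun j =>
    Finset.single_le_sum (f := fun i => |α i|) (fun _ _ => abs_nonneg _) (Finset.mem_univ j)⟩

/-- The exponent in the gap principle. -/
def gapExp (d : ℕ) (w τ : ℝ) : ℝ := 2 * τ + (1 / ((d + 1 : ℕ) : ℝ) + 4 * τ) * (1 + 2 * w)

/-- If the gap exponent is less than `1`, non-parallel pairs are confined to bounded `n n'`. -/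
lemma card_skewSet_le_of_lt_one {d : ℕ} (hd : 2 ≤ d) {α : Fin d → ℝ} {w : ℝ} (hw0 : 0 ≤ w)
    {c : ℝ} (hc0 : 0 < c) (hc1 : c ≤ 1) (h : PairBound α w c) {τ : ℝ} (hτ : 0 < τ)
    (hγ : gapExp d w τ < 1) :
    ∃ K : ℝ, 0 ≤ K ∧ ∀ n n' : ℕ, 1 ≤ n → 1 ≤ n' →
      ((skewSet α τ n n').card : ℝ) ≤ K * ((n : ℝ) * n') ^ (-(1 / 2 : ℝ)) := by
  obtain ⟨A, hA0, hA⟩ := exists_abs_le α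
  set γ := gapExp d w τ with hγdef
  set B : ℝ := 4 * (1 + A) ^ 2 * (2 ^ w) ^ 2 / c ^ 2 with hB
  have hB0 : 0 ≤ B := by positivity
  set T₀ := B ^ (1 / (1 - γ)) with hT₀
  have hT₀0 : 0 ≤ T₀ := by positivity
  set k := ((d + 1 : ℕ) : ℝ) with hk
  refine ⟨9 ^ (d + 1) * T₀ ^ (1 + 4 * k * τ + 1 / 2), by positivity, fun n n' hn hn' => ?_⟩
  have hT := one_le_mul_cast hn hn'
  set T := (n : ℝ) * n' with hTdef
  have hT0 : 0 < T := by linarith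
  rcases (skewSet α τ n n').eq_empty_or_nonempty with he | ⟨p, hp⟩
  · rw [he, Finset.card_empty, Nat.cast_zero]
    positivity
  have hTT : T ≤ T₀ := by
    obtain ⟨hp, hpar⟩ := mem_skewSet.1 hp
    obtain ⟨h1, h2, h3, h4, h5, h6⟩ := mem_badSet.1 hp
    have hM := one_le_cutoff (d := d) hτ hn hT
    have hM' := one_le_cutoff (d := d) hτ hn' hT
    have := mul_le_of_not_parallel hd hw0 hc0 hc1 h hA hM hM' (by positivity) h1 h2 hpar h6
    rw [hTdef, cutoff_mul_cutoff hn hn', ← hTdef, ← hk] at this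
    have e1 : (T ^ τ) ^ 2 * T ^ (1 / k + 4 * τ) * ((T ^ (1 / k + 4 * τ)) ^ w) ^ 2 = T ^ γ := by
      rw [← Real.rpow_natCast (T ^ τ), ← Real.rpow_mul hT0.le, ← Real.rpow_mul hT0.le,
        ← Real.rpow_natCast (T ^ _), ← Real.rpow_mul hT0.le, ← Real.rpow_add hT0,
        ← Real.rpow_add hT0, hγdef, gapExp, ← hk]
      congr 1
      push_cast
      ring
    have e2 : T * c ^ 2 ≤ 4 * (1 + A) ^ 2 * (2 ^ w) ^ 2 * T ^ γ := by
      refine this.trans (le_of_eq ?_)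
      rw [← e1, Real.mul_rpow (x := 2) (y := T ^ (1 / k + 4 * τ)) (by norm_num) (by positivity)]
      ring
    have e3 : T ^ (1 - γ) ≤ B := by
      rw [Real.rpow_sub hT0, Real.rpow_one, div_le_iff₀ (by positivity), hB, div_mul_eq_mul_div,
        le_div_iff₀ (by positivity)]
      exact e2
    calc T = (T ^ (1 - γ)) ^ (1 / (1 - γ)) := by
          rw [← Real.rpow_mul hT0.le, mul_one_div_cancel (by linarith), Real.rpow_one]
      _ ≤ T₀ := Real.rpow_le_rpow (by positivity) e3 (by
          have : 0 < 1 - γ := by linarith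
          positivity)
  calc ((skewSet α τ n n').card : ℝ) ≤ (badSet α τ n n').card := by
        exact Nat.cast_le.2 (Finset.card_le_card fun p hp => (mem_skewSet.1 hp).1)
    _ ≤ 9 ^ (d + 1) * T ^ (1 + 4 * k * τ) := card_badSet_le α hτ hn hn'
    _ = 9 ^ (d + 1) * (T ^ (1 + 4 * k * τ + 1 / 2) * T ^ (-(1 / 2 : ℝ))) := by
        rw [← Real.rpow_add hT0]; congr 2; ring
    _ ≤ 9 ^ (d + 1) * (T₀ ^ (1 + 4 * k * τ + 1 / 2) * T ^ (-(1 / 2 : ℝ))) := by gcongr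
    _ = _ := by ring

lemma one_add_two_mul_pow_le {x : ℝ} (hx : 0 ≤ x) (d : ℕ) : (1 + 2 * x) ^ d ≤ 3 ^ d * (1 + x ^ d) := by
  have h0 : 0 ≤ x ^ d := by positivity
  rcases le_total x 1 with h | h
  · calc (1 + 2 * x) ^ d ≤ 3 ^ d := by gcongr; linarith
      _ ≤ _ := le_mul_of_one_le_right (by positivity) (by linarith)
  · calc (1 + 2 * x) ^ d ≤ (3 * x) ^ d := by gcongr; linarith
      _ = 3 ^ d * x ^ d := mul_pow _ _ _
      _ ≤ _ := by gcongr; linarith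

/-- The part of the bound for `badSet` that depends on the greatest common divisor. -/
def gcdTerm (d : ℕ) (τ : ℝ) (n n' : ℕ) : ℝ :=
  ((n : ℝ) * n') ^ (1 / ((d + 1 : ℕ) : ℝ) + 4 * τ + τ * d) *
    (cutoff d τ n ((n : ℝ) * n') * (Nat.gcd n n' : ℝ) / n') ^ d

lemma card_skewSet_le {d : ℕ} (α : Fin d → ℝ) {τ : ℝ} (hτ : 0 < τ) {n n' : ℕ} (hn : 1 ≤ n)
    (hn' : 1 ≤ n') : ((skewSet α τ n n').card : ℝ) ≤ 9 * 9 ^ d *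
      (((n : ℝ) * n') ^ (1 / ((d + 1 : ℕ) : ℝ) + 4 * τ + τ * d) + gcdTerm d τ n n') := by
  have hT := one_le_mul_cast hn hn'
  have hM := one_le_cutoff (d := d) hτ hn hT
  have hM' := one_le_cutoff (d := d) hτ hn' hT
  have h1 := card_near_line_le α (n := n) (n' := n') (by omega) hM hM'
    (U := ((n : ℝ) * n') ^ τ) (by positivity) (F := skewSet α τ n n') fun p hp => by
      obtain ⟨hp, -⟩ := mem_skewSet.1 hp
      obtain ⟨h1, h2, h3, h4, h5, h6⟩ := mem_badSet.1 hp
      exact ⟨h1, h2, h6⟩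
  refine h1.trans ?_
  rw [cutoff_mul_cutoff hn hn', gcdTerm]
  set T := (n : ℝ) * n'
  have hT0 : 0 < T := by linarith
  set x := cutoff d τ n T * (Nat.gcd n n' : ℝ) / n'
  have hx : 0 ≤ x := by positivity
  have hU : 1 ≤ T ^ τ := Real.one_le_rpow hT hτ.le
  rw [mul_pow]
  have h2 : (2 * T ^ τ + 1) ^ d ≤ 3 ^ d * T ^ (τ * d) := by
    rw [Real.rpow_mul hT0.le, Real.rpow_natCast, ← mul_pow]
    gcongr
    linarith
  have h3 := one_add_two_mul_pow_le hx d
  calc _ ≤ 9 * T ^ (1 / ((d + 1 : ℕ) : ℝ) + 4 * τ) * ((3 ^ d * T ^ (τ * d)) * (3 ^ d * (1 + x ^ d))) := by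
        gcongr
    _ = 9 * (3 ^ d * 3 ^ d) * ((T ^ (1 / ((d + 1 : ℕ) : ℝ) + 4 * τ) * T ^ (τ * d)) * (1 + x ^ d)) := by
        ring
    _ = _ := by
        rw [← Real.rpow_add hT0, ← mul_pow]
        norm_num
        ring

/-- `∑ (n' / gcd(n, n'))^(-2-τ)` over `n' ≥ n` is bounded independently of `n`. -/
lemma exists_sum_div_gcd_le {τ : ℝ} (hτ : 0 < τ) :
    ∃ K : ℝ, 0 ≤ K ∧ ∀ n : ℕ, 1 ≤ n → ∀ N : ℕ, ∑ n' ∈ Finset.Icc n N,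
      ((n' / Nat.gcd n n' : ℕ) : ℝ) ^ (-2 - τ) ≤ K := by
  set u : ℕ → ℝ := fun h => (h : ℝ) ^ (-1 - τ / 2)
  have hu : Summable u := Real.summable_nat_rpow.2 (by linarith)
  have hu0 : ∀ h, 0 ≤ u h := fun h => by positivity
  refine ⟨(∑' h, u h) * ∑' h, u h, mul_nonneg (tsum_nonneg hu0) (tsum_nonneg hu0),
    fun n hn N => ?_⟩
  have hinj : Set.InjOn (fun n' => (n / Nat.gcd n n', n' / Nat.gcd n n')) (Finset.Icc n N) := by
    intro a ha b hb hab
    simp only [Prod.mk.injEq] at hab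
    have hga : 0 < Nat.gcd n a := Nat.gcd_pos_of_pos_left _ hn
    have hgb : 0 < Nat.gcd n b := Nat.gcd_pos_of_pos_left _ hn
    have h1 : n = Nat.gcd n a * (n / Nat.gcd n a) := (Nat.mul_div_cancel' (Nat.gcd_dvd_left _ _)).symm
    have h2 : n = Nat.gcd n b * (n / Nat.gcd n b) := (Nat.mul_div_cancel' (Nat.gcd_dvd_left _ _)).symm
    have h3 : a = Nat.gcd n a * (a / Nat.gcd n a) := (Nat.mul_div_cancel' (Nat.gcd_dvd_right _ _)).symm
    have h4 : b = Nat.gcd n b * (b / Nat.gcd n b) := (Nat.mul_div_cancel' (Nat.gcd_dvd_right _ _)).symm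
    have hpos : 0 < n / Nat.gcd n b := by
      rcases Nat.eq_zero_or_pos (n / Nat.gcd n b) with h | h
      · rw [h] at h2; omega
      · exact h
    have hg : Nat.gcd n a = Nat.gcd n b := by
      rw [hab.1] at h1
      exact Nat.eq_of_mul_eq_mul_right hpos (h1.symm.trans h2)
    rw [h3, h4, hab.2, hg]
  set φ := fun n' : ℕ => (n / Nat.gcd n n', n' / Nat.gcd n n')
  have hterm : ∀ n' ∈ Finset.Icc n N, ((n' / Nat.gcd n n' : ℕ) : ℝ) ^ (-2 - τ) ≤
      u (φ n').1 * u (φ n').2 := by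
    intro n' hn'
    have hnn := (Finset.mem_Icc.1 hn').1
    have hg : 0 < Nat.gcd n n' := Nat.gcd_pos_of_pos_left _ hn
    have h1 : 1 ≤ n / Nat.gcd n n' := Nat.div_pos (Nat.gcd_le_left _ hn) hg
    have h2 : n / Nat.gcd n n' ≤ n' / Nat.gcd n n' := Nat.div_le_div_right hnn
    have h1' : (0 : ℝ) < ((n / Nat.gcd n n' : ℕ) : ℝ) := by exact_mod_cast h1
    have h2' : ((n / Nat.gcd n n' : ℕ) : ℝ) ≤ ((n' / Nat.gcd n n' : ℕ) : ℝ) := by exact_mod_cast h2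
    have h3' := h1'.trans_le h2'
    simp only [φ, u]
    rw [show -2 - τ = (-1 - τ / 2) + (-1 - τ / 2) by ring, Real.rpow_add h3']
    gcongr ?_ * _
    exact Real.rpow_le_rpow_of_nonpos h1' h2' (by linarith)
  refine (Finset.sum_le_sum hterm).trans ?_
  have h1 : ∑ n' ∈ Finset.Icc n N, u (φ n').1 * u (φ n').2 =
      ∑ q ∈ (Finset.Icc n N).image φ, u q.1 * u q.2 := (Finset.sum_image (f := fun q : ℕ × ℕ => u q.1 * u q.2) hinj).symm
  rw [h1]
  set R := (Finset.Icc n N).image φ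
  calc ∑ q ∈ R, u q.1 * u q.2 ≤ ∑ q ∈ R.image Prod.fst ×ˢ R.image Prod.snd, u q.1 * u q.2 :=
        Finset.sum_le_sum_of_subset_of_nonneg Finset.subset_product
          fun _ _ _ => mul_nonneg (hu0 _) (hu0 _)
    _ = (∑ h ∈ R.image Prod.fst, u h) * ∑ h ∈ R.image Prod.snd, u h := by
        rw [Finset.sum_mul_sum, Finset.sum_product]
    _ ≤ _ := mul_le_mul (hu.sum_le_tsum _ fun _ _ => hu0 _) (hu.sum_le_tsum _ fun _ _ => hu0 _)
        (Finset.sum_nonneg fun _ _ => hu0 _) (tsum_nonneg hu0)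

lemma sum_gcdTerm_le {d : ℕ} (hd : 2 ≤ d) {τ : ℝ} (hτ : 0 < τ)
    (hτ1 : (7 * ((d + 1 : ℕ) : ℝ) + 3) * τ ≤ 1 / 6) {L : ℕ → ℝ} {C : ℝ}
    (hL : WeightBound d τ L C) :
    ∃ K : ℝ, 0 ≤ K ∧ ∀ n : ℕ, 1 ≤ n → ∀ N : ℕ, ∑ n' ∈ Finset.Icc n N, L n' * gcdTerm d τ n n' ≤
      K * (n : ℝ) ^ (1 / ((d + 1 : ℕ) : ℝ) + (7 * ((d + 1 : ℕ) : ℝ) + 3) * τ) := by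
  obtain ⟨K, hK0, hK⟩ := exists_sum_div_gcd_le hτ
  have hk : (3 : ℝ) ≤ ((d + 1 : ℕ) : ℝ) := by exact_mod_cast (by omega : 3 ≤ d + 1)
  have hdk : (d : ℝ) = ((d + 1 : ℕ) : ℝ) - 1 := by push_cast; ring
  set k := ((d + 1 : ℕ) : ℝ)
  set κ := 1 / k with hκ
  have hκ0 : 0 < κ := by positivity
  have hκ1 : κ ≤ 1 / 3 := one_div_le_one_div_of_le (by norm_num) hk
  have hκd : κ * d = 1 - κ := by rw [hdk, hκ]; field_simp
  have hC := hL.C_nonneg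
  refine ⟨C * K, by positivity, fun n hn N => ?_⟩
  have hn1 : (1 : ℝ) ≤ n := by exact_mod_cast hn
  have hn0 : (0 : ℝ) < n := by linarith
  have hterm : ∀ n' ∈ Finset.Icc n N, L n' * gcdTerm d τ n n' ≤
      C * (n : ℝ) ^ (κ + (7 * k + 3) * τ) * ((n' / Nat.gcd n n' : ℕ) : ℝ) ^ (-2 - τ) := by
    intro n' hmem
    have hnn : n ≤ n' := (Finset.mem_Icc.1 hmem).1
    have hn' : 1 ≤ n' := hn.trans hnn
    have hnn' : (n : ℝ) ≤ n' := by exact_mod_cast hnn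
    have hn'1 : (1 : ℝ) ≤ n' := by exact_mod_cast hn'
    have hn'0 : (0 : ℝ) < n' := by linarith
    have hT := one_le_mul_cast hn hn'
    have hg : 0 < Nat.gcd n n' := Nat.gcd_pos_of_pos_left _ hn
    have hgn : Nat.gcd n n' ≤ n' := Nat.gcd_le_right _ hn'
    set ν : ℝ := ((n' / Nat.gcd n n' : ℕ) : ℝ) with hν
    have hν1 : 1 ≤ ν := by
      rw [hν]; exact_mod_cast Nat.div_pos hgn hg
    have hν0 : 0 < ν := by linarith
    have hνn : ν ≤ n' := by rw [hν]; exact_mod_cast Nat.div_le_self _ _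
    have hνinv : (Nat.gcd n n' : ℝ) / n' = ν⁻¹ := by
      rw [hν, Nat.cast_div (Nat.gcd_dvd_right _ _) (by positivity), inv_div]
    have hg1 : gcdTerm d τ n n' ≤ (n' : ℝ) ^ (κ + 8 * τ + 6 * τ * d) * n * ν ^ (-2 : ℝ) := by
      rw [gcdTerm, mul_div_assoc, hνinv, mul_pow]
      have a1 : (cutoff d τ n ((n : ℝ) * n')) ^ d = (n : ℝ) ^ (1 - κ) * ((n : ℝ) * n') ^ (2 * τ * d) := by
        rw [cutoff, mul_pow, ← Real.rpow_natCast, ← Real.rpow_natCast, ← Real.rpow_mul hn0.le,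
          ← Real.rpow_mul (by positivity)]
        rw [← hκ, hκd]
      have a2 : ν⁻¹ ^ d ≤ ν ^ (-2 : ℝ) := by
        rw [Real.rpow_neg hν0.le, Real.rpow_two, ← inv_pow]
        exact pow_le_pow_of_le_one (by positivity) (inv_le_one_of_one_le₀ hν1) hd
      have a3 : ((n : ℝ) * n') ^ (4 * τ + 3 * τ * d) ≤ (n' : ℝ) ^ (8 * τ + 6 * τ * d) := by
        rw [show 8 * τ + 6 * τ * d = 2 * (4 * τ + 3 * τ * d) by ring, Real.rpow_mul hn'0.le,
          Real.rpow_two, sq]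
        gcongr
      have a4 : ((n : ℝ) * n') ^ (κ + 4 * τ + τ * d) * ((n : ℝ) * n') ^ (2 * τ * d) =
          (n : ℝ) ^ κ * (n' : ℝ) ^ κ * ((n : ℝ) * n') ^ (4 * τ + 3 * τ * d) := by
        rw [← Real.mul_rpow hn0.le hn'0.le, ← Real.rpow_add (by positivity),
          ← Real.rpow_add (by positivity)]
        congr 1; ring
      have a5 : (n : ℝ) ^ κ * (n : ℝ) ^ (1 - κ) = n := by
        rw [← Real.rpow_add hn0, add_sub_cancel, Real.rpow_one]
      rw [a1]
      calc _ = (((n : ℝ) * n') ^ (κ + 4 * τ + τ * d) * ((n : ℝ) * n') ^ (2 * τ * d)) *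
            (n : ℝ) ^ (1 - κ) * ν⁻¹ ^ d := by ring
        _ = ((n : ℝ) ^ κ * (n : ℝ) ^ (1 - κ)) * (n' : ℝ) ^ κ *
            ((n : ℝ) * n') ^ (4 * τ + 3 * τ * d) * ν⁻¹ ^ d := by rw [a4]; ring
        _ ≤ n * (n' : ℝ) ^ κ * (n' : ℝ) ^ (8 * τ + 6 * τ * d) * ν ^ (-2 : ℝ) := by
            rw [a5]; gcongr
        _ = n * ((n' : ℝ) ^ κ * (n' : ℝ) ^ (8 * τ + 6 * τ * d)) * ν ^ (-2 : ℝ) := by ring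
        _ = _ := by rw [← Real.rpow_add hn'0, ← add_assoc]; ring
    have hg2 : (n' : ℝ) ^ (-1 + k * τ) * (n' : ℝ) ^ (κ + 8 * τ + 6 * τ * d) ≤
        (n : ℝ) ^ (-1 + κ + (7 * k + 3) * τ) * ν ^ (-τ) := by
      rw [← Real.rpow_add hn'0]
      have : -1 + k * τ + (κ + 8 * τ + 6 * τ * d) = (-1 + κ + (7 * k + 3) * τ) + -τ := by
        rw [hdk]; ring
      rw [this, Real.rpow_add hn'0]
      gcongr ?_ * ?_
      · exact Real.rpow_le_rpow_of_nonpos hn0 hnn' (by linarith)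
      · exact Real.rpow_le_rpow_of_nonpos hν0 hνn (by linarith)
    have hg0 : 0 ≤ gcdTerm d τ n n' := by rw [gcdTerm, cutoff]; positivity
    calc L n' * gcdTerm d τ n n' ≤ (C * (n' : ℝ) ^ (-1 + k * τ)) *
          ((n' : ℝ) ^ (κ + 8 * τ + 6 * τ * d) * n * ν ^ (-2 : ℝ)) :=
          mul_le_mul (hL.le n' hn') hg1 hg0 (by positivity)
      _ = C * n * ν ^ (-2 : ℝ) * ((n' : ℝ) ^ (-1 + k * τ) * (n' : ℝ) ^ (κ + 8 * τ + 6 * τ * d)) := by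
          ring
      _ ≤ C * n * ν ^ (-2 : ℝ) * ((n : ℝ) ^ (-1 + κ + (7 * k + 3) * τ) * ν ^ (-τ)) := by gcongr
      _ = C * (n ^ (1 : ℝ) * (n : ℝ) ^ (-1 + κ + (7 * k + 3) * τ)) * (ν ^ (-2 : ℝ) * ν ^ (-τ)) := by
          rw [Real.rpow_one]; ring
      _ = _ := by
          rw [← Real.rpow_add hn0, ← Real.rpow_add hν0]
          congr 3
          ring
  refine (Finset.sum_le_sum hterm).trans ?_
  rw [← Finset.mul_sum]
  calc _ ≤ C * (n : ℝ) ^ (κ + (7 * k + 3) * τ) * K := by gcongr; exact hK n hn N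
    _ = _ := by ring

lemma sum_pair_le_two_mul {G : ℕ → ℕ → ℝ} (hsymm : ∀ n n', G n n' = G n' n)
    (hG : ∀ n n', 0 ≤ G n n') (N : ℕ) :
    ∑ n ∈ Finset.Icc 1 N, ∑ n' ∈ Finset.Icc 1 N, G n n' ≤
      2 * ∑ n ∈ Finset.Icc 1 N, ∑ n' ∈ Finset.Icc n N, G n n' := by
  have h1 : ∀ n ∈ Finset.Icc 1 N, ∑ n' ∈ Finset.Icc n N, G n n' =
      ∑ n' ∈ Finset.Icc 1 N, if n ≤ n' then G n n' else 0 := by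
    intro n hn
    rw [← Finset.sum_filter]
    congr 1
    ext x
    simp only [Finset.mem_Icc, Finset.mem_filter] at hn ⊢
    omega
  rw [Finset.sum_congr rfl h1, two_mul]
  have h2 : ∑ n ∈ Finset.Icc 1 N, ∑ n' ∈ Finset.Icc 1 N, (if n ≤ n' then G n n' else 0) =
      ∑ n ∈ Finset.Icc 1 N, ∑ n' ∈ Finset.Icc 1 N, (if n' ≤ n then G n n' else 0) := by
    rw [Finset.sum_comm]
    refine Finset.sum_congr rfl fun n _ => Finset.sum_congr rfl fun n' _ => ?_
    rw [hsymm]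
  conv_rhs => rw [h2]
  conv_rhs => arg 1; rw [← h2]
  rw [← Finset.sum_add_distrib]
  refine Finset.sum_le_sum fun n _ => ?_
  rw [← Finset.sum_add_distrib]
  refine Finset.sum_le_sum fun n' _ => ?_
  have := hG n n'
  rcases le_total n n' with h | h
  · rw [if_pos h]; split_ifs <;> linarith
  · rw [if_pos h]; split_ifs <;> linarith

lemma sum_mul_rpow_pair (L : ℕ → ℝ) (e : ℝ) (N : ℕ) :
    ∑ n ∈ Finset.Icc 1 N, ∑ n' ∈ Finset.Icc 1 N, L n * L n' * ((n : ℝ) * n') ^ e =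
      (∑ n ∈ Finset.Icc 1 N, L n * (n : ℝ) ^ e) ^ 2 := by
  rw [sq, Finset.sum_mul_sum]
  refine Finset.sum_congr rfl fun n _ => Finset.sum_congr rfl fun n' _ => ?_
  rw [Real.mul_rpow (Nat.cast_nonneg _) (Nat.cast_nonneg _)]
  ring

lemma exists_sum_le_mul_sq {L : ℕ → ℝ} (hL : ∀ n, 0 ≤ L n) (e : ℝ) :
    ∃ K : ℝ, 0 ≤ K ∧ ∀ N : ℕ, ∑ n ∈ Finset.Icc 1 N, L n * (n : ℝ) ^ e ≤
      K * (∑ n ∈ Finset.Icc 1 N, L n * (n : ℝ) ^ e) ^ 2 := by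
  by_cases h : ∃ n, 1 ≤ n ∧ L n ≠ 0
  · classical
    set n₀ := Nat.find h
    obtain ⟨h1, h2⟩ := Nat.find_spec h
    have hz : 0 < L n₀ * (n₀ : ℝ) ^ e :=
      mul_pos (lt_of_le_of_ne (hL _) (Ne.symm h2)) (Real.rpow_pos_of_pos (by exact_mod_cast h1) _)
    refine ⟨(L n₀ * (n₀ : ℝ) ^ e)⁻¹, by positivity, fun N => ?_⟩
    rcases lt_or_ge N n₀ with hN | hN
    · have : ∑ n ∈ Finset.Icc 1 N, L n * (n : ℝ) ^ e = 0 := by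
        refine Finset.sum_eq_zero fun n hn => ?_
        have hn := Finset.mem_Icc.1 hn
        have := Nat.find_min h (lt_of_le_of_lt hn.2 hN)
        push Not at this
        rw [this hn.1, zero_mul]
      rw [this]; simp
    · have : L n₀ * (n₀ : ℝ) ^ e ≤ ∑ n ∈ Finset.Icc 1 N, L n * (n : ℝ) ^ e :=
        Finset.single_le_sum (f := fun n => L n * (n : ℝ) ^ e)
          (fun n _ => mul_nonneg (hL n) (by positivity)) (Finset.mem_Icc.2 ⟨h1, hN⟩)
      rw [inv_mul_eq_div, le_div_iff₀ hz, sq]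
      exact mul_le_mul_of_nonneg_left this (hz.le.trans this)
  · push Not at h
    refine ⟨0, le_rfl, fun N => ?_⟩
    rw [zero_mul]
    refine Finset.sum_nonpos fun n hn => ?_
    rw [h n (Finset.mem_Icc.1 hn).1, zero_mul]

set_option maxHeartbeats 1000000 in
/-- The weighted count of all substantial pairs of frequencies. -/
theorem exists_sum_badSet_le {d : ℕ} (hd : 2 ≤ d) {α : Fin d → ℝ} {ρ : ℝ} (hρ0 : 0 ≤ ρ)
    (hρ : omegaTwo α = (ρ : EReal)) :
    ∃ c₀ : ℝ, 0 < c₀ ∧ ∀ (τ : ℝ), 0 < τ → τ < 1 / ((d + 1 : ℕ) : ℝ) → ∀ (L : ℕ → ℝ) (C : ℝ),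
      WeightBound d τ L C → ∀ e : ℝ, -1 / 2 + (ρ + 2) / ((d + 1 : ℕ) : ℝ) + c₀ * τ ≤ e →
      ∃ K : ℝ, 0 ≤ K ∧ ∀ N : ℕ,
        ∑ n ∈ Finset.Icc 1 N, ∑ n' ∈ Finset.Icc 1 N, L n * L n' * ((badSet α τ n n').card : ℝ) ≤
          K * ∑ n ∈ Finset.Icc 1 N, ∑ n' ∈ Finset.Icc 1 N, L n * L n' * ((n : ℝ) * n') ^ e := by
  classical
  have hk : (3 : ℝ) ≤ ((d + 1 : ℕ) : ℝ) := by exact_mod_cast (by omega : 3 ≤ d + 1)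
  have hdk : (d : ℝ) = ((d + 1 : ℕ) : ℝ) - 1 := by push_cast; ring
  set k := ((d + 1 : ℕ) : ℝ) with hkdef
  set κ := 1 / k with hκ
  have hκ0 : 0 < κ := by positivity
  have hκ1 : κ ≤ 1 / 3 := one_div_le_one_div_of_le (by norm_num) hk
  have hρκ : (ρ + 2) / k = (ρ + 2) * κ := by rw [hκ]; ring
  have hkκ : k * κ = 1 := mul_one_div_cancel (by positivity)
  set τ₁ := 1 / (300 * (k + ρ + 1)) with hτ₁
  have hτ₁0 : 0 < τ₁ := by positivity
  have hτ₁k : 300 * (k + ρ + 1) * τ₁ = 1 := mul_one_div_cancel (by positivity)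
  refine ⟨6 / τ₁ + 8 * k + 8 * ρ + 30, by positivity, fun τ hτ hτκ L C hL e he => ?_⟩
  have hC := hL.C_nonneg
  have hL0 := hL.nonneg
  have hkτ : k * τ < 1 := by
    calc k * τ < k * κ := by gcongr
      _ = 1 := hkκ
  have h6 : 0 < 6 / τ₁ * τ := by positivity
  have hkτ0 : 0 < k * τ := by positivity
  have hρτ0 : 0 ≤ ρ * τ := by positivity
  have hρκ0 : 0 ≤ ρ * κ := by positivity
  rw [hρκ] at he
  have he2 : -1 / 2 + (ρ + 2) * κ + 6 / τ₁ * τ + 8 * (k * τ) + 8 * (ρ * τ) + 30 * τ ≤ e :=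
    le_trans (le_of_eq (by ring)) he
  have hpow : ∀ n n' : ℕ, 1 ≤ n → 1 ≤ n' → ∀ x : ℝ, x ≤ e →
      ((n : ℝ) * n') ^ x ≤ ((n : ℝ) * n') ^ e := fun n n' hn hn' x hx =>
    Real.rpow_le_rpow_of_exponent_le (one_le_mul_cast hn hn') hx
  by_cases hbig : τ₁ ≤ τ
  · have h61 : 6 ≤ 6 / τ₁ * τ := by
      rw [div_mul_eq_mul_div, le_div_iff₀ hτ₁0]
      gcongr
    refine ⟨9 ^ (d + 1), by positivity, fun N => ?_⟩
    rw [Finset.mul_sum]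
    refine Finset.sum_le_sum fun n hn => ?_
    rw [Finset.mul_sum]
    refine Finset.sum_le_sum fun n' hn' => ?_
    have hn := (Finset.mem_Icc.1 hn).1
    have hn' := (Finset.mem_Icc.1 hn').1
    calc L n * L n' * ((badSet α τ n n').card : ℝ)
        ≤ L n * L n' * (9 ^ (d + 1) * ((n : ℝ) * n') ^ e) := by
          have h0 := mul_nonneg (hL0 n) (hL0 n')
          gcongr
          refine (card_badSet_le α hτ hn hn').trans ?_
          gcongr ?_ * ?_
          refine hpow n n' hn hn' _ ?_
          nlinarith
      _ = _ := by ring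
  push Not at hbig
  have hsmall : 300 * (k * τ) + 300 * (ρ * τ) + 300 * τ ≤ 1 := by
    calc _ = 300 * (k + ρ + 1) * τ := by ring
      _ ≤ 300 * (k + ρ + 1) * τ₁ := by gcongr
      _ = 1 := hτ₁k
  set w := ρ + τ with hw
  have hw0 : 0 ≤ w := by positivity
  obtain ⟨c, hc0, hc1, hpair⟩ := exists_pairBound (α := α) hw0 (by
    rw [hρ, hw]; exact_mod_cast (by linarith : ρ < ρ + τ))
  have hττ : τ * τ ≤ τ := by nlinarith
  have hκτ : κ * τ ≤ τ := by nlinarith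
  obtain ⟨K₁, hK₁0, hK₁⟩ := sum_parallel_le hd hw0 hc0 hc1 hpair hτ
    (by rw [hw, ← hkdef]; nlinarith) hL
  obtain ⟨K₂, hK₂0, hK₂⟩ := sum_gcdTerm_le hd hτ (by rw [← hkdef]; nlinarith) hL
  obtain ⟨K₃, hK₃0, hK₃⟩ := exists_sum_le_mul_sq hL0 e
  have hskew : ∃ K₄ K₅ : ℝ, 0 ≤ K₄ ∧ 0 ≤ K₅ ∧ ∀ n : ℕ, 1 ≤ n → ∀ N : ℕ,
      ∑ n' ∈ Finset.Icc n N, L n' * ((skewSet α τ n n').card : ℝ) ≤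
        K₄ * ∑ n' ∈ Finset.Icc n N, L n' * ((n : ℝ) * n') ^ e + K₅ * (n : ℝ) ^ e := by
    by_cases hγ : gapExp d w τ < 1
    · obtain ⟨K₄, hK₄0, hK₄⟩ := card_skewSet_le_of_lt_one hd hw0 hc0 hc1 hpair hτ hγ
      refine ⟨K₄, 0, hK₄0, le_rfl, fun n hn N => ?_⟩
      rw [zero_mul, add_zero, Finset.mul_sum]
      refine Finset.sum_le_sum fun n' hn' => ?_
      have hn' : 1 ≤ n' := hn.trans (Finset.mem_Icc.1 hn').1
      calc L n' * ((skewSet α τ n n').card : ℝ)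
          ≤ L n' * (K₄ * ((n : ℝ) * n') ^ e) := by
            have := hL0 n'
            gcongr
            refine (hK₄ n n' hn hn').trans ?_
            gcongr ?_ * ?_
            exact hpow n n' hn hn' _ (by nlinarith)
        _ = _ := by ring
    · have hγ' : 1 ≤ κ + 2 * (ρ * κ) + 8 * (ρ * τ) + 16 * τ := by
        have h1 : 1 ≤ gapExp d w τ := not_lt.1 hγ
        rw [gapExp, ← hkdef, ← hκ, hw] at h1
        nlinarith
      have he3 : κ + 7 * (k * τ) + 4 * τ ≤ e := by linarith
      refine ⟨9 * 9 ^ d, 9 * 9 ^ d * K₂, by positivity, by positivity, fun n hn N => ?_⟩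
      have hn1 : (1 : ℝ) ≤ n := by exact_mod_cast hn
      calc ∑ n' ∈ Finset.Icc n N, L n' * ((skewSet α τ n n').card : ℝ)
          ≤ ∑ n' ∈ Finset.Icc n N, (9 * 9 ^ d * (L n' * ((n : ℝ) * n') ^ e) +
              9 * 9 ^ d * (L n' * gcdTerm d τ n n')) := by
            refine Finset.sum_le_sum fun n' hn' => ?_
            have hn' : 1 ≤ n' := hn.trans (Finset.mem_Icc.1 hn').1
            have h1 := card_skewSet_le α hτ hn hn'
            have h2 := hpow n n' hn hn' (κ + 4 * τ + τ * d) (by rw [hdk]; linarith)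
            have h0 := hL0 n'
            calc L n' * ((skewSet α τ n n').card : ℝ)
                ≤ L n' * (9 * 9 ^ d * (((n : ℝ) * n') ^ (κ + 4 * τ + τ * d) + gcdTerm d τ n n')) := by
                  gcongr
              _ ≤ L n' * (9 * 9 ^ d * (((n : ℝ) * n') ^ e + gcdTerm d τ n n')) := by gcongr
              _ = _ := by ring
        _ = 9 * 9 ^ d * ∑ n' ∈ Finset.Icc n N, L n' * ((n : ℝ) * n') ^ e +
            9 * 9 ^ d * ∑ n' ∈ Finset.Icc n N, L n' * gcdTerm d τ n n' := by
            rw [Finset.sum_add_distrib, Finset.mul_sum, Finset.mul_sum]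
        _ ≤ 9 * 9 ^ d * ∑ n' ∈ Finset.Icc n N, L n' * ((n : ℝ) * n') ^ e +
            9 * 9 ^ d * (K₂ * (n : ℝ) ^ e) := by
            gcongr
            refine (hK₂ n hn N).trans ?_
            gcongr ?_ * ?_
            exact Real.rpow_le_rpow_of_exponent_le hn1 (by rw [← hkdef, ← hκ]; linarith)
        _ = _ := by ring
  obtain ⟨K₄, K₅, hK₄0, hK₅0, hK₄⟩ := hskew
  refine ⟨2 * (K₄ + (K₁ + K₅) * K₃), by positivity, fun N => ?_⟩
  set Z := ∑ n ∈ Finset.Icc 1 N, L n * (n : ℝ) ^ e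
  have hinner : ∀ n ∈ Finset.Icc 1 N,
      ∑ n' ∈ Finset.Icc n N, L n * L n' * ((badSet α τ n n').card : ℝ) ≤
      K₄ * ∑ n' ∈ Finset.Icc 1 N, L n * L n' * ((n : ℝ) * n') ^ e +
        (K₁ + K₅) * (L n * (n : ℝ) ^ e) := by
    intro n hn
    have hn := (Finset.mem_Icc.1 hn).1
    have hn1 : (1 : ℝ) ≤ n := by exact_mod_cast hn
    have h0 := hL0 n
    have hsplit : ∀ n', ((badSet α τ n n').card : ℝ) =
        (((badSet α τ n n').filter fun p => Parallel p.1 p.2).card : ℝ) +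
          ((skewSet α τ n n').card : ℝ) := fun n' => by
      rw [skewSet]
      exact_mod_cast (Finset.card_filter_add_card_filter_not _).symm
    calc ∑ n' ∈ Finset.Icc n N, L n * L n' * ((badSet α τ n n').card : ℝ)
        = L n * (∑ n' ∈ Finset.Icc n N, L n' *
            (((badSet α τ n n').filter fun p => Parallel p.1 p.2).card : ℝ) +
          ∑ n' ∈ Finset.Icc n N, L n' * ((skewSet α τ n n').card : ℝ)) := by
          rw [← Finset.sum_add_distrib, Finset.mul_sum]
          refine Finset.sum_congr rfl fun n' _ => ?_
          rw [hsplit]; ring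
      _ ≤ L n * (K₁ * (n : ℝ) ^ e + (K₄ * ∑ n' ∈ Finset.Icc 1 N, L n' * ((n : ℝ) * n') ^ e +
            K₅ * (n : ℝ) ^ e)) := by
          gcongr ?_ * (?_ + ?_)
          · refine (hK₁ n hn N).trans ?_
            gcongr ?_ * ?_
            refine Real.rpow_le_rpow_of_exponent_le hn1 ?_
            rw [← hkdef, ← hκ, hw]
            nlinarith
          · refine (hK₄ n hn N).trans ?_
            gcongr ?_ + _
            refine mul_le_mul_of_nonneg_left ?_ hK₄0
            refine Finset.sum_le_sum_of_subset_of_nonneg (Finset.Icc_subset_Icc_left hn) ?_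
            intro n' _ _
            have := hL0 n'
            positivity
      _ = _ := by
          rw [Finset.mul_sum, Finset.mul_sum, mul_add, mul_add, Finset.mul_sum]
          rw [show ∀ a b c : ℝ, a + (b + c) = b + (a + c) by intros; ring]
          congr 1
          · refine Finset.sum_congr rfl fun n' _ => ?_
            ring
          · ring
  refine (sum_pair_le_two_mul (G := fun n n' => L n * L n' * ((badSet α τ n n').card : ℝ))
    (fun n n' => by simp only [card_badSet_comm α τ n n']; ring)
    (fun n n' => mul_nonneg (mul_nonneg (hL0 n) (hL0 n')) (Nat.cast_nonneg _)) N).trans ?_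
  have hZ : ∑ n ∈ Finset.Icc 1 N, ∑ n' ∈ Finset.Icc 1 N, L n * L n' * ((n : ℝ) * n') ^ e = Z ^ 2 :=
    sum_mul_rpow_pair L e N
  calc _ ≤ 2 * ∑ n ∈ Finset.Icc 1 N, (K₄ * ∑ n' ∈ Finset.Icc 1 N, L n * L n' * ((n : ℝ) * n') ^ e +
        (K₁ + K₅) * (L n * (n : ℝ) ^ e)) := by
        gcongr with n hn
        exact hinner n hn
    _ = 2 * (K₄ * Z ^ 2 + (K₁ + K₅) * Z) := by
        rw [Finset.sum_add_distrib, ← Finset.mul_sum, ← Finset.mul_sum, hZ]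
    _ ≤ 2 * (K₄ * Z ^ 2 + (K₁ + K₅) * (K₃ * Z ^ 2)) := by
        gcongr
        exact hK₃ N
    _ = _ := by rw [hZ]; ring

/-! ### Fourier series and integrals -/

/-- The real character `x ↦ exp(2πi ζ · x)`. -/
def chiR {k : ℕ} (ζ x : Fin k → ℝ) : ℂ := Complex.exp (2 * Real.pi * Complex.I * (ζ ⬝ᵥ x : ℝ))

/-- The character `x ↦ exp(2πi ξ · x)` for an integer vector `ξ`. -/
def chi {k : ℕ} (ξ : Fin k → ℤ) (x : Fin k → ℝ) : ℂ := chiR (fun j => (ξ j : ℝ)) x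

lemma norm_chiR {k : ℕ} (ζ x : Fin k → ℝ) : ‖chiR ζ x‖ = 1 := by
  rw [chiR, mul_comm (2 * (Real.pi : ℂ)) Complex.I, mul_assoc, mul_comm]
  have : (2 * (Real.pi : ℂ) * ((ζ ⬝ᵥ x : ℝ) : ℂ)) = ((2 * Real.pi * (ζ ⬝ᵥ x) : ℝ) : ℂ) := by
    push_cast; ring
  rw [this, Complex.norm_exp_ofReal_mul_I]

lemma norm_chi {k : ℕ} (ξ : Fin k → ℤ) (x : Fin k → ℝ) : ‖chi ξ x‖ = 1 := norm_chiR _ _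

lemma chi_add {k : ℕ} (ξ ξ' : Fin k → ℤ) (x : Fin k → ℝ) : chi (ξ + ξ') x = chi ξ x * chi ξ' x := by
  rw [chi, chi, chi, chiR, chiR, chiR, ← Complex.exp_add]
  congr 1
  have : (fun j => (((ξ + ξ') j : ℤ) : ℝ)) = (fun j => (ξ j : ℝ)) + fun j => (ξ' j : ℝ) := by
    funext j; simp
  rw [this, add_dotProduct]
  push_cast
  ring

lemma chi_zero {k : ℕ} (x : Fin k → ℝ) : chi 0 x = 1 := by
  have : (fun j => (((0 : Fin k → ℤ) j : ℤ) : ℝ)) = 0 := by funext j; simp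
  rw [chi, chiR, this, zero_dotProduct]
  simp

lemma continuous_chiR {k : ℕ} (ζ : Fin k → ℝ) : Continuous (chiR ζ) := by
  unfold chiR dotProduct
  fun_prop

lemma continuous_chi {k : ℕ} (ξ : Fin k → ℤ) : Continuous (chi ξ) := continuous_chiR _

/-- The Fourier coefficient of a measure. -/
def muHat {k : ℕ} (μ : Measure (Fin k → ℝ)) (ξ : Fin k → ℤ) : ℂ := ∫ x, chi ξ x ∂μ

lemma norm_muHat_le {k : ℕ} (μ : Measure (Fin k → ℝ)) [IsProbabilityMeasure μ] (ξ : Fin k → ℤ) :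
    ‖muHat μ ξ‖ ≤ 1 := by
  refine (norm_integral_le_integral_norm _).trans ?_
  simp [norm_chi]

lemma muHat_zero {k : ℕ} (μ : Measure (Fin k → ℝ)) [IsProbabilityMeasure μ] : muHat μ 0 = 1 := by
  simp [muHat, chi_zero]

lemma integrable_chi {k : ℕ} (μ : Measure (Fin k → ℝ)) [IsProbabilityMeasure μ] (ξ : Fin k → ℤ) :
    Integrable (chi ξ) μ :=
  (integrable_const (1 : ℝ)).mono' (continuous_chi ξ).aestronglyMeasurable
    (Eventually.of_forall fun x => (norm_chi ξ x).le)

lemma integral_of_hasSum_chi {k : ℕ} {ι : Type*} [Countable ι] (μ : Measure (Fin k → ℝ))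
    [IsProbabilityMeasure μ] {a : ι → ℂ} {ξ : ι → Fin k → ℤ} (ha : Summable fun i => ‖a i‖)
    {g : (Fin k → ℝ) → ℂ} (hg : ∀ x, HasSum (fun i => a i * chi (ξ i) x) (g x)) :
    HasSum (fun i => a i * muHat μ (ξ i)) (∫ x, g x ∂μ) := by
  have h := hasSum_integral_of_summable_integral_norm (μ := μ) (F := fun i x => a i * chi (ξ i) x)
    (fun i => (integrable_chi μ (ξ i)).const_mul _) ?_
  · have h1 : ∀ x, ∑' i, a i * chi (ξ i) x = g x := fun x => (hg x).tsum_eq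
    simp only [h1, integral_const_mul] at h
    exact h
  · simpa [norm_chi] using ha

/-- `f` is given by the absolutely convergent Fourier series `∑ c_m e(n m · x)`. -/
structure HasFourier {k : ℕ} (f : (Fin k → ℝ) → ℝ) (n : ℕ) (c : (Fin k → ℤ) → ℂ) : Prop where
  summable : Summable fun m => ‖c m‖
  hasSum : ∀ x, HasSum (fun m => c m * chi ((n : ℤ) • m) x) (f x : ℂ)

namespace HasFourier

variable {k : ℕ} {f g : (Fin k → ℝ) → ℝ} {n n' : ℕ} {c c' : (Fin k → ℤ) → ℂ}

lemma continuous (h : HasFourier f n c) : Continuous f := by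
  have h1 : Continuous fun x => ∑' m, c m * chi ((n : ℤ) • m) x :=
    continuous_tsum (fun m => continuous_const.mul (continuous_chi _)) h.summable fun m x => by
      rw [norm_mul, norm_chi, mul_one]
  have h2 : f = fun x => (∑' m, c m * chi ((n : ℤ) • m) x).re := by
    funext x
    rw [(h.hasSum x).tsum_eq, Complex.ofReal_re]
  rw [h2]
  exact Complex.continuous_re.comp h1

lemma abs_le (h : HasFourier f n c) (x : Fin k → ℝ) : |f x| ≤ ∑' m, ‖c m‖ := by
  rw [← Real.norm_eq_abs, ← Complex.norm_real, ← (h.hasSum x).tsum_eq]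
  have : ∀ m, ‖c m * chi ((n : ℤ) • m) x‖ = ‖c m‖ := fun m => by rw [norm_mul, norm_chi, mul_one]
  refine (norm_tsum_le_tsum_norm (by simpa only [this] using h.summable)).trans (le_of_eq ?_)
  simp only [this]

lemma integrable_mul (h : HasFourier f n c) (h' : HasFourier g n' c') (μ : Measure (Fin k → ℝ))
    [IsProbabilityMeasure μ] : Integrable (fun x => f x * g x) μ := by
  refine (integrable_const ((∑' m, ‖c m‖) * ∑' m, ‖c' m‖)).mono'
    (h.continuous.mul h'.continuous).aestronglyMeasurable (Eventually.of_forall fun x => ?_)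
  rw [Real.norm_eq_abs, abs_mul]
  exact mul_le_mul (h.abs_le x) (h'.abs_le x) (abs_nonneg _) (tsum_nonneg fun _ => norm_nonneg _)

lemma hasSum_integral (h : HasFourier f n c) (μ : Measure (Fin k → ℝ)) [IsProbabilityMeasure μ] :
    HasSum (fun m => c m * muHat μ ((n : ℤ) • m)) ((∫ x, f x ∂μ : ℝ) : ℂ) := by
  rw [← integral_complex_ofReal]
  exact integral_of_hasSum_chi μ h.summable h.hasSum

lemma hasSum_mul (h : HasFourier f n c) (h' : HasFourier g n' c') (x : Fin k → ℝ) :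
    HasSum (fun p : (Fin k → ℤ) × (Fin k → ℤ) =>
      c p.1 * c' p.2 * chi ((n : ℤ) • p.1 + (n' : ℤ) • p.2) x) ((f x * g x : ℝ) : ℂ) := by
  have s1 : Summable fun m => ‖c m * chi ((n : ℤ) • m) x‖ := by
    simpa only [norm_mul, norm_chi, mul_one] using h.summable
  have s2 : Summable fun m => ‖c' m * chi ((n' : ℤ) • m) x‖ := by
    simpa only [norm_mul, norm_chi, mul_one] using h'.summable
  have s3 := summable_mul_of_summable_norm s1 s2
  have h1 := HasSum.mul (h.hasSum x) (h'.hasSum x) s3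
  have e : (fun p : (Fin k → ℤ) × (Fin k → ℤ) =>
      c p.1 * c' p.2 * chi ((n : ℤ) • p.1 + (n' : ℤ) • p.2) x) = fun p =>
      (c p.1 * chi ((n : ℤ) • p.1) x) * (c' p.2 * chi ((n' : ℤ) • p.2) x) := by
    funext p
    rw [chi_add]
    ring
  rw [e, Complex.ofReal_mul]
  exact h1

lemma hasSum_integral_mul (h : HasFourier f n c) (h' : HasFourier g n' c')
    (μ : Measure (Fin k → ℝ)) [IsProbabilityMeasure μ] :
    HasSum (fun p : (Fin k → ℤ) × (Fin k → ℤ) =>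
      c p.1 * c' p.2 * muHat μ ((n : ℤ) • p.1 + (n' : ℤ) • p.2))
      ((∫ x, f x * g x ∂μ : ℝ) : ℂ) := by
  rw [← integral_complex_ofReal]
  exact integral_of_hasSum_chi μ (a := fun p : (Fin k → ℤ) × (Fin k → ℤ) => c p.1 * c' p.2)
    (ξ := fun p => (n : ℤ) • p.1 + (n' : ℤ) • p.2)
    (h.summable.mul_norm h'.summable) (h.hasSum_mul h')

/-- Subtracting the constant term. -/
lemma sub_const (h : HasFourier f n c) {L : ℝ} (hL : c 0 = L) :
    HasFourier (fun x => f x - L) n (fun m => if m = 0 then 0 else c m) where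
  summable := by
    refine h.summable.of_nonneg_of_le (fun _ => norm_nonneg _) fun m => ?_
    split_ifs
    · simp
    · exact le_rfl
  hasSum x := by
    have h1 := (h.hasSum x).sub (hasSum_ite_eq (0 : Fin k → ℤ) (c 0))
    rw [hL] at h1
    push_cast
    convert! h1 using 2 with m
    split_ifs with hm
    · subst hm
      simp [chi_zero, hL]
    · simp

end HasFourier

instance (k : ℕ) : IsProbabilityMeasure (lam k) := ⟨by simp [lam, Real.volume_Icc_pi]⟩

lemma integral_exp_int {a : ℤ} (ha : a ≠ 0) :
    ∫ t in Set.Icc (0 : ℝ) 1, Complex.exp (2 * Real.pi * Complex.I * ((a : ℝ) * t : ℝ)) = 0 := by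
  rw [integral_Icc_eq_integral_Ioc, ← intervalIntegral.integral_of_le zero_le_one]
  have hc : (2 * Real.pi * Complex.I * a : ℂ) ≠ 0 := by
    simp [Real.pi_ne_zero, ha]
  have e : ∀ t : ℝ, Complex.exp (2 * Real.pi * Complex.I * ((a : ℝ) * t : ℝ)) =
      Complex.exp ((2 * Real.pi * Complex.I * a) * t) := fun t => by push_cast; ring_nf
  simp only [e]
  rw [integral_exp_mul_complex hc]
  have : Complex.exp (2 * Real.pi * Complex.I * a * ((1 : ℝ) : ℂ)) = 1 := by
    rw [Complex.exp_eq_one_iff]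
    exact ⟨a, by push_cast; ring⟩
  rw [this]
  simp

lemma chiR_eq_prod {k : ℕ} (ζ x : Fin k → ℝ) :
    chiR ζ x = ∏ j, Complex.exp (2 * Real.pi * Complex.I * (ζ j * x j : ℝ)) := by
  rw [chiR, ← Complex.exp_sum, dotProduct, Complex.ofReal_sum, Finset.mul_sum]

lemma muHat_lam {k : ℕ} {ξ : Fin k → ℤ} (hξ : ξ ≠ 0) : muHat (lam k) ξ = 0 := by
  obtain ⟨j, hj⟩ := Function.ne_iff.1 hξ
  have h1 : lam k = Measure.pi fun _ : Fin k => (volume : Measure ℝ).restrict (Set.Icc 0 1) := by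
    rw [lam, ← Set.pi_univ_Icc, volume_pi, Measure.restrict_pi_pi]
    rfl
  rw [muHat, h1]
  simp only [chi, chiR_eq_prod]
  rw [integral_fintype_prod_eq_prod (f := fun j t =>
    Complex.exp (2 * Real.pi * Complex.I * (((ξ j : ℝ) * t : ℝ) : ℂ)))]
  exact Finset.prod_eq_zero (Finset.mem_univ j) (integral_exp_int hj)

lemma integral_lam_eq {k : ℕ} {f : (Fin k → ℝ) → ℝ} {n : ℕ} (hn : 1 ≤ n) {c : (Fin k → ℤ) → ℂ}
    (h : HasFourier f n c) : ((∫ x, f x ∂(lam k) : ℝ) : ℂ) = c 0 := by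
  have h1 := h.hasSum_integral (lam k)
  refine h1.unique ?_
  have : ∀ m, m ≠ 0 → c m * muHat (lam k) ((n : ℤ) • m) = 0 := fun m hm => by
    rw [muHat_lam (smul_ne_zero (by omega) hm), mul_zero]
  convert! hasSum_single (0 : Fin k → ℤ) this using 1
  rw [smul_zero, muHat_zero, mul_one]

/-- The contribution of a pair of frequencies to the change of a correlation. -/
def pairTerm {k : ℕ} (μ : Measure (Fin k → ℝ)) (n n' : ℕ) (c c' : (Fin k → ℤ) → ℂ)
    (p : (Fin k → ℤ) × (Fin k → ℤ)) : ℝ :=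
  open Classical in
  if p.1 ≠ 0 ∧ p.2 ≠ 0 ∧ (n : ℤ) • p.1 + (n' : ℤ) • p.2 ≠ 0 then
    ‖c p.1‖ * ‖c' p.2‖ * ‖muHat μ ((n : ℤ) • p.1 + (n' : ℤ) • p.2)‖ else 0

lemma abs_correlation_sub_le {k : ℕ} (μ : Measure (Fin k → ℝ)) [IsProbabilityMeasure μ]
    {f g : (Fin k → ℝ) → ℝ} {n n' : ℕ} {c c' : (Fin k → ℤ) → ℂ} (h : HasFourier f n c)
    (h' : HasFourier g n' c') {L L' : ℝ} (hL : c 0 = L) (hL' : c' 0 = L') :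
    |∫ x, (f x - L) * (g x - L') ∂μ - ∫ x, (f x - L) * (g x - L') ∂(lam k)| ≤
      ∑' p, pairTerm μ n n' c c' p := by
  have h1 := (h.sub_const hL).hasSum_integral_mul (h'.sub_const hL') μ
  have h2 := (h.sub_const hL).hasSum_integral_mul (h'.sub_const hL') (lam k)
  have h3 := h1.sub h2
  rw [← Complex.ofReal_sub] at h3
  rw [← Real.norm_eq_abs, ← Complex.norm_real, ← h3.tsum_eq]
  have hterm : ∀ p : (Fin k → ℤ) × (Fin k → ℤ),
      ‖((if p.1 = 0 then 0 else c p.1) * (if p.2 = 0 then 0 else c' p.2) *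
        muHat μ ((n : ℤ) • p.1 + (n' : ℤ) • p.2) -
      (if p.1 = 0 then 0 else c p.1) * (if p.2 = 0 then 0 else c' p.2) *
        muHat (lam k) ((n : ℤ) • p.1 + (n' : ℤ) • p.2))‖ = pairTerm μ n n' c c' p := by
    intro p
    rw [pairTerm]
    by_cases e1 : p.1 = 0
    · simp [e1]
    by_cases e2 : p.2 = 0
    · simp [e2]
    by_cases e3 : (n : ℤ) • p.1 + (n' : ℤ) • p.2 = 0
    · rw [e3, muHat_zero, muHat_zero, sub_self, norm_zero, if_neg (by simp)]
    · rw [muHat_lam e3, mul_zero, sub_zero, if_neg e1, if_neg e2, if_pos ⟨e1, e2, e3⟩, norm_mul,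
        norm_mul]
  have hs : Summable fun p => pairTerm μ n n' c c' p := by
    refine (h.summable.mul_norm h'.summable).of_nonneg_of_le ?_ ?_
    · intro p
      rw [pairTerm]
      split_ifs
      · positivity
      · exact le_rfl
    · intro p
      rw [pairTerm, norm_mul]
      split_ifs
      · exact mul_le_of_le_one_right (by positivity) (norm_muHat_le μ _)
      · positivity
  refine (norm_tsum_le_tsum_norm (by simpa only [hterm] using hs)).trans (le_of_eq ?_)
  simp only [hterm]

lemma variance_eq {k : ℕ} (μ : Measure (Fin k → ℝ)) [IsProbabilityMeasure μ]
    {f : ℕ → (Fin k → ℝ) → ℝ} {c : ℕ → (Fin k → ℤ) → ℂ}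
    (h : ∀ n, 1 ≤ n → HasFourier (f n) n (c n)) (N : ℕ) :
    variance f N μ = ∑ n ∈ Finset.Icc 1 N, ∑ n' ∈ Finset.Icc 1 N,
      ∫ x, (f n x - ∫ z, f n z ∂(lam k)) * (f n' x - ∫ z, f n' z ∂(lam k)) ∂μ := by
  have hs : ∀ n ∈ Finset.Icc 1 N, HasFourier (fun x => f n x - ∫ z, f n z ∂(lam k)) n
      (fun m => if m = 0 then 0 else c n m) := fun n hn =>
    (h n (Finset.mem_Icc.1 hn).1).sub_const
      (integral_lam_eq (Finset.mem_Icc.1 hn).1 (h n (Finset.mem_Icc.1 hn).1)).symm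
  rw [variance]
  simp only [sq, Finset.sum_mul_sum]
  rw [integral_finsetSum _ fun n hn => integrable_finsetSum _ fun n' hn' =>
    (hs n hn).integrable_mul (hs n' hn') μ]
  refine Finset.sum_congr rfl fun n hn => ?_
  rw [integral_finsetSum _ fun n' hn' => (hs n hn).integrable_mul (hs n' hn') μ]

/-- A product of absolutely convergent series is an absolutely convergent multiple series. -/
lemma hasSum_prod_pi {𝕜 : Type*} [RCLike 𝕜] : ∀ {k : ℕ} (f : Fin k → ℤ → 𝕜)
    (_ : ∀ j, Summable fun t => ‖f j t‖),
    (Summable fun a : Fin k → ℤ => ‖∏ j, f j (a j)‖) ∧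
      HasSum (fun a : Fin k → ℤ => ∏ j, f j (a j)) (∏ j, ∑' t, f j t) := by
  intro k
  induction k with
  | zero =>
    intro f _
    simp only [Finset.univ_eq_empty, Finset.prod_empty]
    exact ⟨(hasSum_unique _).summable, hasSum_unique _⟩
  | succ k ih =>
    intro f hf
    obtain ⟨h1, h2⟩ := ih (fun j => f j.succ) fun j => hf j.succ
    have e1 := (hf 0).mul_norm h1
    have e2 := (hf 0).of_norm.hasSum.mul h2 e1.of_norm
    have e3 : ∀ q : ℤ × (Fin k → ℤ), ∏ j, f j ((Fin.consEquiv fun _ => ℤ) q j) =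
        f 0 q.1 * ∏ j : Fin k, f j.succ (q.2 j) := fun q => by
      rw [Fin.prod_univ_succ]
      rfl
    constructor
    · rw [← (Fin.consEquiv fun _ : Fin (k + 1) => ℤ).summable_iff]
      convert! e1 using 2 with q
      simp only [Function.comp_apply, e3]
    · rw [← (Fin.consEquiv fun _ : Fin (k + 1) => ℤ).hasSum_iff, Fin.prod_univ_succ]
      convert! e2 using 2 with q
      simp only [Function.comp_apply, e3]

/-- A summable weight on integer vectors. -/
def freqWeight {k : ℕ} (m : Fin k → ℤ) : ℝ := ∏ j, ((1 + |(m j : ℝ)|) ^ 2)⁻¹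

lemma freqWeight_nonneg {k : ℕ} (m : Fin k → ℤ) : 0 ≤ freqWeight m :=
  Finset.prod_nonneg fun _ _ => by positivity

lemma summable_inv_one_add_abs_sq : Summable fun t : ℤ => ((1 + |(t : ℝ)|) ^ 2)⁻¹ := by
  have h : Summable fun t : ℤ => ((t : ℝ) ^ 2)⁻¹ := by
    simpa using (Real.summable_one_div_int_pow (p := 2)).2 one_lt_two
  refine h.of_norm_bounded_eventually ?_
  rw [Filter.eventually_cofinite]
  refine (Set.finite_singleton (0 : ℤ)).subset fun t ht => ?_
  by_contra h0
  apply ht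
  have h1 : (0 : ℝ) < |(t : ℝ)| := by
    rw [abs_pos]; exact_mod_cast h0
  rw [Real.norm_eq_abs, abs_of_nonneg (by positivity), ← sq_abs (t : ℝ)]
  gcongr
  linarith

lemma summable_freqWeight (k : ℕ) : Summable fun m : Fin k → ℤ => freqWeight m := by
  have := (hasSum_prod_pi (fun (_ : Fin k) (t : ℤ) => ((1 + |(t : ℝ)|) ^ 2)⁻¹) fun _ => by
    simpa using summable_inv_one_add_abs_sq).2.summable
  exact this

/-- Rapid decay of the Fourier coefficients of a measure away from the line `ℝ (1, α)`. -/
def FourierDecay {d : ℕ} (α : Fin d → ℝ) (B : ℕ → ℝ) (μ : Measure (Fin (d + 1) → ℝ)) : Prop :=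
  ∀ (A : ℕ) (ξ : Fin (d + 1) → ℤ) (j : Fin d), |slope α ξ j| ^ A * ‖muHat μ ξ‖ ≤ B A

/-- Bounds for the Fourier coefficients `c n m` of `f_n` in terms of `L n = λ(f_n)`. -/
structure CoeffBound (d : ℕ) (τ : ℝ) (c : ℕ → (Fin (d + 1) → ℤ) → ℂ) (L : ℕ → ℝ) : Prop where
  zero : ∀ n, 1 ≤ n → c n 0 = L n
  norm_le : ∀ n, 1 ≤ n → ∀ m, ‖c n m‖ ≤ L n
  decay : ∀ A : ℕ, ∃ C : ℝ, 0 ≤ C ∧ ∀ n, 1 ≤ n → ∀ m j,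
    ‖c n m‖ * (1 + |(m j : ℝ)| / (n : ℝ) ^ (1 / ((d + 1 : ℕ) : ℝ) + τ)) ^ A ≤
      C * L n * (n : ℝ) ^ (2 + 2 * ((d + 1 : ℕ) : ℝ) * τ) * freqWeight m

lemma FourierDecay.nonneg {d : ℕ} (hd : 2 ≤ d) {α : Fin d → ℝ} {B : ℕ → ℝ}
    {μ : Measure (Fin (d + 1) → ℝ)} (h : FourierDecay α B μ) (A : ℕ) : 0 ≤ B A :=
  le_trans (by positivity) (h A 0 ⟨0, by omega⟩)

lemma FourierDecay.norm_le {d : ℕ} {α : Fin d → ℝ} {B : ℕ → ℝ}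
    {μ : Measure (Fin (d + 1) → ℝ)} (h : FourierDecay α B μ) {U : ℝ} (hU : 0 < U) (A : ℕ)
    {ξ : Fin (d + 1) → ℤ} {j : Fin d} (hj : U ≤ |slope α ξ j|) :
    ‖muHat μ ξ‖ ≤ B A * (U ^ A)⁻¹ := by
  rw [← div_eq_mul_inv, le_div_iff₀ (by positivity), mul_comm]
  refine le_trans ?_ (h A ξ j)
  gcongr

lemma CoeffBound.norm_le_of_cutoff_lt {d : ℕ} {τ : ℝ} {c : (Fin (d + 1) → ℤ) → ℂ} {L C : ℝ}
    {n : ℕ} (hn : 1 ≤ n) {A : ℕ} {m : Fin (d + 1) → ℤ} {j : Fin (d + 1)}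
    (h : ‖c m‖ * (1 + |(m j : ℝ)| / (n : ℝ) ^ (1 / ((d + 1 : ℕ) : ℝ) + τ)) ^ A ≤
      C * L * (n : ℝ) ^ (2 + 2 * ((d + 1 : ℕ) : ℝ) * τ) * freqWeight m)
    {T : ℝ} (hτ : 0 < τ) (hT : (n : ℝ) ≤ T) (hj : cutoff d τ n T < |(m j : ℝ)|) :
    ‖c m‖ ≤ C * L * (n : ℝ) ^ (2 + 2 * ((d + 1 : ℕ) : ℝ) * τ) * freqWeight m * ((T ^ τ) ^ A)⁻¹ := by
  have hn1 : (1 : ℝ) ≤ n := by exact_mod_cast hn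
  have hn0 : (0 : ℝ) < n := by linarith
  have hT0 : 0 < T := by linarith
  rw [← div_eq_mul_inv, le_div_iff₀ (by positivity)]
  refine le_trans ?_ h
  gcongr
  have h1 : T ^ τ ≤ |(m j : ℝ)| / (n : ℝ) ^ (1 / ((d + 1 : ℕ) : ℝ) + τ) := by
    rw [le_div_iff₀ (by positivity), Real.rpow_add hn0]
    refine le_trans ?_ hj.le
    rw [cutoff, two_mul, Real.rpow_add hT0]
    calc T ^ τ * ((n : ℝ) ^ (1 / ((d + 1 : ℕ) : ℝ)) * (n : ℝ) ^ τ)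
        ≤ T ^ τ * ((n : ℝ) ^ (1 / ((d + 1 : ℕ) : ℝ)) * T ^ τ) := by gcongr
      _ = _ := by ring
  linarith

lemma rpow_tail_le {d : ℕ} {τ : ℝ} (hτ1 : τ < 1 / ((d + 1 : ℕ) : ℝ)) {A : ℕ}
    (hA : 5 ≤ τ * A) {n n' : ℕ} (hn : 1 ≤ n) (hn' : 1 ≤ n') :
    (n : ℝ) ^ (2 + 2 * ((d + 1 : ℕ) : ℝ) * τ) * (n' : ℝ) ^ (2 + 2 * ((d + 1 : ℕ) : ℝ) * τ) *
      ((((n : ℝ) * n') ^ τ) ^ A)⁻¹ ≤ ((n : ℝ) * n') ^ (-(1 / 2 : ℝ)) := by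
  have hT := one_le_mul_cast hn hn'
  have hkτ : ((d + 1 : ℕ) : ℝ) * τ < 1 := by
    rwa [lt_div_iff₀ (by positivity), mul_comm] at hτ1
  rw [← Real.mul_rpow (Nat.cast_nonneg _) (Nat.cast_nonneg _), ← Real.rpow_natCast,
    ← Real.rpow_mul (by positivity), ← Real.rpow_neg (by positivity),
    ← Real.rpow_add (by positivity)]
  refine Real.rpow_le_rpow_of_exponent_le hT ?_
  linarith

lemma exists_tsum_pairTerm_le {d : ℕ} (hd : 2 ≤ d) {α : Fin d → ℝ} {τ : ℝ} (hτ : 0 < τ)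
    (hτ1 : τ < 1 / ((d + 1 : ℕ) : ℝ)) {c : ℕ → (Fin (d + 1) → ℤ) → ℂ} {L : ℕ → ℝ}
    (hc : CoeffBound d τ c L) (B : ℕ → ℝ) :
    ∃ K : ℝ, 0 ≤ K ∧ ∀ μ : Measure (Fin (d + 1) → ℝ), IsProbabilityMeasure μ →
      FourierDecay α B μ → ∀ n n' : ℕ, 1 ≤ n → 1 ≤ n' →
      ∑' p, pairTerm μ n n' (c n) (c n') p ≤
        L n * L n' * ((badSet α τ n n').card + K * ((n : ℝ) * n') ^ (-(1 / 2 : ℝ))) := by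
  classical
  obtain ⟨A, hA⟩ := exists_nat_ge (5 / τ)
  rw [div_le_iff₀ hτ, mul_comm] at hA
  obtain ⟨C₀, hC₀, hdec₀⟩ := hc.decay 0
  obtain ⟨C, hC, hdec⟩ := hc.decay A
  set S := ∑' m : Fin (d + 1) → ℤ, freqWeight m
  have hS0 : 0 ≤ S := tsum_nonneg freqWeight_nonneg
  set K₀ := C * C₀ + C₀ * C + C₀ * C₀ * |B A| with hK₀
  have hK₀0 : 0 ≤ K₀ := by positivity
  refine ⟨K₀ * (S * S), by positivity, fun μ _ hμ n n' hn hn' => ?_⟩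
  have hB0 := hμ.nonneg hd A
  have hT := one_le_mul_cast hn hn'
  have hn1 : (1 : ℝ) ≤ n := by exact_mod_cast hn
  have hn'1 : (1 : ℝ) ≤ n' := by exact_mod_cast hn'
  set T := (n : ℝ) * n' with hTdef
  have hT0 : 0 < T := by linarith
  have hnT : (n : ℝ) ≤ T := le_mul_of_one_le_right (by linarith) hn'1
  have hnT' : (n' : ℝ) ≤ T := le_mul_of_one_le_left (by linarith) hn1
  have hL : 0 ≤ L n := (norm_nonneg _).trans (hc.norm_le n hn 0)
  have hL' : 0 ≤ L n' := (norm_nonneg _).trans (hc.norm_le n' hn' 0)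
  set X := (n : ℝ) ^ (2 + 2 * ((d + 1 : ℕ) : ℝ) * τ)
  set X' := (n' : ℝ) ^ (2 + 2 * ((d + 1 : ℕ) : ℝ) * τ)
  set ρ := ((T ^ τ) ^ A)⁻¹
  have hρ0 : 0 ≤ ρ := by positivity
  have hXρ : X * X' * ρ ≤ T ^ (-(1 / 2 : ℝ)) := rpow_tail_le hτ1 hA hn hn'
  have h0 : ∀ m, ‖c n m‖ ≤ C₀ * L n * X * freqWeight m := fun m => by
    have := hdec₀ n hn m 0
    rwa [pow_zero, mul_one] at this
  have h0' : ∀ m, ‖c n' m‖ ≤ C₀ * L n' * X' * freqWeight m := fun m => by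
    have := hdec₀ n' hn' m 0
    rwa [pow_zero, mul_one] at this
  set P := L n * L n' * T ^ (-(1 / 2 : ℝ))
  have hP0 : 0 ≤ P := by positivity
  have hterm : ∀ p : (Fin (d + 1) → ℤ) × (Fin (d + 1) → ℤ), pairTerm μ n n' (c n) (c n') p ≤
      (if p ∈ badSet α τ n n' then L n * L n' else 0) +
        K₀ * P * (freqWeight p.1 * freqWeight p.2) := by
    intro p
    have hq := freqWeight_nonneg p.1
    have hq' := freqWeight_nonneg p.2
    have htail0 : 0 ≤ K₀ * P * (freqWeight p.1 * freqWeight p.2) := by positivity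
    rw [pairTerm]
    split_ifs with h1 h2 h2
    · have : ‖c n p.1‖ * ‖c n' p.2‖ * ‖muHat μ ((n : ℤ) • p.1 + (n' : ℤ) • p.2)‖ ≤
          L n * L n' * 1 := by
        gcongr
        · exact hc.norm_le n hn _
        · exact hc.norm_le n' hn' _
        · exact norm_muHat_le μ _
      linarith
    · rw [zero_add]
      have hgen : ∀ K₁, K₁ ≤ K₀ → L n * L n' * (X * X' * ρ) * K₁ * (freqWeight p.1 * freqWeight p.2)
          ≤ K₀ * P * (freqWeight p.1 * freqWeight p.2) := by
        intro K₁ hK₁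
        calc L n * L n' * (X * X' * ρ) * K₁ * (freqWeight p.1 * freqWeight p.2)
            ≤ L n * L n' * (X * X' * ρ) * K₀ * (freqWeight p.1 * freqWeight p.2) := by gcongr
          _ ≤ L n * L n' * T ^ (-(1 / 2 : ℝ)) * K₀ * (freqWeight p.1 * freqWeight p.2) := by gcongr
          _ = _ := by simp only [P]; ring
      by_cases c1 : ∃ j, cutoff d τ n T < |(p.1 j : ℝ)|
      · obtain ⟨j, hj⟩ := c1
        have e1 := CoeffBound.norm_le_of_cutoff_lt hn (hdec n hn p.1 j) hτ hnT hj
        calc _ ≤ (C * L n * X * freqWeight p.1 * ρ) * (C₀ * L n' * X' * freqWeight p.2) * 1 := by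
              gcongr
              · exact h0' _
              · exact norm_muHat_le μ _
          _ = L n * L n' * (X * X' * ρ) * (C * C₀) * (freqWeight p.1 * freqWeight p.2) := by ring
          _ ≤ _ := hgen _ (by
            have : 0 ≤ C₀ * C + C₀ * C₀ * |B A| := by positivity
            linarith)
      by_cases c2 : ∃ j, cutoff d τ n' T < |(p.2 j : ℝ)|
      · obtain ⟨j, hj⟩ := c2
        have e1 := CoeffBound.norm_le_of_cutoff_lt hn' (hdec n' hn' p.2 j) hτ hnT' hj
        calc _ ≤ (C₀ * L n * X * freqWeight p.1) * (C * L n' * X' * freqWeight p.2 * ρ) * 1 := by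
              gcongr
              · exact h0 _
              · exact norm_muHat_le μ _
          _ = L n * L n' * (X * X' * ρ) * (C₀ * C) * (freqWeight p.1 * freqWeight p.2) := by ring
          _ ≤ _ := hgen _ (by
            have : 0 ≤ C * C₀ + C₀ * C₀ * |B A| := by positivity
            linarith)
      push Not at c1 c2
      have c3 : ∃ j, T ^ τ < |slope α ((n : ℤ) • p.1 + (n' : ℤ) • p.2) j| := by
        by_contra hcon
        push Not at hcon
        refine h2 (mem_badSet.2 ⟨c1, c2, h1.1, h1.2.1, h1.2.2, fun j => ?_⟩)
        have := hcon j
        rwa [slope_comb, Int.cast_natCast, Int.cast_natCast] at this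
      obtain ⟨j, hj⟩ := c3
      have e1 := hμ.norm_le (by positivity) A hj.le
      calc _ ≤ (C₀ * L n * X * freqWeight p.1) * (C₀ * L n' * X' * freqWeight p.2) * (B A * ρ) := by
            gcongr
            · exact h0 _
            · exact h0' _
        _ = L n * L n' * (X * X' * ρ) * (C₀ * C₀ * B A) * (freqWeight p.1 * freqWeight p.2) := by
            ring
        _ ≤ _ := hgen _ (by
          have h3 : C₀ * C₀ * B A ≤ C₀ * C₀ * |B A| := by gcongr; exact le_abs_self _
          have : 0 ≤ C * C₀ + C₀ * C := by positivity
          linarith)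
    · have : 0 ≤ L n * L n' := by positivity
      linarith
    · linarith
  have hs1 : HasSum (fun p => if p ∈ badSet α τ n n' then L n * L n' else 0)
      ((badSet α τ n n').card * (L n * L n')) := by
    have : HasSum (fun p => if p ∈ badSet α τ n n' then L n * L n' else 0)
        (∑ p ∈ badSet α τ n n', if p ∈ badSet α τ n n' then L n * L n' else 0) :=
      hasSum_sum_of_ne_finset_zero fun p hp => if_neg hp
    rwa [Finset.sum_congr rfl fun p hp => if_pos hp, Finset.sum_const, nsmul_eq_mul] at this
  have hw := summable_freqWeight (d + 1)
  have hwn : Summable fun m : Fin (d + 1) → ℤ => ‖freqWeight m‖ := hw.norm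
  have hs2 : HasSum (fun p : (Fin (d + 1) → ℤ) × (Fin (d + 1) → ℤ) =>
      K₀ * P * (freqWeight p.1 * freqWeight p.2)) (K₀ * P * (S * S)) :=
    (HasSum.mul hw.hasSum hw.hasSum (summable_mul_of_summable_norm hwn hwn)).mul_left _
  have hs3 := hs1.add hs2
  have hnn : ∀ p, 0 ≤ pairTerm μ n n' (c n) (c n') p := fun p => by
    rw [pairTerm]; split_ifs <;> positivity
  have hs4 := Summable.of_nonneg_of_le hnn hterm hs3.summable
  refine (hs4.tsum_le_tsum hterm hs3.summable).trans (le_of_eq ?_)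
  rw [hs3.tsum_eq]
  simp only [P]
  ring

/-- The variance bound for all measures with the Fourier decay of a flat hyperplane piece. -/
theorem exists_variance_sub_le {d : ℕ} (hd : 2 ≤ d) {α : Fin d → ℝ} {ρ : ℝ} (hρ0 : 0 ≤ ρ)
    (hρ : omegaTwo α = (ρ : EReal)) :
    ∃ c₀ : ℝ, 0 < c₀ ∧ ∀ τ : ℝ, 0 < τ → τ < 1 / ((d + 1 : ℕ) : ℝ) →
      ∀ (f : ℕ → (Fin (d + 1) → ℝ) → ℝ) (c : ℕ → (Fin (d + 1) → ℤ) → ℂ) (C : ℝ),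
      (∀ n, 1 ≤ n → HasFourier (f n) n (c n)) →
      CoeffBound d τ c (fun n => ∫ x, f n x ∂(lam (d + 1))) →
      WeightBound d τ (fun n => ∫ x, f n x ∂(lam (d + 1))) C →
      ∀ B : ℕ → ℝ, ∀ e : ℝ, -1 / 2 + (ρ + 2) / ((d + 1 : ℕ) : ℝ) + c₀ * τ ≤ e →
      ∃ K : ℝ, 0 < K ∧ ∀ μ : Measure (Fin (d + 1) → ℝ), IsProbabilityMeasure μ →
        FourierDecay α B μ → ∀ N : ℕ,
        |variance f N μ - variance f N (lam (d + 1))| ≤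
          K * ∑ n ∈ Finset.Icc 1 N, ∑ n' ∈ Finset.Icc 1 N, (∫ x, f n x ∂(lam (d + 1))) *
            (∫ x, f n' x ∂(lam (d + 1))) * ((n : ℝ) * n') ^ e := by
  obtain ⟨c₀, hc₀, hcount⟩ := exists_sum_badSet_le hd hρ0 hρ
  refine ⟨c₀, hc₀, fun τ hτ hτ1 f c C hf hc hw B e he => ?_⟩
  obtain ⟨K₁, hK₁0, hK₁⟩ := hcount τ hτ hτ1 _ C hw e he
  obtain ⟨K₂, hK₂0, hK₂⟩ := exists_tsum_pairTerm_le hd (α := α) hτ hτ1 hc B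
  refine ⟨K₁ + K₂ + 1, by positivity, fun μ hμ hdec N => ?_⟩
  set L : ℕ → ℝ := fun n => ∫ x, f n x ∂(lam (d + 1))
  have hL0 : ∀ n, 0 ≤ L n := hw.nonneg
  change |_| ≤ (K₁ + K₂ + 1) * ∑ n ∈ Finset.Icc 1 N, ∑ n' ∈ Finset.Icc 1 N, L n * L n' * _
  have he' : -(1 / 2 : ℝ) ≤ e := by
    have : 0 ≤ (ρ + 2) / ((d + 1 : ℕ) : ℝ) := by positivity
    have : 0 ≤ c₀ * τ := by positivity
    linarith
  have hpair : ∀ n ∈ Finset.Icc 1 N, ∀ n' ∈ Finset.Icc 1 N,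
      |∫ x, (f n x - L n) * (f n' x - L n') ∂μ -
        ∫ x, (f n x - L n) * (f n' x - L n') ∂(lam (d + 1))| ≤
      L n * L n' * ((badSet α τ n n').card : ℝ) + K₂ * (L n * L n' * ((n : ℝ) * n') ^ e) := by
    intro n hn n' hn'
    have hn := (Finset.mem_Icc.1 hn).1
    have hn' := (Finset.mem_Icc.1 hn').1
    refine (abs_correlation_sub_le μ (hf n hn) (hf n' hn') (hc.zero n hn) (hc.zero n' hn')).trans ?_
    refine (hK₂ μ hμ hdec n n' hn hn').trans ?_
    have h1 := Real.rpow_le_rpow_of_exponent_le (one_le_mul_cast hn hn') he'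
    have h2 := hL0 n
    have h3 := hL0 n'
    change L n * L n' * _ ≤ _
    calc _ ≤ L n * L n' * ((badSet α τ n n').card + K₂ * ((n : ℝ) * n') ^ e) := by gcongr
      _ = _ := by ring
  rw [variance_eq μ hf, variance_eq (lam (d + 1)) hf, ← Finset.sum_sub_distrib]
  simp only [← Finset.sum_sub_distrib]
  set W := ∑ n ∈ Finset.Icc 1 N, ∑ n' ∈ Finset.Icc 1 N, L n * L n' * ((n : ℝ) * n') ^ e with hWdef
  have hW0 : 0 ≤ W := Finset.sum_nonneg fun n _ => Finset.sum_nonneg fun n' _ => by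
    have h2 := hL0 n
    have h3 := hL0 n'
    positivity
  calc _ ≤ ∑ n ∈ Finset.Icc 1 N, ∑ n' ∈ Finset.Icc 1 N,
        (L n * L n' * ((badSet α τ n n').card : ℝ) + K₂ * (L n * L n' * ((n : ℝ) * n') ^ e)) := by
        refine (Finset.abs_sum_le_sum_abs _ _).trans (Finset.sum_le_sum fun n hn => ?_)
        exact (Finset.abs_sum_le_sum_abs _ _).trans (Finset.sum_le_sum fun n' hn' =>
          hpair n hn n' hn')
    _ = ∑ n ∈ Finset.Icc 1 N, ∑ n' ∈ Finset.Icc 1 N, L n * L n' * ((badSet α τ n n').card : ℝ) +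
        K₂ * W := by
        simp only [Finset.sum_add_distrib, ← Finset.mul_sum, hWdef]
    _ ≤ K₁ * W + K₂ * W := by gcongr; exact hK₁ N
    _ ≤ (K₁ + K₂ + 1) * W := by linarith

section

open scoped FourierTransform SchwartzMap

/-! ### Fourier transforms of bump functions -/

/-- The Fourier transform `∫ b(u) e(t u) du` of a real function. -/
def bHat (b : ℝ → ℝ) (t : ℝ) : ℂ :=
  ∫ u, (b u : ℂ) * Complex.exp (2 * Real.pi * Complex.I * (t * u : ℝ))

lemma norm_exp_two_pi_I (t : ℝ) : ‖Complex.exp (2 * Real.pi * Complex.I * (t : ℝ))‖ = 1 := by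
  rw [show (2 * Real.pi * Complex.I * (t : ℝ) : ℂ) = ((2 * Real.pi * t : ℝ) : ℂ) * Complex.I by
    push_cast; ring, Complex.norm_exp_ofReal_mul_I]

lemma fourier_eq_bHat (b : ℝ → ℝ) (t : ℝ) : 𝓕 (fun u => (b u : ℂ)) t = bHat b (-t) := by
  rw [Real.fourier_real_eq_integral_exp_smul, bHat]
  refine integral_congr_ae (Eventually.of_forall fun u => ?_)
  simp only [smul_eq_mul]
  rw [mul_comm]
  congr 2
  push_cast
  ring

/-- A smooth compactly supported real function as a complex Schwartz function. -/
def toSchwartz {b : ℝ → ℝ} (hc : HasCompactSupport b) (hs : ContDiff ℝ ∞ b) : 𝓢(ℝ, ℂ) :=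
  HasCompactSupport.toSchwartzMap (f := fun u => (b u : ℂ)) (hc.comp_left Complex.ofReal_zero)
    (Complex.ofRealCLM.contDiff.comp hs)

lemma toSchwartz_apply {b : ℝ → ℝ} (hc : HasCompactSupport b) (hs : ContDiff ℝ ∞ b) (u : ℝ) :
    toSchwartz hc hs u = b u := rfl

lemma fourier_toSchwartz {b : ℝ → ℝ} (hc : HasCompactSupport b) (hs : ContDiff ℝ ∞ b) (t : ℝ) :
    𝓕 (toSchwartz hc hs) t = bHat b (-t) := by
  rw [← fourier_eq_bHat, SchwartzMap.fourier_coe]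
  rfl

lemma bHat_decay {b : ℝ → ℝ} (hc : HasCompactSupport b) (hs : ContDiff ℝ ∞ b) (A : ℕ) :
    ∃ C : ℝ, 0 ≤ C ∧ ∀ t, ‖bHat b t‖ * (1 + |t|) ^ A ≤ C := by
  have h := fun t : ℝ => SchwartzMap.one_add_le_sup_seminorm_apply (𝕜 := ℝ) (m := (A, 0)) (k := A)
    (n := 0) le_rfl le_rfl (𝓕 (toSchwartz hc hs)) t
  refine ⟨_, le_trans (by positivity) (h 0), fun t => ?_⟩
  have := h (-t)
  rw [norm_iteratedFDeriv_zero, fourier_toSchwartz, neg_neg, norm_neg, Real.norm_eq_abs,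
    mul_comm] at this
  exact this

lemma norm_bHat_le {b : ℝ → ℝ} (hb : ∀ u, 0 ≤ b u) (t : ℝ) : ‖bHat b t‖ ≤ ∫ u, b u := by
  refine (norm_integral_le_integral_norm _).trans (le_of_eq ?_)
  refine integral_congr_ae (Eventually.of_forall fun u => ?_)
  simp only [norm_mul, norm_exp_two_pi_I, mul_one, Complex.norm_real, Real.norm_eq_abs,
    abs_of_nonneg (hb u)]

lemma bHat_zero (b : ℝ → ℝ) : bHat b 0 = (∫ u, b u : ℝ) := by
  rw [bHat, ← integral_complex_ofReal]
  simp

lemma IsBump.nonneg {b : ℝ → ℝ} (hb : IsBump b) (u : ℝ) : 0 ≤ b u := (hb.mem_Icc u).1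

lemma IsBump.integral_pos {b : ℝ → ℝ} (hb : IsBump b) : 0 < ∫ u, b u := by
  obtain ⟨x, hx⟩ := hb.nonzero
  exact hb.smooth.continuous.integral_pos_of_hasCompactSupport_nonneg_nonzero hb.compact hb.nonneg hx

lemma bHat_comp_div (b : ℝ → ℝ) {r : ℝ} (hr : 0 < r) (t : ℝ) :
    bHat (fun u => b (u / r)) t = r * bHat b (r * t) := by
  have h := Measure.integral_comp_div
    (fun v : ℝ => (b v : ℂ) * Complex.exp (2 * Real.pi * Complex.I * (r * t * v : ℝ))) r
  rw [abs_of_pos hr] at h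
  rw [bHat, bHat, ← Complex.real_smul, ← h]
  refine integral_congr_ae (Eventually.of_forall fun u => ?_)
  simp only
  congr 4
  field_simp

lemma comp_div_smooth {b : ℝ → ℝ} (hs : ContDiff ℝ ∞ b) (r : ℝ) :
    ContDiff ℝ ∞ fun u => b (u / r) := hs.comp (contDiff_id.div_const r)

lemma comp_div_compact {b : ℝ → ℝ} (hc : HasCompactSupport b) {r : ℝ} (hr : 0 < r) :
    HasCompactSupport fun u => b (u / r) := by
  have := hc.comp_homeomorph (Homeomorph.mulRight₀ r⁻¹ (inv_ne_zero hr.ne'))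
  exact this

/-- Poisson summation for `∑_a b((u - a) / r)`. -/
lemma tsum_comp_sub_div {b : ℝ → ℝ} (hc : HasCompactSupport b) (hs : ContDiff ℝ ∞ b) {r : ℝ}
    (hr : 0 < r) (u : ℝ) :
    ∑' a : ℤ, ((b ((u - a) / r) : ℝ) : ℂ) =
      ∑' m : ℤ, (r * bHat b (-(r * m))) * Complex.exp (2 * Real.pi * Complex.I * (m * u : ℝ)) := by
  have h := SchwartzMap.tsum_eq_tsum_fourier
    (toSchwartz (comp_div_compact hc hr) (comp_div_smooth hs r)) u
  simp only [toSchwartz_apply] at h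
  rw [← (Equiv.neg ℤ).tsum_eq] at h
  simp only [Equiv.neg_apply, Int.cast_neg, ← sub_eq_add_neg] at h
  rw [h]
  refine tsum_congr fun m => ?_
  rw [fourier_toSchwartz, bHat_comp_div b hr, fourier_coe_apply]
  congr 1
  · rw [mul_neg]
  · congr 1
    push_cast
    ring

lemma summable_norm_bHat {b : ℝ → ℝ} (hc : HasCompactSupport b) (hs : ContDiff ℝ ∞ b) {r : ℝ}
    (hr : 0 < r) : Summable fun m : ℤ => ‖(r : ℂ) * bHat b (-(r * m))‖ := by
  obtain ⟨C, hC0, hC⟩ := bHat_decay hc hs 2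
  have hmin : 0 < min 1 r := lt_min one_pos hr
  refine (summable_inv_one_add_abs_sq.mul_left (r * (C / (min 1 r) ^ 2))).of_nonneg_of_le
    (fun _ => norm_nonneg _) fun m => ?_
  have h1 := hC (-(r * m))
  rw [norm_mul, Complex.norm_real, Real.norm_eq_abs, abs_of_pos hr, mul_assoc]
  gcongr
  rw [abs_neg, abs_mul, abs_of_pos hr] at h1
  rw [← div_eq_mul_inv, le_div_iff₀ (by positivity), le_div_iff₀ (by positivity), mul_assoc,
    ← mul_pow]
  refine le_trans ?_ h1
  gcongr
  have e1 : min 1 r ≤ 1 := min_le_left _ _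
  have e2 : min 1 r ≤ r := min_le_right _ _
  have := abs_nonneg (m : ℝ)
  nlinarith

lemma summable_comp_sub_div {b : ℝ → ℝ} (hc : HasCompactSupport b) {r : ℝ} (hr : 0 < r) (u : ℝ) :
    Summable fun a : ℤ => ‖b ((u - a) / r)‖ := by
  obtain ⟨R, hR⟩ := hc.isCompact.isBounded.subset_closedBall (0 : ℝ)
  apply summable_of_hasFiniteSupport
  have : (Function.support fun a : ℤ => ‖b ((u - a) / r)‖) ⊆
      Set.Icc ⌊u - R * r⌋ ⌈u + R * r⌉ := by
    intro a ha
    have h1 : b ((u - a) / r) ≠ 0 := by simpa using ha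
    have h2 := hR (subset_tsupport _ h1)
    rw [mem_closedBall_zero_iff, Real.norm_eq_abs, abs_div, abs_of_pos hr, div_le_iff₀ hr] at h2
    have h3 := abs_le.1 h2
    constructor
    · have : (⌊u - R * r⌋ : ℝ) ≤ a := (Int.floor_le _).trans (by linarith)
      exact_mod_cast this
    · have : (a : ℝ) ≤ ⌈u + R * r⌉ := le_trans (by linarith) (Int.le_ceil _)
      exact_mod_cast this
  exact (Set.finite_Icc _ _).subset this

/-- The Fourier coefficients of `boxFun`. -/
def boxCoeff {k : ℕ} (y : Fin k → ℝ) (n : ℕ) (s : Fin k → ℝ) (b : Fin k → ℝ → ℝ)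
    (m : Fin k → ℤ) : ℂ :=
  ∏ j, ((((n * s j : ℝ) : ℂ) * bHat (b j) (-(n * s j * m j))) *
    Complex.exp (2 * Real.pi * Complex.I * (m j * -y j : ℝ)))

lemma hasFourier_boxFun {k : ℕ} (y : Fin k → ℝ) {n : ℕ} (hn : 1 ≤ n) {s : Fin k → ℝ}
    (hs : ∀ j, 0 < s j) {b : Fin k → ℝ → ℝ} (hb : ∀ j, IsBump (b j)) :
    HasFourier (boxFun y n s b) n (boxCoeff y n s b) := by
  have hn0 : (0 : ℝ) < n := by exact_mod_cast hn
  have hr : ∀ j, 0 < n * s j := fun j => mul_pos hn0 (hs j)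
  have hsum := fun j => summable_norm_bHat (hb j).compact (hb j).smooth (hr j)
  have h1 := fun x : Fin k → ℝ => hasSum_prod_pi (fun j (m : ℤ) =>
    ((((n * s j : ℝ) : ℂ) * bHat (b j) (-(n * s j * m))) *
      Complex.exp (2 * Real.pi * Complex.I * (m * (n * x j - y j) : ℝ)))) fun j => by
      simpa only [norm_mul, norm_exp_two_pi_I, mul_one] using hsum j
  have h2 : ∀ (x : Fin k → ℝ) (m : Fin k → ℤ), ∏ j, ((((n * s j : ℝ) : ℂ) *
      bHat (b j) (-(n * s j * m j))) *
      Complex.exp (2 * Real.pi * Complex.I * (m j * (n * x j - y j) : ℝ))) =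
      boxCoeff y n s b m * chi ((n : ℤ) • m) x := by
    intro x m
    rw [boxCoeff, chi, chiR_eq_prod, ← Finset.prod_mul_distrib]
    refine Finset.prod_congr rfl fun j _ => ?_
    rw [mul_assoc _ (Complex.exp _) (Complex.exp _), ← Complex.exp_add]
    congr 2
    simp only [Pi.smul_apply, smul_eq_mul]
    push_cast
    ring
  constructor
  · have := (h1 0).1
    simp only [h2, norm_mul, norm_chi, mul_one] at this
    exact this
  · intro x
    have h3 := (h1 x).2
    simp only [h2] at h3
    convert! h3 using 1
    have h4 := (hasSum_prod_pi (fun j (a : ℤ) => b j ((n * x j - y j - a) / (n * s j)))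
      fun j => summable_comp_sub_div (hb j).compact (hr j) _).2.tsum_eq
    have h5 : boxFun y n s b x = ∏ j, ∑' a : ℤ, b j ((n * x j - y j - a) / (n * s j)) := by
      rw [← h4, boxFun]
      refine tsum_congr fun a => Finset.prod_congr rfl fun j _ => ?_
      congr 1
      have := (hs j).ne'
      field_simp
      ring
    rw [h5, Complex.ofReal_prod]
    refine Finset.prod_congr rfl fun j _ => ?_
    rw [Complex.ofReal_tsum]
    have := tsum_comp_sub_div (hb j).compact (hb j).smooth (hr j) (n * x j - y j)
    exact_mod_cast this

lemma HasFourier.sum {k : ℕ} {ι : Type*} (s : Finset ι) {f : ι → (Fin k → ℝ) → ℝ} {n : ℕ}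
    {c : ι → (Fin k → ℤ) → ℂ} (h : ∀ i ∈ s, HasFourier (f i) n (c i)) :
    HasFourier (fun x => ∑ i ∈ s, f i x) n (fun m => ∑ i ∈ s, c i m) where
  summable := by
    refine (summable_sum fun i hi => (h i hi).summable).of_nonneg_of_le (fun _ => norm_nonneg _)
      fun m => ?_
    exact norm_sum_le _ _
  hasSum x := by
    simp only [Finset.sum_mul, Complex.ofReal_sum]
    exact hasSum_sum fun i hi => (h i hi).hasSum x

end

/-! ### Fourier coefficients of admissible function systems -/

lemma distInt_int_add {u : ℝ} (h0 : 0 ≤ u) (h1 : u < 1 / 2) (a : ℤ) : distInt (a + u) = u := by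
  have hr : round ((a : ℝ) + u) = a := by
    rw [round_intCast_add, round_eq_zero_iff.2 ⟨by linarith, h1⟩, add_zero]
  rw [distInt, hr, add_sub_cancel_left, abs_of_nonneg h0]

lemma scaleInterval_subset {n : ℕ} {s : ℝ} (hs : 0 ≤ s) (core : Bool) :
    scaleInterval n s core ⊆ Set.Ico 0 (n * s) := by
  rw [scaleInterval]
  split_ifs
  · exact subset_rfl
  · exact Set.Ico_subset_Ico_left (by positivity)

lemma measurableSet_scaleInterval (n : ℕ) (s : ℝ) (core : Bool) :
    MeasurableSet (scaleInterval n s core) := by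
  rw [scaleInterval]
  split_ifs <;> exact measurableSet_Ico

lemma le_volume_scaleInterval {n : ℕ} {s : ℝ} (hs : 0 ≤ s) (core : Bool) :
    ENNReal.ofReal (n * s / 2) ≤ volume (scaleInterval n s core) := by
  have : 0 ≤ n * s := by positivity
  rw [scaleInterval]
  split_ifs <;> rw [Real.volume_Ico] <;> apply ENNReal.ofReal_le_ofReal <;> linarith

namespace AdmissibleSystem

variable {k : ℕ} {τ : ℝ} (S : AdmissibleSystem k τ)

/-- The bump functions used in `f_n`. -/
def bumpFn (n : ℕ) (i : Fin (S.size (block n))) (j : Fin k) : ℝ → ℝ :=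
  if S.core (block n) i j then S.w₁ else S.w₂

lemma isBump_bumpFn (n : ℕ) (i : Fin (S.size (block n))) (j : Fin k) : IsBump (S.bumpFn n i j) := by
  rw [bumpFn]
  split_ifs
  · exact S.bump₁
  · exact S.bump₂

/-- The Fourier coefficients of `f_n`. -/
def coeff (n : ℕ) (m : Fin k → ℤ) : ℂ :=
  ∑ i, boxCoeff S.y n (S.scale (block n) i) (S.bumpFn n i) m

lemma hasFourier_fn {n : ℕ} (hn : 1 ≤ n) : HasFourier (S.fn n) n (S.coeff n) :=
  HasFourier.sum Finset.univ fun i _ =>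
    hasFourier_boxFun S.y hn (S.scale_pos (block n) i) (S.isBump_bumpFn n i)

lemma fn_nonneg (n : ℕ) (x : Fin k → ℝ) : 0 ≤ S.fn n x :=
  Finset.sum_nonneg fun i _ => tsum_nonneg fun _ => Finset.prod_nonneg fun j _ =>
    (S.isBump_bumpFn n i j).nonneg _

/-- `λ(f_n)`. -/
def mean (n : ℕ) : ℝ := ∫ x, S.fn n x ∂(lam k)

lemma mean_nonneg (n : ℕ) : 0 ≤ S.mean n := integral_nonneg (S.fn_nonneg n)

/-- The mean value of one summand of `f_n`. -/
def boxMean (n : ℕ) (i : Fin (S.size (block n))) : ℝ :=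
  ∏ j, n * S.scale (block n) i j * ∫ u, S.bumpFn n i j u

lemma coeff_zero {n : ℕ} (hn : 1 ≤ n) : S.coeff n 0 = S.mean n :=
  (integral_lam_eq hn (S.hasFourier_fn hn)).symm

lemma mean_eq {n : ℕ} (hn : 1 ≤ n) : S.mean n = ∑ i, S.boxMean n i := by
  have h := S.coeff_zero hn
  rw [coeff] at h
  have h1 : ∀ i, boxCoeff S.y n (S.scale (block n) i) (S.bumpFn n i) 0 = S.boxMean n i := by
    intro i
    rw [boxCoeff, boxMean, Complex.ofReal_prod]
    refine Finset.prod_congr rfl fun j _ => ?_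
    simp [bHat_zero]
  simp only [h1] at h
  exact_mod_cast h.symm

lemma norm_boxCoeff_le (n : ℕ) (i : Fin (S.size (block n))) (m : Fin k → ℤ) :
    ‖boxCoeff S.y n (S.scale (block n) i) (S.bumpFn n i) m‖ ≤ S.boxMean n i := by
  rw [boxCoeff, norm_prod, boxMean]
  refine Finset.prod_le_prod (fun _ _ => norm_nonneg _) fun j _ => ?_
  have h0 : 0 ≤ n * S.scale (block n) i j := mul_nonneg (Nat.cast_nonneg _) (S.scale_pos _ _ _).le
  rw [norm_mul, norm_mul, norm_exp_two_pi_I, mul_one, Complex.norm_real, Real.norm_eq_abs,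
    abs_of_nonneg h0]
  gcongr
  exact norm_bHat_le (S.isBump_bumpFn n i j).nonneg _

lemma norm_coeff_le {n : ℕ} (hn : 1 ≤ n) (m : Fin k → ℤ) : ‖S.coeff n m‖ ≤ S.mean n := by
  rw [S.mean_eq hn]
  exact (norm_sum_le _ _).trans (Finset.sum_le_sum fun i _ => S.norm_boxCoeff_le n i m)

lemma exists_bump_decay (A : ℕ) : ∃ C : ℝ, 0 ≤ C ∧ ∀ (n : ℕ) (i : Fin (S.size (block n))) (j : Fin k)
    (t : ℝ), ‖bHat (S.bumpFn n i j) t‖ * (1 + |t|) ^ A ≤ C * ∫ u, S.bumpFn n i j u := by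
  obtain ⟨C₁, h₁, h₁'⟩ := bHat_decay S.bump₁.compact S.bump₁.smooth A
  obtain ⟨C₂, h₂, h₂'⟩ := bHat_decay S.bump₂.compact S.bump₂.smooth A
  have p₁ := S.bump₁.integral_pos
  have p₂ := S.bump₂.integral_pos
  refine ⟨C₁ / (∫ u, S.w₁ u) + C₂ / ∫ u, S.w₂ u, by positivity, fun n i j t => ?_⟩
  rw [bumpFn]
  split_ifs
  · refine (h₁' t).trans ?_
    rw [add_mul, div_mul_cancel₀ _ p₁.ne']
    have : 0 ≤ C₂ / (∫ u, S.w₂ u) * ∫ u, S.w₁ u := by positivity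
    linarith
  · refine (h₂' t).trans ?_
    rw [add_mul, div_mul_cancel₀ _ p₂.ne']
    have : 0 ≤ C₁ / (∫ u, S.w₁ u) * ∫ u, S.w₂ u := by positivity
    linarith

end AdmissibleSystem

lemma AdmissibleSystem.coeff_decay {d : ℕ} {τ : ℝ} (S : AdmissibleSystem (d + 1) τ) (A : ℕ) :
    ∃ C : ℝ, 0 ≤ C ∧ ∀ n, 1 ≤ n → ∀ m j,
      ‖S.coeff n m‖ * (1 + |(m j : ℝ)| / (n : ℝ) ^ (1 / ((d + 1 : ℕ) : ℝ) + τ)) ^ A ≤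
        C * S.mean n * (n : ℝ) ^ (2 + 2 * ((d + 1 : ℕ) : ℝ) * τ) * freqWeight m := by
  obtain ⟨C, hC0, hC⟩ := S.exists_bump_decay (A + 2)
  obtain ⟨c, C', hc0, -, hb⟩ := S.scale_bounds
  have hτ := S.tau_pos
  set c₁ := min c 1 with hc₁
  have hc₁0 : 0 < c₁ := lt_min hc0 one_pos
  set D := C / c₁ ^ (A + 2)
  have hD0 : 0 ≤ D := by positivity
  refine ⟨D ^ (d + 1), by positivity, fun n hn m j => ?_⟩
  have hn1 : (1 : ℝ) ≤ n := by exact_mod_cast hn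
  have hn0 : (0 : ℝ) < n := by linarith
  set H := (n : ℝ) ^ (1 / ((d + 1 : ℕ) : ℝ) + τ) with hH
  have hH1 : 1 ≤ H := Real.one_le_rpow hn1 (by positivity)
  have hH0 : 0 < H := by linarith
  set Y : ℝ := 1 + |(m j : ℝ)| / H
  have hHpow : ∏ _l : Fin (d + 1), H ^ 2 = (n : ℝ) ^ (2 + 2 * ((d + 1 : ℕ) : ℝ) * τ) := by
    rw [Finset.prod_const, Finset.card_univ, Fintype.card_fin, hH, ← pow_mul,
      ← Real.rpow_natCast, ← Real.rpow_mul hn0.le]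
    congr 1
    have : ((d + 1 : ℕ) : ℝ) ≠ 0 := by positivity
    rw [Nat.cast_mul]
    field_simp
    push_cast
    ring
  have hbox : ∀ i, ‖boxCoeff S.y n (S.scale (block n) i) (S.bumpFn n i) m‖ * Y ^ A ≤
      S.boxMean n i * (D ^ (d + 1) * (n : ℝ) ^ (2 + 2 * ((d + 1 : ℕ) : ℝ) * τ) * freqWeight m) := by
    intro i
    have hfac : ∀ l, ‖((((n * S.scale (block n) i l : ℝ) : ℂ) *
        bHat (S.bumpFn n i l) (-(n * S.scale (block n) i l * m l))) *
        Complex.exp (2 * Real.pi * Complex.I * (m l * -S.y l : ℝ)))‖ *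
        (1 + |(m l : ℝ)| / H) ^ A ≤
        (n * S.scale (block n) i l * ∫ u, S.bumpFn n i l u) *
          (D * H ^ 2 * ((1 + |(m l : ℝ)|) ^ 2)⁻¹) := by
      intro l
      set r := n * S.scale (block n) i l
      have hr0 : 0 < r := mul_pos hn0 (S.scale_pos _ _ _)
      have hrH : c₁ / H ≤ r := by
        have h1 := (hb n hn i l).1
        have h2 : c / H ≤ r := by
          calc c / H = n * (c * (n : ℝ) ^ (-(1 + 1 / ((d + 1 : ℕ) : ℝ) + τ))) := by
                rw [show -(1 + 1 / ((d + 1 : ℕ) : ℝ) + τ) = -1 + -(1 / ((d + 1 : ℕ) : ℝ) + τ) by ring,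
                  Real.rpow_add hn0, Real.rpow_neg_one, Real.rpow_neg hn0.le, ← hH]
                field_simp
            _ ≤ r := by simp only [r]; gcongr
        refine le_trans ?_ h2
        gcongr
        exact min_le_left _ _
      have hI := (S.isBump_bumpFn n i l).integral_pos
      set t := |(m l : ℝ)|
      have ht0 : 0 ≤ t := abs_nonneg _
      have hbound := hC n i l (-(r * m l))
      rw [abs_neg, abs_mul, abs_of_pos hr0] at hbound
      have h3 : c₁ * (1 + t / H) ≤ 1 + r * t := by
        have e1 : c₁ ≤ 1 := min_le_right _ _
        have e2 : c₁ / H * t ≤ r * t := by gcongr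
        have e3 : c₁ * (1 + t / H) = c₁ + c₁ / H * t := by ring
        linarith
      have h4 : ‖bHat (S.bumpFn n i l) (-(r * m l))‖ * (1 + t / H) ^ (A + 2) ≤
          D * ∫ u, S.bumpFn n i l u := by
        have : ‖bHat (S.bumpFn n i l) (-(r * m l))‖ * (c₁ * (1 + t / H)) ^ (A + 2) ≤
            C * ∫ u, S.bumpFn n i l u := le_trans (by gcongr) hbound
        rw [mul_pow] at this
        simp only [D]
        rw [div_mul_eq_mul_div, le_div_iff₀ (by positivity)]
        linarith
      have h5 : (1 + t) / H ≤ 1 + t / H := by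
        rw [add_div]
        gcongr
        exact (div_le_one hH0).2 hH1
      rw [norm_mul, norm_mul, norm_exp_two_pi_I, mul_one, Complex.norm_real, Real.norm_eq_abs,
        abs_of_pos hr0]
      have h6 : ‖bHat (S.bumpFn n i l) (-(r * m l))‖ * (1 + t / H) ^ A * ((1 + t) / H) ^ 2 ≤
          D * ∫ u, S.bumpFn n i l u := by
        refine le_trans ?_ h4
        rw [pow_add, ← mul_assoc]
        gcongr
      have h7 : ‖bHat (S.bumpFn n i l) (-(r * m l))‖ * (1 + t / H) ^ A ≤
          (D * ∫ u, S.bumpFn n i l u) * (H ^ 2 * ((1 + t) ^ 2)⁻¹) := by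
        rw [div_pow, ← mul_div_assoc, div_le_iff₀ (by positivity)] at h6
        rw [← mul_assoc, ← div_eq_mul_inv, le_div_iff₀ (by positivity)]
        exact h6
      calc r * ‖bHat (S.bumpFn n i l) (-(r * m l))‖ * (1 + t / H) ^ A
          = r * (‖bHat (S.bumpFn n i l) (-(r * m l))‖ * (1 + t / H) ^ A) := by ring
        _ ≤ r * ((D * ∫ u, S.bumpFn n i l u) * (H ^ 2 * ((1 + t) ^ 2)⁻¹)) := by gcongr
        _ = _ := by ring
    have hY : Y ^ A ≤ ∏ l, (1 + |(m l : ℝ)| / H) ^ A := by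
      have hone : ∀ l, 1 ≤ (1 + |(m l : ℝ)| / H) ^ A := fun l =>
        one_le_pow₀ (le_add_of_nonneg_right (by positivity))
      rw [← Finset.mul_prod_erase _ _ (Finset.mem_univ j)]
      refine le_mul_of_one_le_right (by positivity) ?_
      calc (1 : ℝ) = ∏ _l ∈ Finset.univ.erase j, 1 := by simp
        _ ≤ _ := Finset.prod_le_prod (fun _ _ => zero_le_one) fun l _ => hone l
    have hD : ∏ l, (D * H ^ 2 * ((1 + |(m l : ℝ)|) ^ 2)⁻¹) =
        D ^ (d + 1) * (n : ℝ) ^ (2 + 2 * ((d + 1 : ℕ) : ℝ) * τ) * freqWeight m := by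
      rw [Finset.prod_mul_distrib, Finset.prod_mul_distrib, hHpow, Finset.prod_const,
        Finset.card_univ, Fintype.card_fin, freqWeight]
    calc _ ≤ ‖boxCoeff S.y n (S.scale (block n) i) (S.bumpFn n i) m‖ *
          ∏ l, (1 + |(m l : ℝ)| / H) ^ A := by gcongr
      _ ≤ ∏ l, ((n * S.scale (block n) i l * ∫ u, S.bumpFn n i l u) *
          (D * H ^ 2 * ((1 + |(m l : ℝ)|) ^ 2)⁻¹)) := by
          rw [boxCoeff, norm_prod, ← Finset.prod_mul_distrib]
          exact Finset.prod_le_prod (fun _ _ => by positivity) fun l _ => hfac l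
      _ = _ := by
          rw [Finset.prod_mul_distrib, hD]
          rfl
  calc ‖S.coeff n m‖ * Y ^ A
      ≤ (∑ i, ‖boxCoeff S.y n (S.scale (block n) i) (S.bumpFn n i) m‖) * Y ^ A := by
        gcongr
        exact norm_sum_le _ _
    _ ≤ ∑ i, S.boxMean n i * (D ^ (d + 1) * (n : ℝ) ^ (2 + 2 * ((d + 1 : ℕ) : ℝ) * τ) * freqWeight m) := by
        rw [Finset.sum_mul]
        exact Finset.sum_le_sum fun i _ => hbox i
    _ = _ := by
        rw [← Finset.sum_mul, ← S.mean_eq hn]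
        ring

lemma AdmissibleSystem.coeffBound {d : ℕ} {τ : ℝ} (S : AdmissibleSystem (d + 1) τ) :
    CoeffBound d τ S.coeff S.mean where
  zero _ hn := S.coeff_zero hn
  norm_le _ hn m := S.norm_coeff_le hn m
  decay := S.coeff_decay

/-- Disjointness of the boxes bounds the sum of their volumes. -/
lemma AdmissibleSystem.sum_prod_scale_le {d : ℕ} {τ : ℝ} (S : AdmissibleSystem (d + 1) τ) :
    ∃ C : ℝ, 0 ≤ C ∧ ∀ n : ℕ, 2 ≤ n →
      ∑ i, ∏ j, ((n : ℝ) * S.scale (block n) i j) ≤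
        C * (n : ℝ) ^ (-1 + ((d + 1 : ℕ) : ℝ) * τ) := by
  obtain ⟨_, C, _, hC0, hb⟩ := S.scale_bounds
  refine ⟨2 ^ (d + 1) * C ^ (d + 1), by positivity, fun n hn => ?_⟩
  have hn1 : 1 ≤ n := by omega
  have hn2 : (2 : ℝ) ≤ n := by exact_mod_cast hn
  have hn0 : (0 : ℝ) < n := by linarith
  set I := Fin (S.size (block n))
  set s := S.scale (block n)
  have hs : ∀ i j, 0 < s i j := S.scale_pos (block n)
  set P : I → Set (Fin (d + 1) → ℝ) := fun i =>
    Set.pi Set.univ fun j => scaleInterval n (s i j) (S.core (block n) i j)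
  set R := C * (n : ℝ) ^ (-(1 / ((d + 1 : ℕ) : ℝ) - τ))
  have hR0 : 0 ≤ R := by positivity
  have hsR : ∀ i j, n * s i j ≤ R := by
    intro i j
    have h1 := (hb n hn1 i j).2
    calc (n : ℝ) * s i j ≤ n * (C * (n : ℝ) ^ (-(1 + 1 / ((d + 1 : ℕ) : ℝ) - τ))) := by gcongr
      _ = R := by
        rw [show -(1 + 1 / ((d + 1 : ℕ) : ℝ) - τ) = -1 + -(1 / ((d + 1 : ℕ) : ℝ) - τ) by ring,
          Real.rpow_add hn0, Real.rpow_neg_one]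
        simp only [R]
        field_simp
  have hhalf : ∀ i j, n * s i j ≤ 1 / 2 := by
    intro i j
    have := S.scale_le n hn1 i j
    calc (n : ℝ) * s i j ≤ n * (1 / (2 * n)) := by gcongr
      _ = 1 / 2 := by field_simp
  have hdisj : Pairwise (Function.onFun Disjoint P) := by
    intro i i' hii
    rw [Function.onFun, Set.disjoint_left]
    intro u hu hu'
    set a : Fin (d + 1) → ℤ := fun j => ⌈-S.y j⌉
    set x : Fin (d + 1) → ℝ := fun j => (S.y j + a j + u j) / n
    have hmem : ∀ i, u ∈ P i → x ∈ boxSet S.y n (s i) (S.core (block n) i) := by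
      intro i hu
      have hu1 : ∀ j, u j ∈ scaleInterval n (s i j) (S.core (block n) i j) := fun j =>
        hu j (Set.mem_univ j)
      have hu2 : ∀ j, 0 ≤ u j ∧ u j < 1 / 2 := fun j => by
        have := scaleInterval_subset (hs i j).le _ (hu1 j)
        exact ⟨this.1, this.2.trans_le (hhalf i j)⟩
      have hx : ∀ j, n * x j - S.y j = a j + u j := fun j => by
        simp only [x]; field_simp; ring
      refine ⟨⟨fun j => ?_, fun j => ?_⟩, fun j => ?_⟩
      · have h1 := Int.le_ceil (-S.y j)
        have h2 := (hu2 j).1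
        simp only [x, Pi.zero_apply]
        apply div_nonneg _ hn0.le
        simp only [a]
        linarith
      · have h1 := Int.ceil_lt_add_one (-S.y j)
        have h2 := (hu2 j).2
        simp only [x, Pi.one_apply]
        rw [div_le_one hn0]
        simp only [a]
        linarith
      · rw [hx, distInt_int_add (hu2 j).1 (hu2 j).2]
        exact hu1 j
    exact Set.disjoint_left.1 (S.disjoint n hn1 i i' hii) (hmem i hu) (hmem i' hu')
  have hmeas : ∀ i, MeasurableSet (P i) := fun i =>
    MeasurableSet.univ_pi fun j => measurableSet_scaleInterval _ _ _
  have hsub : (⋃ i, P i) ⊆ Set.pi Set.univ fun _ : Fin (d + 1) => Set.Ico (0 : ℝ) R := by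
    refine Set.iUnion_subset fun i u hu j _ => ?_
    have := scaleInterval_subset (hs i j).le _ (hu j (Set.mem_univ j))
    exact ⟨this.1, this.2.trans_le (hsR i j)⟩
  have hvol := measure_mono (μ := volume) hsub
  rw [measure_iUnion hdisj hmeas, tsum_fintype, volume_pi_pi] at hvol
  simp only [Real.volume_Ico, sub_zero, Finset.prod_const, Finset.card_univ, Fintype.card_fin] at hvol
  have hlow : ∀ i, ENNReal.ofReal (∏ j, (n * s i j / 2)) ≤ volume (P i) := by
    intro i
    rw [volume_pi_pi, ENNReal.ofReal_prod_of_nonneg fun j _ => by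
      have := (hs i j).le
      positivity]
    exact Finset.prod_le_prod' fun j _ => le_volume_scaleInterval (hs i j).le _
  have h1 : ENNReal.ofReal (∑ i, ∏ j, (n * s i j / 2)) ≤ ENNReal.ofReal (R ^ (d + 1)) := by
    rw [ENNReal.ofReal_sum_of_nonneg fun i _ => Finset.prod_nonneg fun j _ => by
      have := (hs i j).le
      positivity, ENNReal.ofReal_pow hR0]
    exact (Finset.sum_le_sum fun i _ => hlow i).trans hvol
  rw [ENNReal.ofReal_le_ofReal_iff (by positivity)] at h1
  have h2 : ∑ i, ∏ j, ((n : ℝ) * s i j) = 2 ^ (d + 1) * ∑ i, ∏ j, (n * s i j / 2) := by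
    rw [Finset.mul_sum]
    refine Finset.sum_congr rfl fun i _ => ?_
    rw [Finset.prod_div_distrib, Finset.prod_const, Finset.card_univ, Fintype.card_fin]
    field_simp
  have h3 : R ^ (d + 1) = C ^ (d + 1) * (n : ℝ) ^ (-1 + ((d + 1 : ℕ) : ℝ) * τ) := by
    simp only [R]
    rw [mul_pow, ← Real.rpow_natCast (_ ^ _), ← Real.rpow_mul hn0.le]
    congr 2
    have : ((d + 1 : ℕ) : ℝ) ≠ 0 := by positivity
    field_simp
    ring
  rw [h2, mul_assoc, ← h3]
  gcongr

lemma AdmissibleSystem.exists_weightBound {d : ℕ} {τ : ℝ} (S : AdmissibleSystem (d + 1) τ) :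
    ∃ C : ℝ, WeightBound d τ S.mean C := by
  obtain ⟨C, hC0, hC⟩ := S.sum_prod_scale_le
  have p₁ := S.bump₁.integral_pos
  have p₂ := S.bump₂.integral_pos
  set J := (∫ u, S.w₁ u) + ∫ u, S.w₂ u
  refine ⟨C * J ^ (d + 1) + S.mean 1, S.mean_nonneg, add_nonneg (by positivity) (S.mean_nonneg 1),
    fun n hn => ?_⟩
  have hn0 : (0 : ℝ) < n := by exact_mod_cast hn
  rcases Nat.lt_or_ge n 2 with h | h
  · obtain rfl : n = 1 := by omega
    have : 0 ≤ C * J ^ (d + 1) := by positivity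
    simp
    exact this
  · have h1 : S.mean n ≤ (∑ i, ∏ j, ((n : ℝ) * S.scale (block n) i j)) * J ^ (d + 1) := by
      rw [S.mean_eq hn, Finset.sum_mul]
      refine Finset.sum_le_sum fun i _ => ?_
      rw [AdmissibleSystem.boxMean, Finset.prod_mul_distrib]
      have h0 : 0 ≤ ∏ j, ((n : ℝ) * S.scale (block n) i j) := Finset.prod_nonneg fun j _ =>
        mul_nonneg hn0.le (S.scale_pos _ _ _).le
      refine mul_le_mul_of_nonneg_left ?_ h0
      calc ∏ j, ∫ u, S.bumpFn n i j u ≤ ∏ _j : Fin (d + 1), J := by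
            refine Finset.prod_le_prod (fun j _ => (S.isBump_bumpFn n i j).integral_pos.le)
              fun j _ => ?_
            rw [AdmissibleSystem.bumpFn]
            simp only [J]
            split_ifs <;> linarith
        _ = _ := by simp
    have h2 := S.mean_nonneg 1
    calc S.mean n ≤ (C * (n : ℝ) ^ (-1 + ((d + 1 : ℕ) : ℝ) * τ)) * J ^ (d + 1) := by
          refine h1.trans ?_
          gcongr
          exact hC n h
      _ = (C * J ^ (d + 1)) * (n : ℝ) ^ (-1 + ((d + 1 : ℕ) : ℝ) * τ) := by ring
      _ ≤ _ := by gcongr; linarith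

section

open scoped Convolution

/-! ### Fourier transforms of the measures near the hyperplane -/

/-- A smooth compactly supported non-negative function with positive integral. -/
structure IsProfile (ψ : ℝ → ℝ) : Prop where
  smooth : ContDiff ℝ ∞ ψ
  compact : HasCompactSupport ψ
  nonneg : ∀ t, 0 ≤ ψ t
  integral_pos : 0 < ∫ t, ψ t

lemma IsProfile.integrable {ψ : ℝ → ℝ} (h : IsProfile ψ) : Integrable ψ :=
  h.smooth.continuous.integrable_of_hasCompactSupport h.compact

lemma IsBump.isProfile_comp_div {b : ℝ → ℝ} (hb : IsBump b) {r : ℝ} (hr : 0 < r) :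
    IsProfile fun t => b (t / r) where
  smooth := comp_div_smooth hb.smooth r
  compact := comp_div_compact hb.compact hr
  nonneg _ := hb.nonneg _
  integral_pos := by
    rw [Measure.integral_comp_div, abs_of_pos hr]
    exact smul_pos hr hb.integral_pos

lemma IsProfile.integral_Icc {ψ : ℝ → ℝ} (h : IsProfile ψ) {B : ℝ} (hB : 0 < B) :
    IsProfile fun s => ∫ z in Set.Icc (-B) B, ψ (s - z) := by
  set f : ℝ → ℝ := Set.indicator (Set.Icc (-B) B) fun _ => 1
  have hf : Integrable f := (integrable_indicator_iff measurableSet_Icc).2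
    (by simp [IntegrableOn])
  have hcf : HasCompactSupport f :=
    HasCompactSupport.intro (isCompact_Icc (a := -B) (b := B)) fun x hx =>
      Set.indicator_of_notMem hx _
  have hconv : (fun s => ∫ z in Set.Icc (-B) B, ψ (s - z)) =
      f ⋆[ContinuousLinearMap.mul ℝ ℝ] ψ := by
    funext s
    rw [convolution_def, ← integral_indicator measurableSet_Icc]
    refine integral_congr_ae (Eventually.of_forall fun z => ?_)
    simp only [ContinuousLinearMap.mul_apply', f, Set.indicator]
    split_ifs <;> simp
  refine ⟨?_, ?_, fun s => setIntegral_nonneg measurableSet_Icc fun z _ => h.nonneg _, ?_⟩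
  · rw [hconv]
    exact h.compact.contDiff_convolution_right _ hf.locallyIntegrable h.smooth
  · rw [hconv]
    exact hcf.convolution _ h.compact
  · rw [hconv, integral_convolution _ hf h.integrable]
    have : ∫ z, f z = 2 * B := by
      simp only [f]
      rw [integral_indicator measurableSet_Icc]
      simp
      rw [max_eq_left (by linarith)]
      ring
    rw [this, ContinuousLinearMap.mul_apply']
    have := h.integral_pos
    positivity

/-- The probability measure with density proportional to `∏ ψ_j(x_j)`. -/
def productMeasure {k : ℕ} (ψ : Fin k → ℝ → ℝ) : Measure (Fin k → ℝ) :=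
  volume.withDensity fun x => ENNReal.ofReal ((∏ j, ψ j (x j)) / ∫ z : Fin k → ℝ, ∏ j, ψ j (z j))

section productMeasure

variable {k : ℕ} {ψ : Fin k → ℝ → ℝ}

lemma integral_prod_profile (ψ : Fin k → ℝ → ℝ) :
    ∫ z : Fin k → ℝ, ∏ j, ψ j (z j) = ∏ j, ∫ t, ψ j t :=
  integral_fintype_prod_volume_eq_prod ψ

lemma prod_integral_pos (h : ∀ j, IsProfile (ψ j)) : 0 < ∏ j, ∫ t, ψ j t :=
  Finset.prod_pos fun j _ => (h j).integral_pos

lemma isProbabilityMeasure_productMeasure (h : ∀ j, IsProfile (ψ j)) :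
    IsProbabilityMeasure (productMeasure ψ) := by
  constructor
  have hpos := prod_integral_pos h
  have hint : Integrable fun x : Fin k → ℝ => ∏ j, ψ j (x j) :=
    Integrable.fintype_prod fun j => (h j).integrable
  rw [productMeasure, withDensity_apply _ MeasurableSet.univ, Measure.restrict_univ,
    ← ofReal_integral_eq_lintegral_ofReal (hint.div_const _) (Eventually.of_forall fun x =>
      div_nonneg (Finset.prod_nonneg fun j _ => (h j).nonneg _) (by
        rw [integral_prod_profile]; exact hpos.le)), integral_div, div_self]
  · exact ENNReal.ofReal_one
  · rw [integral_prod_profile]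
    exact hpos.ne'

lemma integral_chiR_productMeasure (h : ∀ j, IsProfile (ψ j)) (ζ : Fin k → ℝ) :
    ∫ x, chiR ζ x ∂(productMeasure ψ) = ∏ j, bHat (ψ j) (ζ j) / ((∫ t, ψ j t : ℝ) : ℂ) := by
  have hpos := prod_integral_pos h
  have hcont : Continuous fun x : Fin k → ℝ => ∏ j, ψ j (x j) :=
    continuous_finsetProd _ fun j _ => (h j).smooth.continuous.comp (continuous_apply j)
  have hm : Measurable fun x : Fin k → ℝ =>
      ENNReal.ofReal ((∏ j, ψ j (x j)) / ∫ z : Fin k → ℝ, ∏ j, ψ j (z j)) :=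
    (hcont.measurable.div_const _).ennreal_ofReal
  rw [productMeasure, integral_withDensity_eq_integral_toReal_smul hm
    (Eventually.of_forall fun _ => ENNReal.ofReal_lt_top)]
  have e : ∀ x : Fin k → ℝ, (ENNReal.ofReal ((∏ j, ψ j (x j)) /
      ∫ z : Fin k → ℝ, ∏ j, ψ j (z j))).toReal • chiR ζ x =
      ∏ j, ((ψ j (x j) : ℂ) * Complex.exp (2 * Real.pi * Complex.I * (ζ j * x j : ℝ)) /
        ((∫ t, ψ j t : ℝ) : ℂ)) := by
    intro x
    rw [integral_prod_profile, ENNReal.toReal_ofReal (div_nonneg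
      (Finset.prod_nonneg fun j _ => (h j).nonneg _) hpos.le), chiR_eq_prod, Complex.real_smul,
      Finset.prod_div_distrib, Finset.prod_mul_distrib]
    push_cast
    ring
  simp only [e]
  rw [integral_fintype_prod_volume_eq_prod (fun j t =>
    (ψ j t : ℂ) * Complex.exp (2 * Real.pi * Complex.I * (ζ j * t : ℝ)) /
        ((∫ t, ψ j t : ℝ) : ℂ))]
  refine Finset.prod_congr rfl fun j _ => ?_
  rw [integral_div]
  rfl

lemma norm_integral_chiR_productMeasure_le (h : ∀ j, IsProfile (ψ j)) (ζ : Fin k → ℝ) (i : Fin k) :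
    ‖∫ x, chiR ζ x ∂(productMeasure ψ)‖ ≤ ‖bHat (ψ i) (ζ i)‖ / ∫ t, ψ i t := by
  rw [integral_chiR_productMeasure h, norm_prod, ← Finset.mul_prod_erase _ _ (Finset.mem_univ i)]
  have hfac : ∀ j, ‖bHat (ψ j) (ζ j) / ((∫ t, ψ j t : ℝ) : ℂ)‖ =
      ‖bHat (ψ j) (ζ j)‖ / ∫ t, ψ j t := fun j => by
    rw [norm_div, Complex.norm_real, Real.norm_eq_abs, abs_of_pos (h j).integral_pos]
  have hone : ∀ j, ‖bHat (ψ j) (ζ j)‖ / (∫ t, ψ j t) ≤ 1 := fun j =>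
    (div_le_one (h j).integral_pos).2 (norm_bHat_le (h j).nonneg _)
  simp only [hfac]
  refine mul_le_of_le_one_right (div_nonneg (norm_nonneg _) (h i).integral_pos.le) ?_
  exact Finset.prod_le_one (fun j _ => div_nonneg (norm_nonneg _) (h j).integral_pos.le)
    fun j _ => hone j

end productMeasure

namespace FlatData

variable {d : ℕ} {α : Fin d → ℝ} {c : ℝ} (D : FlatData α c)

/-- The one-dimensional factors of the density along the hyperplane. -/
def profile (j : Fin d) (s : ℝ) : ℝ :=
  ∫ z in Set.Icc (-D.B j) (D.B j), D.b j.castSucc ((s - z) / D.r j)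

lemma isProfile_profile (j : Fin d) : IsProfile (D.profile j) :=
  ((D.bump j.castSucc).isProfile_comp_div (D.r_pos j)).integral_Icc (D.B_pos j)

lemma volume_restrict_Icc :
    (volume : Measure (Fin d → ℝ)).restrict (Set.Icc (-D.B) D.B) =
      Measure.pi fun j => (volume : Measure ℝ).restrict (Set.Icc (-D.B j) (D.B j)) := by
  rw [← Set.pi_univ_Icc, volume_pi, Measure.restrict_pi_pi]
  rfl

lemma density₀_eq (s : Fin d → ℝ) : D.density₀ s = ∏ j, D.profile j (s j) := by
  rw [density₀, D.volume_restrict_Icc, integral_fintype_prod_eq_prod (f := fun j z =>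
    D.b j.castSucc ((s j - z) / D.r j))]
  rfl

lemma embed_castSucc (s : Fin d → ℝ) (j : Fin d) : embed s j.castSucc = s j := by
  simp [embed]

lemma embed_last (s : Fin d → ℝ) : embed s (Fin.last d) = 0 := by
  simp [embed]

lemma continuous_embed : Continuous (embed : (Fin d → ℝ) → Fin (d + 1) → ℝ) := by
  refine continuous_pi fun i => ?_
  refine Fin.lastCases ?_ (fun j => ?_) i
  · simp only [embed_last]
    exact continuous_const
  · simp only [embed_castSucc]
    exact continuous_apply j

lemma continuous_mollifier (η : ℝ) : Continuous (D.mollifier η) := by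
  unfold mollifier
  refine Continuous.mul (continuous_finsetProd _ fun j _ => ?_) ?_
  · exact (D.bump j.castSucc).smooth.continuous.comp ((continuous_apply _).div_const _)
  · exact (D.bump _).smooth.continuous.comp ((continuous_apply _).div_const _)

/-- The one-dimensional factors of the density `density η`. -/
def profileEta (η : ℝ) (j : Fin (d + 1)) : ℝ → ℝ :=
  Fin.lastCases (motive := fun _ => ℝ → ℝ) (fun t => D.b (Fin.last d) (t / η))
    (fun i => D.profile i) j

lemma profileEta_castSucc (η : ℝ) (j : Fin d) : D.profileEta η j.castSucc = D.profile j := by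
  simp [profileEta]

lemma profileEta_last (η : ℝ) : D.profileEta η (Fin.last d) = fun t => D.b (Fin.last d) (t / η) := by
  simp [profileEta]

lemma isProfile_profileEta {η : ℝ} (hη : 0 < η) (j : Fin (d + 1)) : IsProfile (D.profileEta η j) := by
  refine Fin.lastCases ?_ (fun i => ?_) j
  · rw [profileEta_last]
    exact (D.bump _).isProfile_comp_div hη
  · rw [profileEta_castSucc]
    exact D.isProfile_profile i

lemma density_eq (η : ℝ) (x : Fin (d + 1) → ℝ) : D.density η x = ∏ j, D.profileEta η j (x j) := by
  have hm : Continuous fun z => D.mollifier η (x - z) :=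
    (D.continuous_mollifier η).comp (continuous_const.sub continuous_id)
  rw [density, plate, integral_map continuous_embed.aemeasurable hm.aestronglyMeasurable]
  simp only [mollifier, Pi.sub_apply, embed_castSucc, embed_last, sub_zero]
  rw [integral_mul_const, Fin.prod_univ_castSucc, profileEta_last]
  congr 1
  simp only [profileEta_castSucc]
  exact D.density₀_eq fun j => x j.castSucc

lemma muEta_eq (η : ℝ) : D.muEta η = (productMeasure (D.profileEta η)).map D.motion := by
  rw [muEta, productMeasure]
  simp only [D.density_eq]

lemma muZero_eq : D.muZero = (productMeasure D.profile).map fun s => D.motion (embed s) := by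
  rw [muZero, productMeasure]
  simp only [D.density₀_eq]

lemma continuous_motion : Continuous D.motion := by
  unfold motion
  exact (Continuous.matrix_mulVec continuous_const continuous_id).add continuous_const

lemma isProbabilityMeasure_muEta {η : ℝ} (hη : 0 < η) : IsProbabilityMeasure (D.muEta η) := by
  have := isProbabilityMeasure_productMeasure (D.isProfile_profileEta hη)
  rw [muEta_eq]
  exact Measure.isProbabilityMeasure_map D.continuous_motion.aemeasurable

lemma isProbabilityMeasure_muZero : IsProbabilityMeasure D.muZero := by
  have := isProbabilityMeasure_productMeasure D.isProfile_profile
  rw [muZero_eq]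
  exact Measure.isProbabilityMeasure_map (D.continuous_motion.comp continuous_embed).aemeasurable

/-- The frequency in the coordinates of the hyperplane. -/
def rotate (ξ : Fin (d + 1) → ℤ) : Fin (d + 1) → ℝ := (fun j => (ξ j : ℝ)) ᵥ* D.R

lemma chi_motion (ξ : Fin (d + 1) → ℤ) (x : Fin (d + 1) → ℝ) :
    chi ξ (D.motion x) = chi ξ D.p * chiR (D.rotate ξ) x := by
  rw [chi, chi, chiR, chiR, chiR, ← Complex.exp_add, motion, dotProduct_add,
    Matrix.dotProduct_mulVec, rotate]
  congr 1
  push_cast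
  ring

lemma norm_muHat_muEta {η : ℝ} (ξ : Fin (d + 1) → ℤ) :
    ‖muHat (D.muEta η) ξ‖ = ‖∫ x, chiR (D.rotate ξ) x ∂(productMeasure (D.profileEta η))‖ := by
  rw [muHat, muEta_eq, integral_map D.continuous_motion.aemeasurable
    (continuous_chi ξ).aestronglyMeasurable]
  simp only [chi_motion]
  rw [integral_const_mul, norm_mul, norm_chi, one_mul]

lemma norm_muHat_muZero (ξ : Fin (d + 1) → ℤ) :
    ‖muHat D.muZero ξ‖ =
      ‖∫ x, chiR (fun j : Fin d => D.rotate ξ j.castSucc) x ∂(productMeasure D.profile)‖ := by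
  have hm : Continuous fun s => D.motion (embed s) := D.continuous_motion.comp continuous_embed
  rw [muHat, muZero_eq, integral_map hm.aemeasurable (continuous_chi ξ).aestronglyMeasurable]
  have e : ∀ s : Fin d → ℝ, chiR (D.rotate ξ) (embed s) =
      chiR (fun j : Fin d => D.rotate ξ j.castSucc) s := by
    intro s
    rw [chiR, chiR]
    congr 3
    rw [dotProduct, Fin.sum_univ_castSucc, embed_last, mul_zero, add_zero]
    simp only [embed_castSucc]
    rfl
  simp only [chi_motion, e]
  rw [integral_const_mul, norm_mul, norm_chi, one_mul]

lemma norm_muHat_muEta_le {η : ℝ} (hη : 0 < η) (ξ : Fin (d + 1) → ℤ) (i : Fin d) :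
    ‖muHat (D.muEta η) ξ‖ ≤ ‖bHat (D.profile i) (D.rotate ξ i.castSucc)‖ / ∫ t, D.profile i t := by
  rw [norm_muHat_muEta]
  have := norm_integral_chiR_productMeasure_le (D.isProfile_profileEta hη) (D.rotate ξ) i.castSucc
  rwa [profileEta_castSucc] at this

lemma norm_muHat_muZero_le (ξ : Fin (d + 1) → ℤ) (i : Fin d) :
    ‖muHat D.muZero ξ‖ ≤ ‖bHat (D.profile i) (D.rotate ξ i.castSucc)‖ / ∫ t, D.profile i t := by
  rw [norm_muHat_muZero]
  exact norm_integral_chiR_productMeasure_le D.isProfile_profile _ i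

lemma slope_eq (ξ : Fin (d + 1) → ℤ) (j : Fin d) :
    slope α ξ j = ∑ i : Fin d, (D.R j.succ i.castSucc - α j * D.R 0 i.castSucc) *
      D.rotate ξ i.castSucc := by
  have hRR : D.R * D.Rᵀ = 1 := (Matrix.mem_orthogonalGroup_iff _ _).1 D.R_mem
  have hξ : (fun j => (ξ j : ℝ)) = D.R *ᵥ D.rotate ξ := by
    rw [rotate, ← Matrix.mulVec_transpose, Matrix.mulVec_mulVec, hRR, Matrix.one_mulVec]
  have hcoord : ∀ a, (ξ a : ℝ) = ∑ b, D.R a b * D.rotate ξ b := fun a => by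
    have := congrFun hξ a
    exact this
  have hlast : D.R j.succ (Fin.last d) - α j * D.R 0 (Fin.last d) = 0 := by
    have h1 := fun a => congrFun D.R_last a
    simp only [Pi.smul_apply, smul_eq_mul, Matrix.mulVec_single_one, Matrix.col_apply] at h1
    have h2 := h1 j.succ
    have h3 := h1 0
    simp only [normal, Fin.cons_succ, Fin.cons_zero] at h2 h3
    set q := √(Fin.cons (1 : ℝ) α ⬝ᵥ Fin.cons (1 : ℝ) α)
    have hq : q ≠ 0 := by
      intro h0
      rw [h0, zero_mul] at h3
      exact zero_ne_one h3
    have : q * (D.R j.succ (Fin.last d) - α j * D.R 0 (Fin.last d)) = 0 := by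
      linear_combination h2 - α j * h3
    exact (mul_eq_zero.1 this).resolve_left hq
  rw [slope, hcoord, hcoord 0, Finset.mul_sum, ← Finset.sum_sub_distrib, Fin.sum_univ_castSucc]
  have e : ∀ b, D.R j.succ b * D.rotate ξ b - α j * (D.R 0 b * D.rotate ξ b) =
      (D.R j.succ b - α j * D.R 0 b) * D.rotate ξ b := fun b => by ring
  simp only [e, hlast, zero_mul, add_zero]

lemma exists_abs_slope_le (hd : 0 < d) : ∃ G : ℝ, 0 ≤ G ∧ ∀ ξ j, ∃ i : Fin d,
    |slope α ξ j| ≤ G * |D.rotate ξ i.castSucc| := by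
  set G := ∑ j : Fin d, ∑ i : Fin d, |D.R j.succ i.castSucc - α j * D.R 0 i.castSucc| with hG
  refine ⟨G, Finset.sum_nonneg fun _ _ => Finset.sum_nonneg fun _ _ => abs_nonneg _, fun ξ j => ?_⟩
  have : Nonempty (Fin d) := ⟨⟨0, hd⟩⟩
  obtain ⟨i, hi⟩ := Finite.exists_max fun i : Fin d => |D.rotate ξ i.castSucc|
  refine ⟨i, ?_⟩
  rw [D.slope_eq]
  calc _ ≤ ∑ l : Fin d, |D.R j.succ l.castSucc - α j * D.R 0 l.castSucc| *
        |D.rotate ξ i.castSucc| := by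
        refine (Finset.abs_sum_le_sum_abs _ _).trans (Finset.sum_le_sum fun l _ => ?_)
        rw [abs_mul]
        exact mul_le_mul_of_nonneg_left (hi l) (abs_nonneg _)
    _ = (∑ l : Fin d, |D.R j.succ l.castSucc - α j * D.R 0 l.castSucc|) *
        |D.rotate ξ i.castSucc| := by rw [Finset.sum_mul]
    _ ≤ _ := by
        gcongr
        exact Finset.single_le_sum (f := fun j : Fin d => ∑ i : Fin d,
          |D.R j.succ i.castSucc - α j * D.R 0 i.castSucc|)
          (fun _ _ => Finset.sum_nonneg fun _ _ => abs_nonneg _) (Finset.mem_univ j)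

lemma exists_fourierDecay_of_le (hd : 0 < d) : ∃ B : ℕ → ℝ, ∀ μ : Measure (Fin (d + 1) → ℝ),
    (∀ (ξ : Fin (d + 1) → ℤ) (i : Fin d), ‖muHat μ ξ‖ ≤
      ‖bHat (D.profile i) (D.rotate ξ i.castSucc)‖ / ∫ t, D.profile i t) → FourierDecay α B μ := by
  obtain ⟨G, hG0, hG⟩ := D.exists_abs_slope_le hd
  choose C hC0 hC using fun (A : ℕ) (i : Fin d) =>
    bHat_decay (D.isProfile_profile i).compact (D.isProfile_profile i).smooth A
  refine ⟨fun A => G ^ A * ∑ i, C A i / ∫ t, D.profile i t, fun μ hμ A ξ j => ?_⟩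
  obtain ⟨i, hi⟩ := hG ξ j
  have hI := (D.isProfile_profile i).integral_pos
  set t := D.rotate ξ i.castSucc
  have h1 : |t| ^ A * ‖muHat μ ξ‖ ≤ C A i / ∫ t, D.profile i t := by
    rw [le_div_iff₀ hI, mul_assoc]
    calc |t| ^ A * (‖muHat μ ξ‖ * ∫ t, D.profile i t)
        ≤ (1 + |t|) ^ A * ‖bHat (D.profile i) t‖ := by
          gcongr
          · linarith
          · exact (le_div_iff₀ hI).1 (hμ ξ i)
      _ = ‖bHat (D.profile i) t‖ * (1 + |t|) ^ A := mul_comm _ _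
      _ ≤ C A i := hC A i t
  calc |slope α ξ j| ^ A * ‖muHat μ ξ‖ ≤ (G * |t|) ^ A * ‖muHat μ ξ‖ := by gcongr
    _ = G ^ A * (|t| ^ A * ‖muHat μ ξ‖) := by rw [mul_pow]; ring
    _ ≤ G ^ A * ∑ i, C A i / ∫ t, D.profile i t := by
        gcongr
        exact h1.trans (Finset.single_le_sum (f := fun i => C A i / ∫ t, D.profile i t)
          (fun i _ => div_nonneg (hC0 A i) (D.isProfile_profile i).integral_pos.le)
          (Finset.mem_univ i))

end FlatData

end

/-! ### Expectations and the variance transference principle -/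

lemma eventually_exists_le_slope {d : ℕ} (hd : 2 ≤ d) {α : Fin d → ℝ} {ρ τ : ℝ} (hρ0 : 0 ≤ ρ)
    (hρ : omegaTwo α = (ρ : EReal)) (hτ : 0 < τ)
    (hsmall : (ρ + τ) * (1 / ((d + 1 : ℕ) : ℝ) + 2 * τ) + τ < 1) :
    ∀ᶠ n : ℕ in atTop, ∀ m : Fin (d + 1) → ℤ, m ≠ 0 →
      (∀ j, |(m j : ℝ)| ≤ cutoff d τ n n) → ∃ j, (n : ℝ) ^ τ ≤ |slope α ((n : ℤ) • m) j| := by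
  set w := ρ + τ
  set κ := 1 / ((d + 1 : ℕ) : ℝ)
  have hw0 : 0 ≤ w := by positivity
  obtain ⟨c, hc0, hc1, hc⟩ := exists_pairBound (α := α) (w := w) hw0 (by
    rw [hρ]; exact_mod_cast (by simp only [w]; linarith : ρ < w))
  have hlim : Tendsto (fun n : ℕ => (n : ℝ) ^ (1 - w * (κ + 2 * τ) - τ)) atTop atTop :=
    (tendsto_rpow_atTop (by linarith)).comp tendsto_natCast_atTop_atTop
  filter_upwards [hlim.eventually_ge_atTop (1 / c), eventually_ge_atTop 1] with n hn hn1 m hm hmX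
  have hn0 : (0 : ℝ) < n := by exact_mod_cast hn1
  obtain ⟨j, hj⟩ := exists_slope_lower_bound hd hw0 hc1 hc hm hmX
  refine ⟨j, ?_⟩
  rw [slope_smul, abs_mul, Int.cast_natCast, abs_of_pos hn0]
  have hX : cutoff d τ n n = (n : ℝ) ^ (κ + 2 * τ) := by rw [cutoff, ← Real.rpow_add hn0]
  rw [hX, ← Real.rpow_mul hn0.le] at hj
  rw [div_le_iff₀ hc0] at hn
  calc (n : ℝ) ^ τ = (n : ℝ) ^ τ * 1 := (mul_one _).symm
    _ ≤ (n : ℝ) ^ τ * ((n : ℝ) ^ (1 - w * (κ + 2 * τ) - τ) * c) := by gcongr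
    _ = n * (c * (n : ℝ) ^ ((κ + 2 * τ) * -w)) := by
        have : (n : ℝ) ^ τ * (n : ℝ) ^ (1 - w * (κ + 2 * τ) - τ) =
            n * (n : ℝ) ^ ((κ + 2 * τ) * -w) := by
          rw [← Real.rpow_add hn0, ← Real.rpow_one_add' hn0.le]
          · congr 1; ring
          · have : 1 + (κ + 2 * τ) * -w = 1 - w * (κ + 2 * τ) := by ring
            rw [this]
            linarith
        linear_combination c * this
    _ ≤ n * |slope α m j| := by gcongr

lemma mul_rpow_tail_le {d : ℕ} {τ : ℝ} (hτ1 : τ < 1 / ((d + 1 : ℕ) : ℝ)) {A : ℕ}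
    (hA : 6 ≤ τ * A) {L : ℕ → ℝ} {C : ℝ} (hL : WeightBound d τ L C) {n : ℕ} (hn : 1 ≤ n) :
    L n * (n : ℝ) ^ (2 + 2 * ((d + 1 : ℕ) : ℝ) * τ) * (((n : ℝ) ^ τ) ^ A)⁻¹ ≤
      C * (n : ℝ) ^ (-2 : ℝ) := by
  have hn1 : (1 : ℝ) ≤ n := by exact_mod_cast hn
  have hkτ : ((d + 1 : ℕ) : ℝ) * τ < 1 := by
    rwa [lt_div_iff₀ (by positivity), mul_comm] at hτ1
  have hC := hL.C_nonneg
  calc _ ≤ C * (n : ℝ) ^ (-1 + ((d + 1 : ℕ) : ℝ) * τ) *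
        (n : ℝ) ^ (2 + 2 * ((d + 1 : ℕ) : ℝ) * τ) * (((n : ℝ) ^ τ) ^ A)⁻¹ := by
        gcongr
        exact hL.le n hn
    _ = C * (n : ℝ) ^ ((-1 + ((d + 1 : ℕ) : ℝ) * τ) + (2 + 2 * ((d + 1 : ℕ) : ℝ) * τ) +
        -(τ * A)) := by
        have hn0 : (0 : ℝ) < n := by linarith
        rw [Real.rpow_add hn0 (_ + _), Real.rpow_add hn0 (-1 + _), Real.rpow_neg hn0.le (τ * A),
          Real.rpow_mul hn0.le, Real.rpow_natCast]
        ring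
    _ ≤ _ := by
        gcongr
        linarith

/-- The expectations for a measure on the hyperplane agree with those for Lebesgue measure up to
a summable error. -/
lemma summable_integral_sub {d : ℕ} (hd : 2 ≤ d) {α : Fin d → ℝ} {ρ τ : ℝ} (hρ0 : 0 ≤ ρ)
    (hρ : omegaTwo α = (ρ : EReal)) (hτ : 0 < τ) (hτ1 : τ < 1 / ((d + 1 : ℕ) : ℝ))
    (hsmall : (ρ + τ) * (1 / ((d + 1 : ℕ) : ℝ) + 2 * τ) + τ < 1)
    {f : ℕ → (Fin (d + 1) → ℝ) → ℝ} {c : ℕ → (Fin (d + 1) → ℤ) → ℂ} {L : ℕ → ℝ} {C : ℝ}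
    (hf : ∀ n, 1 ≤ n → HasFourier (f n) n (c n)) (hc : CoeffBound d τ c L)
    (hw : WeightBound d τ L C) {B : ℕ → ℝ} {μ : Measure (Fin (d + 1) → ℝ)}
    [IsProbabilityMeasure μ] (hμ : FourierDecay α B μ) :
    Summable fun n => |∫ x, f n x ∂μ - L n| := by
  obtain ⟨A, hA⟩ := exists_nat_ge (6 / τ)
  rw [div_le_iff₀ hτ, mul_comm] at hA
  obtain ⟨C₀, hC₀, hdec₀⟩ := hc.decay 0
  obtain ⟨C₁, hC₁, hdec₁⟩ := hc.decay A
  have hB0 := hμ.nonneg hd A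
  have hC := hw.C_nonneg
  set S := ∑' m : Fin (d + 1) → ℤ, freqWeight m
  set K := C₁ + C₀ * B A
  have hK : 0 ≤ K := by positivity
  have hbig : (fun n => |∫ x, f n x ∂μ - L n|) =O[atTop] fun n : ℕ => (n : ℝ) ^ (-2 : ℝ) := by
    refine IsBigO.of_bound (K * C * S) ?_
    filter_upwards [eventually_exists_le_slope hd hρ0 hρ hτ hsmall, eventually_ge_atTop 1]
      with n hslope hn
    have hn1 : (1 : ℝ) ≤ n := by exact_mod_cast hn
    have hn0 : (0 : ℝ) < n := by linarith
    have htail := mul_rpow_tail_le hτ1 hA hw hn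
    set X := (n : ℝ) ^ (2 + 2 * ((d + 1 : ℕ) : ℝ) * τ)
    set R := (((n : ℝ) ^ τ) ^ A)⁻¹
    have hL0 := hw.nonneg n
    have hX0 : 0 ≤ X := by positivity
    have hR0 : 0 ≤ R := by positivity
    have hterm : ∀ m, ‖c n m * muHat μ ((n : ℤ) • m) - (if m = 0 then (L n : ℂ) else 0)‖ ≤
        K * (C * (n : ℝ) ^ (-2 : ℝ)) * freqWeight m := by
      intro m
      have hfw := freqWeight_nonneg m
      by_cases hm : m = 0
      · rw [if_pos hm, hm, smul_zero, muHat_zero, hc.zero n hn, mul_one, sub_self, norm_zero]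
        exact mul_nonneg (by positivity) (freqWeight_nonneg _)
      have hgen : ‖c n m‖ * ‖muHat μ ((n : ℤ) • m)‖ ≤ K * (L n * X * R) * freqWeight m := by
        by_cases h1 : ∃ j, cutoff d τ n n < |(m j : ℝ)|
        · obtain ⟨j, hj⟩ := h1
          have e1 := CoeffBound.norm_le_of_cutoff_lt hn (hdec₁ n hn m j) hτ le_rfl hj
          calc _ ≤ (C₁ * L n * X * freqWeight m * R) * 1 := by
                gcongr
                exact norm_muHat_le μ _
            _ = C₁ * (L n * X * R) * freqWeight m := by ring
            _ ≤ _ := by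
                gcongr
                exact le_add_of_nonneg_right (by positivity)
        · push Not at h1
          obtain ⟨j, hj⟩ := hslope m hm h1
          have e1 := hμ.norm_le (by positivity) A hj
          have e2 : ‖c n m‖ ≤ C₀ * L n * X * freqWeight m := by
            have := hdec₀ n hn m 0
            rwa [pow_zero, mul_one] at this
          calc _ ≤ (C₀ * L n * X * freqWeight m) * (B A * R) := by gcongr
            _ = C₀ * B A * (L n * X * R) * freqWeight m := by ring
            _ ≤ _ := by
                gcongr
                exact le_add_of_nonneg_left hC₁
      rw [if_neg hm, sub_zero, norm_mul]
      exact hgen.trans (by gcongr)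
    have hsum := ((hf n hn).hasSum_integral μ).sub
      (hasSum_ite_eq (0 : Fin (d + 1) → ℤ) (L n : ℂ))
    have hbd := tsum_of_norm_bounded
      ((summable_freqWeight (d + 1)).hasSum.mul_left (K * (C * (n : ℝ) ^ (-2 : ℝ)))) hterm
    rw [hsum.tsum_eq, ← Complex.ofReal_sub, Complex.norm_real, Real.norm_eq_abs] at hbd
    rw [Real.norm_eq_abs, abs_abs, Real.norm_of_nonneg (by positivity)]
    exact hbd.trans_eq (by ring)
  exact summable_of_isBigO_nat (Real.summable_nat_rpow.2 (by norm_num)) hbig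

lemma sum_Icc_one_eq_sum_range (g : ℕ → ℝ) (N : ℕ) :
    ∑ n ∈ Finset.Icc 1 N, g n = ∑ i ∈ Finset.range N, g (i + 1) := by
  rw [Finset.range_eq_Ico, Finset.sum_Ico_add' g 0 N 1]
  rfl

lemma isLittleO_sum_mul_rpow {L : ℕ → ℝ} (hL : ∀ n, 0 ≤ L n) (hns : ¬ Summable L) {e : ℝ}
    (he : e < 0) :
    (fun N => ∑ n ∈ Finset.Icc 1 N, L n * (n : ℝ) ^ e) =o[atTop]
      fun N => ∑ n ∈ Finset.Icc 1 N, L n := by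
  simp only [sum_Icc_one_eq_sum_range]
  refine IsLittleO.sum_range ?_ (fun i => hL _) ?_
  · have h0 : Tendsto (fun i : ℕ => ((i + 1 : ℕ) : ℝ) ^ e) atTop (𝓝 0) :=
      ((tendsto_rpow_neg_atTop (neg_pos.2 he)).comp
        (tendsto_natCast_atTop_atTop.comp (tendsto_add_atTop_nat 1))).congr fun i => by
          simp
    have := (isBigO_refl (fun i => L (i + 1)) atTop).mul_isLittleO
      ((isLittleO_one_iff ℝ).2 h0)
    simpa only [mul_one] using this
  · exact (not_summable_iff_tendsto_nat_atTop_of_nonneg fun i => hL (i + 1)).1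
      fun h => hns ((summable_nat_add_iff 1).1 h)

lemma vtp_of_bounds {k : ℕ} {f : ℕ → (Fin k → ℝ) → ℝ} {μ : Measure (Fin k → ℝ)} {L : ℕ → ℝ}
    (hL : ∀ n, 0 ≤ L n) (hsum : Summable fun n => |∫ x, f n x ∂μ - L n|) {K e : ℝ} (he : e < 0)
    (hV : ∀ N, |variance f N μ - variance f N (lam k)| ≤
      K * (∑ n ∈ Finset.Icc 1 N, L n * (n : ℝ) ^ e) ^ 2) : VTP f μ := by
  set G : ℕ → ℝ := fun N => ∑ n ∈ Finset.Icc 1 N, L n * (n : ℝ) ^ e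
  set V : ℕ → ℝ := fun N => variance f N μ - variance f N (lam k)
  have hVG : V =O[atTop] fun N => G N ^ 2 := IsBigO.of_bound K (Eventually.of_forall fun N => by
    rw [Real.norm_eq_abs, Real.norm_of_nonneg (sq_nonneg _)]
    exact hV N)
  by_cases hs : Summable L
  · refine ⟨id, strictMono_id, 0, V, fun j => ?_, isLittleO_zero _ _, hVG.trans ?_⟩
    · simp [V]
    · refine IsBigO.of_bound ((∑' n, L n) ^ 2) (Eventually.of_forall fun N => ?_)
      rw [norm_one, mul_one, Real.norm_of_nonneg (sq_nonneg _)]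
      have hG0 : 0 ≤ G N := Finset.sum_nonneg fun n _ => mul_nonneg (hL n) (by positivity)
      gcongr
      refine (Finset.sum_le_sum fun n hn => ?_).trans
        (hs.sum_le_tsum (Finset.Icc 1 N) fun n _ => hL n)
      refine mul_le_of_le_one_right (hL n) (Real.rpow_le_one_of_one_le_of_nonpos ?_ he.le)
      exact_mod_cast (Finset.mem_Icc.1 hn).1
  · refine ⟨id, strictMono_id, V, 0, fun j => ?_, ?_, isBigO_zero _ _⟩
    · simp [V]
    set P : ℕ → ℝ := fun N => ∑ n ∈ Finset.Icc 1 N, L n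
    have hPtop : Tendsto P atTop atTop := by
      simp only [P, sum_Icc_one_eq_sum_range]
      exact (not_summable_iff_tendsto_nat_atTop_of_nonneg fun i => hL (i + 1)).1
        fun h => hs ((summable_nat_add_iff 1).1 h)
    have hPE : P =O[atTop] fun N => expectation f N μ := by
      set M := ∑' n, |∫ x, f n x ∂μ - L n|
      refine IsBigO.of_bound 2 ?_
      filter_upwards [hPtop.eventually_ge_atTop (2 * M)] with N hN
      have hdiff : |expectation f N μ - P N| ≤ M := by
        rw [expectation, ← Finset.sum_sub_distrib]
        exact (Finset.abs_sum_le_sum_abs _ _).trans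
          (hsum.sum_le_tsum _ fun n _ => abs_nonneg _)
      rw [Real.norm_of_nonneg (Finset.sum_nonneg fun n _ => hL n), Real.norm_eq_abs]
      have h1 := (abs_le.1 hdiff).1
      have h2 := le_abs_self (expectation f N μ)
      linarith
    exact hVG.trans_isLittleO
      (((isLittleO_sum_mul_rpow hL hs he).trans_isBigO hPE).pow two_pos)

end FlatVTP

end

theorem mainTheorem9 (d : ℕ) (hd : 2 ≤ d) (α : Fin d → ℝ) (c : ℝ) :
    -- the uniform bound for the deformed measures, with `k = d + 1`
    (FlatVTP.omegaTwo α < ⊤ →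
      ∃ C₀ : ℝ, 0 < C₀ ∧
        ∀ (D : FlatVTP.FlatData α c) (τ : ℝ) (S : FlatVTP.AdmissibleSystem (d + 1) τ),
          ∀ ε : ℝ, 0 < ε → ∃ K : ℝ, 0 < K ∧ ∀ η : ℝ, 0 < η → ∀ N : ℕ,
            |FlatVTP.variance S.fn N (D.muEta η)
                - FlatVTP.variance S.fn N (FlatVTP.lam (d + 1))| ≤
              K * ∑ n ∈ Finset.Icc 1 N, ∑ n' ∈ Finset.Icc 1 N,
                (∫ x, S.fn n x ∂(FlatVTP.lam (d + 1))) *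
                (∫ x, S.fn n' x ∂(FlatVTP.lam (d + 1))) *
                ((n : ℝ) * (n' : ℝ)) ^
                  ((2 * (FlatVTP.omegaTwo α).toReal + 4 - ((d + 1 : ℕ) : ℝ) + C₀ * τ + ε) /
                    (2 * ((d + 1 : ℕ) : ℝ)))) ∧
    -- the variance transference principle for the limiting measure on the hyperplane
    (2 * FlatVTP.omegaTwo α + 4 < ((d + 1 : ℕ) : EReal) →
      ∃ τ₀ : ℝ, 0 < τ₀ ∧
        ∀ (D : FlatVTP.FlatData α c) (τ : ℝ) (S : FlatVTP.AdmissibleSystem (d + 1) τ),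
          τ < τ₀ → FlatVTP.VTP S.fn D.muZero) := by
  have hk : (0 : ℝ) < ((d + 1 : ℕ) : ℝ) := by positivity
  have h0 := FlatVTP.omegaTwo_nonneg hd α
  constructor
  · intro hfin
    obtain ⟨ρ, hρ⟩ : ∃ ρ : ℝ, FlatVTP.omegaTwo α = (ρ : EReal) :=
      ⟨_, (EReal.coe_toReal hfin.ne (ne_bot_of_le_ne_bot EReal.zero_ne_bot h0)).symm⟩
    have hρ0 : 0 ≤ ρ := by rw [hρ] at h0; exact_mod_cast h0
    obtain ⟨c₀, hc₀, hvar⟩ := FlatVTP.exists_variance_sub_le hd hρ0 hρ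
    refine ⟨2 * ((d + 1 : ℕ) : ℝ) * c₀, by positivity, fun D τ S ε hε => ?_⟩
    obtain ⟨C, hC⟩ := S.exists_weightBound
    obtain ⟨B, hB⟩ := D.exists_fourierDecay_of_le (by omega)
    obtain ⟨K, hK0, hK⟩ := hvar τ S.tau_pos S.tau_lt S.fn S.coeff C (fun n hn => S.hasFourier_fn hn)
      S.coeffBound hC B ((2 * (FlatVTP.omegaTwo α).toReal + 4 - ((d + 1 : ℕ) : ℝ) +
        2 * ((d + 1 : ℕ) : ℝ) * c₀ * τ + ε) / (2 * ((d + 1 : ℕ) : ℝ))) (by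
          rw [hρ, EReal.toReal_coe, le_div_iff₀ (by positivity)]
          have : (-1 / 2 + (ρ + 2) / ((d + 1 : ℕ) : ℝ) + c₀ * τ) * (2 * ((d + 1 : ℕ) : ℝ)) =
              2 * ρ + 4 - ((d + 1 : ℕ) : ℝ) + 2 * ((d + 1 : ℕ) : ℝ) * c₀ * τ := by
            field_simp
            ring
          linarith)
    exact ⟨K, hK0, fun η hη N => hK _ (D.isProbabilityMeasure_muEta hη)
      (hB _ fun ξ i => D.norm_muHat_muEta_le hη ξ i) N⟩
  · intro hlt
    obtain ⟨ρ, hρ⟩ : ∃ ρ : ℝ, FlatVTP.omegaTwo α = (ρ : EReal) := by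
      refine ⟨_, (EReal.coe_toReal (fun h => ?_)
        (ne_bot_of_le_ne_bot EReal.zero_ne_bot h0)).symm⟩
      rw [h, EReal.mul_top_of_pos (by norm_num), EReal.top_add_of_ne_bot (by decide)] at hlt
      exact not_top_lt hlt
    have hρ0 : 0 ≤ ρ := by rw [hρ] at h0; exact_mod_cast h0
    have hlt' : 2 * ρ + 4 < ((d + 1 : ℕ) : ℝ) := by
      have e : ((2 * ρ + 4 : ℝ) : EReal) = 2 * (ρ : EReal) + 4 := rfl
      rw [hρ, ← e, ← EReal.coe_natCast] at hlt
      exact EReal.coe_lt_coe_iff.1 hlt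
    obtain ⟨c₀, hc₀, hvar⟩ := FlatVTP.exists_variance_sub_le hd hρ0 hρ
    set k : ℝ := ((d + 1 : ℕ) : ℝ)
    set g := k - (2 * ρ + 4) with hg
    have hg0 : 0 < g := sub_pos.2 hlt'
    refine ⟨min (g / (4 * k * c₀)) (1 / (4 * ρ + 8)), by positivity, fun D τ S hτ => ?_⟩
    have hτ0 := S.tau_pos
    obtain ⟨hτ1, hτ2⟩ := lt_min_iff.1 hτ
    rw [lt_div_iff₀ (by positivity)] at hτ1 hτ2
    obtain ⟨C, hC⟩ := S.exists_weightBound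
    obtain ⟨B, hB⟩ := D.exists_fourierDecay_of_le (by omega)
    have hdecay := hB D.muZero D.norm_muHat_muZero_le
    have hprob := D.isProbabilityMeasure_muZero
    obtain ⟨K, hK0, hK⟩ := hvar τ hτ0 S.tau_lt S.fn S.coeff C (fun n hn => S.hasFourier_fn hn)
      S.coeffBound hC B (-(g / (4 * k))) (by
        rw [← neg_div, le_div_iff₀ (by positivity)]
        have : (-1 / 2 + (ρ + 2) / k + c₀ * τ) * (4 * k) = -2 * g + τ * (4 * k * c₀) := by
          rw [hg]
          field_simp
          ring
        linarith)
    have hsmall : (ρ + τ) * (1 / k + 2 * τ) + τ < 1 := by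
      have hρk : ρ * (1 / k) ≤ 1 / 2 := by
        rw [mul_one_div, div_le_iff₀ hk]
        linarith
      have hk1 : 1 / k ≤ 1 := by
        rw [div_le_one hk]
        linarith
      have e1 : τ * (1 / k) ≤ τ := mul_le_of_le_one_right hτ0.le hk1
      have e2 : τ * τ ≤ τ := mul_le_of_le_one_right hτ0.le (S.tau_lt.le.trans hk1)
      nlinarith
    refine FlatVTP.vtp_of_bounds (K := K) S.mean_nonneg
      (FlatVTP.summable_integral_sub hd hρ0 hρ hτ0 S.tau_lt hsmall
        (fun n hn => S.hasFourier_fn hn) S.coeffBound hC hdecay)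
      (neg_neg_of_pos (by positivity : 0 < g / (4 * k))) fun N => ?_
    rw [← FlatVTP.sum_mul_rpow_pair]
    exact hK D.muZero hprob hdecay N
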